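/- Let $n\ge 2$, let $\xi\sim P$ be a random variable, let $f(\cdot;\xi):\mathbb R^n\to\mathbb R$ be twice differentiable for every $\xi$, and let $F(x)=\mathbb E_\xi f(x;\xi)$ be bounded below. Let $L_0,M_0,\delta>0$ and $L_1,G_0,G_1,M_1,K_0,K_1\ge 0$ and assume that for all $x,x'\in\mathbb R^n$ (with Euclidean and spectral norms): 1. ($(L_0,L_1)$-smoothness) $F$ is differentiable and $\|\nabla F(x)-\nabla F(x')\|\le (L_0+L_1\|\nabla F(x)\|)\|x-x'\|$ whenever $L_1\|x-x'\|\le 1$; 2. (gradient variance) $\mathbb E_\xi\nabla f(x;\xi)=\nabla F(x)$ and $\mathbb E_\xi\|\nabla f(x;\xi)-\nabla F(x)\|^2\le G_0^2+G_1^2\|\nabla F(x)\|^2$; 3. (second-order generalized smoothness and Hessian variance) $F$ is twice differentiable, $\|\nabla^2F(x)-\nabla^2F(x')\|\le (M_0+M_1\|\nabla F(x)\|)\|x-x'\|$ whenever $\|x-x'\|\le\delta$, $\mathbb E_\xi\nabla^2 f(x;\xi)=\nabla^2F(x)$ and $\mathbb E_\xi\|\nabla^2 f(x;\xi)-\nabla^2F(x)\|^2\le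 K_0^2+K_1^2\|\nabla F(x)\|^2$; 4. (averaged smoothness of the components) $\mathbb E_\xi\|\nabla f(x;\xi)-\nabla f(x';\xi)\|\le (L_0+L_1\|\nabla F(x)\|)\|x-x'\|$. Write $f(x;\mathcal S)=|\mathcal S|^{-1}\sum_{\xi\in\mathcal S}f(x;\xi)$ for a batch $\mathcal S$ of samples. For $\epsilon>0$ and $x_0\in\mathbb R^n$ the variance-reduced second-order trust region method (SOTRGS-VR) runs as follows, for $t=0,\dots,T-1$, with fresh i.i.d. samples from $P$ in every iteration. If $q\mid t$, draw a batch $\mathcal S_1$ and set $g_t=\nabla f(x_t;\mathcal S_1)$; otherwise draw a batch $\mathcal S_3$ and set $g_t=g_{t-1}+\nabla f(x_t;\mathcal S_3)-\nabla f(x_{t-1};\mathcal S_3)$. Draw a batch $\mathcal S_2$ and set $H_t=\nabla^2f(x_t;\mathcal S_2)$. Let $d_{t+1}$ be a global minimizer of $F(x_t)+g_t^Td+\tfrac12 d^TH_td$ over $\|d\|\le\Delta$, and set $x_{t+1}=x_t+d_{t+1}$. The parameters are $\Delta=\sqrt\epsilon$, $|\mathcal S_1|=\lceil\epsilon^{-2}\rceil$,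 $|\mathcal S_2|=\lceil 22\log(n)\epsilon^{-1}\rceil$, $|\mathcal S_3|=\lceil\epsilon^{-3/2}\rceil$, $q=\lceil\epsilon^{-1/2}\rceil$. Put $\Delta_F=F(x_0)-\inf F$. There is an $\epsilon_0>0$ depending only on $L_1,G_1,M_1,K_1,\delta$, and for all $a,b>0$ there is a constant $C>0$ depending only on $a,b$ and the constants $L_0,L_1,G_0,G_1,M_0,M_1,K_0,K_1,\delta$ (not on $n$, $P$, $f$, $x_0$, $\epsilon$, $T$), such that for every $0<\epsilon\le\epsilon_0$ and every integer $T\ge 1$ with $T\ge a\,\Delta_F\,\epsilon^{-3/2}$, $$\mathbb E\|\nabla F(x_{\bar t+1})\|\le C\epsilon,\qquad \mathbb E[\lambda_{\min}(\nabla^2F(x_{\bar t+1}))]\ge -C\sqrt\epsilon ,$$ where $\bar t$ is uniformly distributed on $\{0,\dots,T-1\}$ and independent of the iterates. Moreover, if also $T\le b\,\Delta_F\,\epsilon^{-3/2}$ and $\epsilon\le\Delta_F$, then the total number of samples drawn is at most $C\bigl(\Delta_F\epsilon^{-3}+\log(n)\,\Delta_F\epsilon^{-5/2}\bigr)$; that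 is, the sample complexity is $O(\Delta_F\epsilon^{-3}+\Delta_F\epsilon^{-5/2})$ up to the factor $\log n$ from $|\mathcal S_2|$. -/

import Mathlib

open MeasureTheory ProbabilityTheory
open scoped RealInnerProductSpace

namespace TrustRegion

/-- `ℝⁿ` with the Euclidean norm. -/
abbrev E (n : ℕ) : Type := EuclideanSpace ℝ (Fin n)

/-- The Hessian `∇²F(x)`, the derivative of the gradient, as a linear operator on `ℝⁿ`
(its norm is the spectral norm). -/
noncomputable def hessian {n : ℕ} (F : E n → ℝ) (x : E n) : E n →L[ℝ] E n :=
  fderiv ℝ (gradient F) x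

/-- `F` is twice differentiable on `ℝⁿ`. -/
def TwiceDifferentiable {n : ℕ} (F : E n → ℝ) : Prop :=
  Differentiable ℝ F ∧ Differentiable ℝ (gradient F)

/-- The smallest eigenvalue of a (symmetric) operator. -/
noncomputable def lambdaMin {n : ℕ} (A : E n →L[ℝ] E n) : ℝ :=
  sInf {c : ℝ | Module.End.HasEigenvalue (A : E n →ₗ[ℝ] E n) c}

/-- The objective `F(x) = 𝔼_ξ f(x; ξ)`, `ξ ∼ P`, is bounded below, and every component
`f(·; ξ)` is twice differentiable. -/
structure IsStochasticObjective {n : ℕ} {Ξ : Type*} [MeasurableSpace Ξ] (P : Measure Ξ)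
    (f : E n → Ξ → ℝ) (F : E n → ℝ) : Prop where
  measurable : ∀ x, Measurable (f x)
  twiceDifferentiable : ∀ s, TwiceDifferentiable (fun x => f x s)
  integrable : ∀ x, Integrable (f x) P
  eq_integral : ∀ x, F x = ∫ s, f x s ∂P
  bddBelow : BddBelow (Set.range F)

/-- `(L₀, L₁)`-smoothness. The constraint `‖x - x'‖ ≤ 1 / L₁` is written multiplicatively, so that
it is void for `L₁ = 0`. -/
def GeneralizedSmooth {n : ℕ} (F : E n → ℝ) (L₀ L₁ : ℝ) : Prop :=
  Differentiable ℝ F ∧ ∀ x x' : E n, L₁ * ‖x - x'‖ ≤ 1 →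
    ‖gradient F x - gradient F x'‖ ≤ (L₀ + L₁ * ‖gradient F x‖) * ‖x - x'‖

/-- The stochastic gradient is unbiased with `(G₀, G₁)`-bounded variance. -/
structure GradientVarianceBounded {n : ℕ} {Ξ : Type*} [MeasurableSpace Ξ] (P : Measure Ξ)
    (f : E n → Ξ → ℝ) (F : E n → ℝ) (G₀ G₁ : ℝ) : Prop where
  integrable : ∀ x, Integrable (fun s => gradient (fun y => f y s) x) P
  unbiased : ∀ x, ∫ s, gradient (fun y => f y s) x ∂P = gradient F x
  integrable_sq : ∀ x,
    Integrable (fun s => ‖gradient (fun y => f y s) x - gradient F x‖ ^ 2) P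
  variance_le : ∀ x,
    ∫ s, ‖gradient (fun y => f y s) x - gradient F x‖ ^ 2 ∂P
      ≤ G₀ ^ 2 + G₁ ^ 2 * ‖gradient F x‖ ^ 2

/-- Second-order generalized smoothness. -/
def SecondOrderGeneralizedSmooth {n : ℕ} (F : E n → ℝ) (δ M₀ M₁ : ℝ) : Prop :=
  TwiceDifferentiable F ∧ ∀ x x' : E n, ‖x - x'‖ ≤ δ →
    ‖hessian F x - hessian F x'‖ ≤ (M₀ + M₁ * ‖gradient F x‖) * ‖x - x'‖

/-- The stochastic Hessian is unbiased with `(K₀, K₁)`-bounded variance. -/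
structure HessianVarianceBounded {n : ℕ} {Ξ : Type*} [MeasurableSpace Ξ] (P : Measure Ξ)
    (f : E n → Ξ → ℝ) (F : E n → ℝ) (K₀ K₁ : ℝ) : Prop where
  integrable : ∀ x, Integrable (fun s => hessian (fun y => f y s) x) P
  unbiased : ∀ x, ∫ s, hessian (fun y => f y s) x ∂P = hessian F x
  integrable_sq : ∀ x,
    Integrable (fun s => ‖hessian (fun y => f y s) x - hessian F x‖ ^ 2) P
  variance_le : ∀ x,
    ∫ s, ‖hessian (fun y => f y s) x - hessian F x‖ ^ 2 ∂P
      ≤ K₀ ^ 2 + K₁ ^ 2 * ‖gradient F x‖ ^ 2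

/-- Averaged smoothness of the components. -/
def AveragedSmooth {n : ℕ} {Ξ : Type*} [MeasurableSpace Ξ] (P : Measure Ξ)
    (f : E n → Ξ → ℝ) (F : E n → ℝ) (L₀ L₁ : ℝ) : Prop :=
  ∀ x x' : E n,
    ∫ s, ‖gradient (fun y => f y s) x - gradient (fun y => f y s) x'‖ ∂P
      ≤ (L₀ + L₁ * ‖gradient F x‖) * ‖x - x'‖

/-- The batch function `f(x; S) = |S|⁻¹ ∑_{ξ ∈ S} f(x; ξ)` of a batch of `m` samples. -/
noncomputable def batchFun {n : ℕ} {Ξ : Type*} (f : E n → Ξ → ℝ) {m : ℕ} (S : Fin m → Ξ)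
    (x : E n) : ℝ :=
  (m : ℝ)⁻¹ * ∑ j, f x (S j)

/-- The quadratic model `m(d) = c + gᵀd + ½ dᵀBd`. -/
noncomputable def model {n : ℕ} (c : ℝ) (g : E n) (B : E n →L[ℝ] E n) (d : E n) : ℝ :=
  c + ⟪g, d⟫ + 1 / 2 * ⟪d, B d⟫

/-- `d` is a global solution of the trust region subproblem `min m(d)` subject to `‖d‖ ≤ Δ`. -/
def IsTrustRegionStep {n : ℕ} (c : ℝ) (g : E n) (B : E n →L[ℝ] E n) (Δ : ℝ) (d : E n) : Prop :=
  ‖d‖ ≤ Δ ∧ ∀ d' : E n, ‖d'‖ ≤ Δ → model c g B d ≤ model c g B d'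

/-- The parameters of the variance-reduced method: trust radius, sizes of the batches
`S₁` (gradient, at the start of an epoch), `S₂` (Hessian), `S₃` (gradient differences),
and epoch length `q`. -/
structure Params where
  radius : ℝ
  S₁ : ℕ
  S₂ : ℕ
  S₃ : ℕ
  q : ℕ

/-- The number of gradient samples drawn in iteration `t`. -/
def Params.gradBatch (p : Params) (t : ℕ) : ℕ :=
  if t % p.q = 0 then p.S₁ else p.S₃

/-- The total number of samples (for gradients and for Hessians) drawn in `T` iterations. -/
def Params.totalSamples (p : Params) (T : ℕ) : ℕ :=
  ∑ t ∈ Finset.range T, (p.gradBatch t + p.S₂)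

/-- The parameters `Δ = √ε`, `|S₁| = ε⁻²`, `|S₂| = 22 log(n) ε⁻¹`, `|S₃| = ε^(-3/2)`,
`q = ε^(-1/2)`, the integers being rounded up. -/
noncomputable def soParams (n : ℕ) (ε : ℝ) : Params where
  radius := √ε
  S₁ := ⌈ε ^ (-2 : ℝ)⌉₊
  S₂ := ⌈22 * Real.log n * ε⁻¹⌉₊
  S₃ := ⌈ε ^ (-3 / 2 : ℝ)⌉₊
  q := ⌈ε ^ (-1 / 2 : ℝ)⌉₊

/-- A run of `T` iterations of the variance-reduced second-order trust region method, started at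
`x₀`, on a probability space `(Ω, μ)`. The filtration `ℱ` records the randomness: `ℱ t` is what is
known before iteration `t`. In iteration `t` the fresh i.i.d. samples `gradSample t`
and `hessSample t` with law `P` are drawn. Any (measurable, possibly randomized) choice among the
global solutions of the subproblem is allowed. -/
structure Run {n : ℕ} {Ξ Ω : Type*} [MeasurableSpace Ξ] [mΩ : MeasurableSpace Ω]
    (P : Measure Ξ) (f : E n → Ξ → ℝ) (F : E n → ℝ) (x₀ : E n) (p : Params) (T : ℕ)
    (μ : Measure Ω) where
  /-- the history -/
  ℱ : Filtration ℕ mΩ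
  /-- the batch `S₁` or `S₃` of iteration `t` -/
  gradSample : (t : ℕ) → Fin (p.gradBatch t) → Ω → Ξ
  /-- the batch `S₂` of iteration `t` -/
  hessSample : (t : ℕ) → Fin p.S₂ → Ω → Ξ
  /-- the iterates -/
  x : ℕ → Ω → E n
  /-- the gradient estimators -/
  g : ℕ → Ω → E n
  /-- the Hessian estimators -/
  H : ℕ → Ω → (E n →L[ℝ] E n)
  gradSample_measurable : ∀ t < T, ∀ j, Measurable[ℱ (t + 1)] (gradSample t j)
  hessSample_measurable : ∀ t < T, ∀ j, Measurable[ℱ (t + 1)] (hessSample t j)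
  gradSample_law : ∀ t < T, ∀ j, μ.map (gradSample t j) = P
  hessSample_law : ∀ t < T, ∀ j, μ.map (hessSample t j) = P
  /-- the samples of one iteration are mutually independent -/
  samples_iIndep : ∀ t < T,
    iIndepFun (fun i : Fin (p.gradBatch t) ⊕ Fin p.S₂ =>
      Sum.elim (gradSample t) (hessSample t) i) μ
  /-- the samples of one iteration are jointly independent of the past -/
  samples_indep_past : ∀ t < T,
    Indep (⨆ i : Fin (p.gradBatch t) ⊕ Fin p.S₂,
      MeasurableSpace.comap (Sum.elim (gradSample t) (hessSample t) i) inferInstance) (ℱ t) μ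
  x_measurable : ∀ t ≤ T, Measurable[ℱ t] (x t)
  x_zero : ∀ ω, x 0 ω = x₀
  g_restart : ∀ t < T, t % p.q = 0 → ∀ ω,
    g t ω = gradient (batchFun f (fun j => gradSample t j ω)) (x t ω)
  g_spider : ∀ t, t + 1 < T → (t + 1) % p.q ≠ 0 → ∀ ω,
    g (t + 1) ω = g t ω
      + gradient (batchFun f (fun j => gradSample (t + 1) j ω)) (x (t + 1) ω)
      - gradient (batchFun f (fun j => gradSample (t + 1) j ω)) (x t ω)
  H_eq : ∀ t < T, ∀ ω, H t ω = hessian (batchFun f (fun j => hessSample t j ω)) (x t ω)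
  /-- `x_{t+1} = x_t + d_{t+1}` with a solution `d_{t+1}` of the subproblem with `B_t = H_t` -/
  step : ∀ t < T, ∀ ω,
    IsTrustRegionStep (F (x t ω)) (g t ω) (H t ω) p.radius (x (t + 1) ω - x t ω)

end TrustRegion

namespace TrustRegion

/-! ### The trust region subproblem -/

/-! Write `Δ = √ε`. A global solution `d` of the subproblem comes with a multiplier `lam ≥ 0`: `H d
+ g = -lam d`, `H + lam ≥ 0`, and `‖d‖ = Δ` unless `lam = 0`. Hence the model decreases by at least
`lam Δ² / 2`, while at the new point the gradient is at most `lam Δ` and the least Hessian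
eigenvalue at least `-lam`, up to Taylor remainders and estimation errors. Eliminating `lam`
(`step_progress`) bounds both `Δ ‖∇F(x_{t+1})‖` and `-Δ² λ_min(∇²F(x_{t+1}))` by `2 (F(x_t) -
F(x_{t+1}))` plus `O(Δ) ‖g - ∇F‖ + O(Δ²) ‖H - ∇²F‖ + O(Δ³)(1 + ‖∇F(x_t)‖)`. It remains to show that
the expected errors are `O(Δ²)` for gradients and `O(Δ)` for Hessians, times `1 + 𝔼‖∇F‖`, and to
telescope.

Hessian error: a mean of `m` independent centred symmetric operators has second moment `O(log n /
m)` times the individual one. This follows by symmetrization from a matrix Khintchine inequality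
(`sum_norm_sq_signedSum_le`), proved by estimating traces of even powers of a Rademacher series and
taking the power of order `log n`.

Gradient error: within an epoch, each fresh batch adds an increment centred given the past, so
second moments add. The increments are controlled by mean square smoothness of the components,
obtained by integrating the component Hessians along the step and using the Hessian variance bound
(`lintegral_centred_gradient_difference_le`).

All variances scale with `‖∇F‖²`, whereas only `𝔼‖∇F‖` can be absorbed at the end. Therefore squared
errors are divided by a weight `W`, affine in `‖∇F‖` and known before the batch is drawn, and `2a ≤
W + a² / W` returns to first moments (`lintegral_ofReal_le_of_sq`). For gradients `W` is frozen at
the start of the epoch. Since `q Δ ≤ 2`, generalized smoothness lets `‖∇F‖` vary over an epoch only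
by a factor `exp (2 L₁)` and an additive constant (`Assumptions.gradient_epoch_le`), so `W`
dominates all deviations of the epoch and is itself controlled by the gradient at the next iterate.

The resulting term `stepSlope * Δ³ * 𝔼‖∇F(x_{t+1})‖` is absorbed into the left side once `stepSlope
* ε ≤ 1/2`. As `stepSlope` involves only `L₁, G₁, M₁, K₁`, so does this restriction on `ε₀`. -/

theorem nonneg_of_forall_quadratic {p r : ℝ} (h : ∀ s : ℝ, 0 < s → s ≤ 1 → 0 ≤ s * p + s ^ 2 * r) :
    0 ≤ p := by
  by_contra! hp
  have hr : 0 < |r| + 1 := by positivity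
  have hs : 0 < min 1 (-p / (2 * (|r| + 1))) := lt_min one_pos (by apply div_pos <;> linarith)
  have h1 := h _ hs (min_le_left _ _)
  set s := min 1 (-p / (2 * (|r| + 1))) with hsdef
  have h2 : s * (2 * (|r| + 1)) ≤ -p := by
    rw [← le_div_iff₀ (by positivity)]; exact min_le_right _ _
  have h3 : 0 ≤ p + s * r := by
    by_contra! hlt
    nlinarith [mul_pos hs (neg_pos.mpr hlt)]
  nlinarith [le_abs_self r]

theorem model_sub_model {n : ℕ} (c : ℝ) (g : E n) (B : E n →L[ℝ] E n)
    (hB : (B : E n →ₗ[ℝ] E n).IsSymmetric) (d w : E n) :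
    model c g B w - model c g B d = ⟪B d + g, w - d⟫ + 1 / 2 * ⟪w - d, B (w - d)⟫ := by
  have h1 : ⟪w, B d⟫ = ⟪d, B w⟫ := by
    have := hB w d
    simp only [ContinuousLinearMap.coe_coe] at this
    rw [← this, real_inner_comm]
  have h2 : ⟪B d, w⟫ = ⟪d, B w⟫ := by rw [real_inner_comm, h1]
  have h3 : ⟪B d, d⟫ = ⟪d, B d⟫ := real_inner_comm _ _
  simp only [model, map_sub, inner_sub_left, inner_sub_right, inner_add_left, h1, h2, h3]
  ring

/-- The optimality conditions for a global solution of the trust region subproblem. -/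
theorem IsTrustRegionStep.exists_multiplier {n : ℕ} {c : ℝ} {g : E n} {B : E n →L[ℝ] E n}
    {Δ : ℝ} {d : E n} (hΔ : 0 < Δ) (hB : (B : E n →ₗ[ℝ] E n).IsSymmetric)
    (h : IsTrustRegionStep c g B Δ d) :
    ∃ lam : ℝ, 0 ≤ lam ∧ B d + g = -(lam • d) ∧ lam * ‖d‖ ^ 2 = lam * Δ ^ 2 ∧
      ∀ v, 0 ≤ ⟪v, B v⟫ + lam * ‖v‖ ^ 2 := by
  obtain ⟨hd, hmin⟩ := h
  have key : ∀ w : E n, ‖w‖ ≤ Δ → 0 ≤ ⟪B d + g, w - d⟫ + 1 / 2 * ⟪w - d, B (w - d)⟫ := by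
    intro w hw
    rw [← model_sub_model c g B hB]
    linarith [hmin w hw]
  -- First order condition along feasible directions; `s₀` rescales `v` so that the whole segment up
  -- to `d + s₀ v` is feasible.
  have first : ∀ v : E n, (∃ s₀ > 0, ∀ s : ℝ, 0 < s → s ≤ 1 → ‖d + (s * s₀) • v‖ ≤ Δ) →
      0 ≤ ⟪B d + g, v⟫ := by
    rintro v ⟨s₀, hs₀, hv⟩
    have := nonneg_of_forall_quadratic (p := s₀ * ⟪B d + g, v⟫)
      (r := s₀ ^ 2 * (1 / 2 * ⟪v, B v⟫)) (fun s hs hs1 => by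
        have := key _ (hv s hs hs1)
        simp only [add_sub_cancel_left, map_smul, inner_smul_left, inner_smul_right,
          RCLike.conj_to_real] at this
        linarith)
    exact nonneg_of_mul_nonneg_right this hs₀
  rcases hd.lt_or_eq with hlt | heq
  -- Interior solution: every direction is feasible, the gradient of the model vanishes, and the
  -- multiplier is `0`.
  · have feas : ∀ v : E n, ∃ s₀ > 0, ∀ s : ℝ, 0 < s → s ≤ 1 → ‖d + (s * s₀) • v‖ ≤ Δ := by
      intro v
      refine ⟨(Δ - ‖d‖) / (‖v‖ + 1), div_pos (by linarith) (by positivity), fun s hs hs1 => ?_⟩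
      have h1 : (Δ - ‖d‖) / (‖v‖ + 1) * ‖v‖ ≤ Δ - ‖d‖ := by
        rw [div_mul_eq_mul_div, div_le_iff₀ (by positivity)]
        nlinarith [norm_nonneg v]
      have h0 : 0 ≤ (Δ - ‖d‖) / (‖v‖ + 1) := div_nonneg (by linarith) (by positivity)
      calc ‖d + (s * ((Δ - ‖d‖) / (‖v‖ + 1))) • v‖
          ≤ ‖d‖ + ‖(s * ((Δ - ‖d‖) / (‖v‖ + 1))) • v‖ := norm_add_le _ _
        _ = ‖d‖ + s * ((Δ - ‖d‖) / (‖v‖ + 1) * ‖v‖) := by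
            rw [norm_smul, Real.norm_of_nonneg (by positivity)]; ring
        _ ≤ Δ := by nlinarith
    have hz : B d + g = 0 := by
      have := first (-(B d + g)) (feas _)
      rw [inner_neg_right, real_inner_self_eq_norm_sq] at this
      have h0 : ‖B d + g‖ ^ 2 = 0 := le_antisymm (by linarith) (by positivity)
      simpa using h0
    refine ⟨0, le_rfl, by simp [hz], by simp, fun v => ?_⟩
    obtain ⟨s₀, hs₀, hv⟩ := feas v
    have := key _ (hv 1 one_pos le_rfl)
    simp only [add_sub_cancel_left, map_smul, inner_smul_left, inner_smul_right, hz,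
          RCLike.conj_to_real, one_mul, inner_zero_left, mul_zero, zero_add] at this
    have h2 : 0 ≤ (s₀ * s₀ / 2) * ⟪v, B v⟫ := by linarith
    have := nonneg_of_mul_nonneg_right h2 (by positivity)
    simpa using this
  -- Boundary solution: `lam` is chosen to make `r + lam d` orthogonal to `d`.
  · set r := B d + g with hr
    set lam := -⟪r, d⟫ / Δ ^ 2 with hlam
    have hdd : ⟪d, d⟫ = Δ ^ 2 := by rw [real_inner_self_eq_norm_sq, heq]
    have hrd : ⟪r, d⟫ = -(lam * Δ ^ 2) := by rw [hlam]; field_simp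
    have feas : ∀ v : E n, ⟪d, v⟫ < 0 → ∃ s₀ > 0, ∀ s : ℝ, 0 < s → s ≤ 1 →
        ‖d + (s * s₀) • v‖ ≤ Δ := by
      intro v hv
      have hv1 : 0 < ‖v‖ ^ 2 + 1 := by positivity
      have hs₀ : 0 < -⟪d, v⟫ / (‖v‖ ^ 2 + 1) := div_pos (by linarith) hv1
      refine ⟨_, hs₀, fun s hs hs1 => ?_⟩
      set s₀ := -⟪d, v⟫ / (‖v‖ ^ 2 + 1)
      have h1 : s₀ * (‖v‖ ^ 2 + 1) = -⟪d, v⟫ := div_mul_cancel₀ _ hv1.ne'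
      rw [← sq_le_sq₀ (norm_nonneg _) hΔ.le, norm_add_sq_real, heq, inner_smul_right, norm_smul,
        Real.norm_of_nonneg (by positivity), mul_pow]
      have h2 : s * s₀ * ‖v‖ ^ 2 ≤ -⟪d, v⟫ := by
        nlinarith [mul_nonneg hs₀.le (sq_nonneg ‖v‖)]
      nlinarith [mul_le_mul_of_nonneg_left h2 (by positivity : 0 ≤ s * s₀),
        mul_pos (mul_pos hs hs₀) (neg_pos.mpr hv)]
    have hlam0 : 0 ≤ lam := by
      have := first (-d) (feas _ (by rw [inner_neg_right, hdd]; nlinarith))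
      rw [inner_neg_right, hrd, neg_neg] at this
      exact nonneg_of_mul_nonneg_left this (by positivity)
    have horth : ⟪r + lam • d, d⟫ = 0 := by
      rw [inner_add_left, inner_smul_left, hdd, hrd]; simp
    -- The direction `-(r + lam d)` is tangent to the sphere and may leave the ball. Tilting it
    -- inwards by `-η d` makes it feasible, and `η → 0` removes the cost.
    have hz : r + lam • d = 0 := by
      have hη : ∀ η : ℝ, 0 < η → ‖r + lam • d‖ ^ 2 ≤ η * (lam * Δ ^ 2) := by
        intro η hη
        have hneg : ⟪d, -(r + lam • d) - η • d⟫ < 0 := by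
          rw [inner_sub_right, inner_neg_right, inner_smul_right, hdd, real_inner_comm, horth]
          have : 0 < η * Δ ^ 2 := by positivity
          linarith
        have := first _ (feas _ hneg)
        have e1 : ⟪r, r + lam • d⟫ = ‖r + lam • d‖ ^ 2 := by
          rw [← real_inner_self_eq_norm_sq]
          conv_rhs => rw [inner_add_left, inner_smul_left, real_inner_comm, real_inner_comm _ d]
          rw [real_inner_comm, horth]; simp [real_inner_comm]
        rw [inner_sub_right, inner_neg_right, inner_smul_right, hrd, e1] at this
        linarith
      have h0 : ‖r + lam • d‖ ^ 2 ≤ 0 := by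
        apply le_of_forall_pos_le_add
        intro e he
        have hp : 0 < lam * Δ ^ 2 + 1 := by positivity
        have := hη (e / (lam * Δ ^ 2 + 1)) (by positivity)
        refine this.trans ?_
        rw [div_mul_eq_mul_div, div_le_iff₀ hp]
        nlinarith
      have h0' : ‖r + lam • d‖ ^ 2 = 0 := le_antisymm h0 (by positivity)
      simpa using h0'
    have hreq : r = -(lam • d) := eq_neg_of_add_eq_zero_left hz
    refine ⟨lam, hlam0, hreq, by rw [heq], ?_⟩
    -- The line through `d` along `v` meets the sphere again at `d + s v`. The two points have equal
    -- norm, so comparing the model there turns the linear term into `lam s² ‖v‖² / 2` and leaves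
    -- the curvature condition.
    have generic : ∀ v : E n, ⟪d, v⟫ ≠ 0 → 0 ≤ ⟪v, B v⟫ + lam * ‖v‖ ^ 2 := by
      intro v hv
      have hv0 : v ≠ 0 := by rintro rfl; simp at hv
      have hvn : 0 < ‖v‖ ^ 2 := by positivity
      set s := -(2 * ⟪d, v⟫ / ‖v‖ ^ 2) with hs
      have hsv : s * ‖v‖ ^ 2 = -(2 * ⟪d, v⟫) := by rw [hs]; field_simp
      have hs0 : s ≠ 0 := by
        intro h0; rw [h0] at hsv; apply hv; linarith
      have hw : ‖d + s • v‖ ≤ Δ := by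
        rw [← sq_le_sq₀ (norm_nonneg _) hΔ.le, norm_add_sq_real, heq, inner_smul_right, norm_smul,
          mul_pow, Real.norm_eq_abs, sq_abs]
        have : s ^ 2 * ‖v‖ ^ 2 = s * (s * ‖v‖ ^ 2) := by ring
        rw [this, hsv]; linarith
      have := key _ hw
      rw [hreq] at this
      simp only [add_sub_cancel_left, map_smul, inner_smul_left, inner_smul_right, inner_neg_left,
          RCLike.conj_to_real] at this
      have e : s * ⟪d, v⟫ = -(s ^ 2 * ‖v‖ ^ 2) / 2 := by
        have : s ^ 2 * ‖v‖ ^ 2 = s * (s * ‖v‖ ^ 2) := by ring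
        rw [this, hsv]; ring
      have h2 : 0 ≤ s ^ 2 / 2 * (⟪v, B v⟫ + lam * ‖v‖ ^ 2) := by
        have e2 : lam * (s * ⟪d, v⟫) = lam * (-(s ^ 2 * ‖v‖ ^ 2) / 2) := by rw [e]
        nlinarith
      exact nonneg_of_mul_nonneg_right h2 (by positivity)
    intro v
    by_cases hv : ⟪d, v⟫ = 0
    -- Directions orthogonal to `d` are limits of the generic directions `v + η d`.
    · have hcont : Filter.Tendsto (fun η : ℝ => ⟪v + η • d, B (v + η • d)⟫ + lam * ‖v + η • d‖ ^ 2)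
          (nhdsWithin 0 {0}ᶜ) (nhds (⟪v, B v⟫ + lam * ‖v‖ ^ 2)) := by
        have : Continuous (fun η : ℝ => ⟪v + η • d, B (v + η • d)⟫ + lam * ‖v + η • d‖ ^ 2) := by
          fun_prop
        have h0 := this.tendsto 0
        simp only [zero_smul, add_zero] at h0
        exact h0.mono_left nhdsWithin_le_nhds
      refine ge_of_tendsto hcont ?_
      filter_upwards [self_mem_nhdsWithin] with η hη
      apply generic
      rw [inner_add_right, hv, inner_smul_right, hdd, zero_add]
      exact mul_ne_zero hη (by positivity)
    · exact generic v hv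

/-! ### The smallest eigenvalue -/

/-- In finite dimension the infimum of the Rayleigh quotient is itself an eigenvalue. Bounding
everything below by `-‖A‖` makes the real-valued infima meaningful. -/
theorem lambdaMin_mul_le_inner {n : ℕ} (hn : 0 < n) {A : E n →L[ℝ] E n}
    (hA : (A : E n →ₗ[ℝ] E n).IsSymmetric) (v : E n) : lambdaMin A * ‖v‖ ^ 2 ≤ ⟪v, A v⟫ := by
  have : NeZero n := ⟨hn.ne'⟩
  rcases eq_or_ne v 0 with rfl | hv
  · simp
  have hev := hA.hasEigenvalue_iInf_of_finiteDimensional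
  have hbdd : BddBelow {c : ℝ | Module.End.HasEigenvalue (A : E n →ₗ[ℝ] E n) c} := by
    refine ⟨-‖A‖, fun c hc => ?_⟩
    obtain ⟨w, hw⟩ := hc.exists_hasEigenvector
    have h1 : A w = c • w := hw.apply_eq_smul
    have h2 := A.le_opNorm w
    rw [h1, norm_smul] at h2
    have h3 := le_of_mul_le_mul_right h2 (norm_pos_iff.mpr hw.2)
    exact neg_le_of_abs_le h3
  have hle : lambdaMin A ≤ ⟪v, A v⟫ / ‖v‖ ^ 2 := by
    refine (csInf_le hbdd hev).trans ?_
    have hb : BddBelow (Set.range fun x : { x : E n // x ≠ 0 } =>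
        (RCLike.re ⟪(A : E n →ₗ[ℝ] E n) x, (x : E n)⟫ / ‖(x : E n)‖ ^ 2 : ℝ)) := by
      refine ⟨-‖A‖, ?_⟩
      rintro _ ⟨x, rfl⟩
      have := A.rayleighQuotient_le_norm (x : E n)
      exact neg_le_of_abs_le this
    refine (ciInf_le hb ⟨v, hv⟩).trans (le_of_eq ?_)
    simp [real_inner_comm]
  rwa [le_div_iff₀ (by positivity)] at hle

theorem le_lambdaMin {n : ℕ} (hn : 0 < n) {A : E n →L[ℝ] E n}
    (hA : (A : E n →ₗ[ℝ] E n).IsSymmetric) {c : ℝ} (h : ∀ v, c * ‖v‖ ^ 2 ≤ ⟪v, A v⟫) :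
    c ≤ lambdaMin A := by
  have : NeZero n := ⟨hn.ne'⟩
  refine le_csInf ⟨_, hA.hasEigenvalue_iInf_of_finiteDimensional⟩ fun b hb => ?_
  obtain ⟨w, hw⟩ := hb.exists_hasEigenvector
  have h1 : A w = b • w := hw.apply_eq_smul
  have h2 := h w
  rw [h1, inner_smul_right, real_inner_self_eq_norm_sq] at h2
  have : 0 < ‖w‖ ^ 2 := by have := norm_pos_iff.mpr hw.2; positivity
  exact le_of_mul_le_mul_right h2 this

theorem neg_norm_mul_le_inner {n : ℕ} (A : E n →L[ℝ] E n) (v : E n) :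
    -‖A‖ * ‖v‖ ^ 2 ≤ ⟪v, A v⟫ := by
  have h1 := abs_real_inner_le_norm v (A v)
  have h2 := A.le_opNorm v
  have h3 := neg_abs_le ⟪v, A v⟫
  nlinarith [norm_nonneg v]

/-- Weyl's perturbation inequality: the quadratic forms of `A` and `B` differ by at most `‖A - B‖
‖v‖²`. -/
theorem lambdaMin_sub_norm_le {n : ℕ} (hn : 0 < n) {A B : E n →L[ℝ] E n}
    (hA : (A : E n →ₗ[ℝ] E n).IsSymmetric) (hB : (B : E n →ₗ[ℝ] E n).IsSymmetric) :
    lambdaMin A - ‖A - B‖ ≤ lambdaMin B := by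
  refine le_lambdaMin hn hB fun v => ?_
  have h1 := lambdaMin_mul_le_inner hn hA v
  have h2 := neg_norm_mul_le_inner (B - A) v
  rw [norm_sub_rev] at h2
  rw [_root_.sub_apply, inner_sub_right] at h2
  linarith

/-! ### Second order calculus -/

theorem TwiceDifferentiable.hasGradientAt {n : ℕ} {F : E n → ℝ} (h : TwiceDifferentiable F)
    (x : E n) : HasGradientAt F (gradient F x) x := (h.1 x).hasGradientAt

theorem TwiceDifferentiable.hasFDerivAt_gradient {n : ℕ} {F : E n → ℝ}
    (h : TwiceDifferentiable F) (x : E n) : HasFDerivAt (gradient F) (hessian F x) x :=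
  (h.2 x).hasFDerivAt

theorem TwiceDifferentiable.continuous_gradient {n : ℕ} {F : E n → ℝ}
    (h : TwiceDifferentiable F) : Continuous (gradient F) := h.2.continuous

theorem TwiceDifferentiable.hessian_isSymmetric {n : ℕ} {F : E n → ℝ}
    (h : TwiceDifferentiable F) (x : E n) : (hessian F x : E n →ₗ[ℝ] E n).IsSymmetric := by
  intro v w
  have h1 : ∀ y, HasFDerivAt F (innerSL ℝ (gradient F y)) y := fun y =>
    (h.hasGradientAt y).hasFDerivAt
  have h2 : HasFDerivAt (fun y => innerSL ℝ (gradient F y)) ((innerSL ℝ).comp (hessian F x)) x :=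
    (innerSL ℝ).hasFDerivAt.comp x (h.hasFDerivAt_gradient x)
  have := second_derivative_symmetric h1 h2 v w
  simp only [ContinuousLinearMap.comp_apply, innerSL_apply_apply] at this
  simp only [ContinuousLinearMap.coe_coe]
  rw [this, real_inner_comm]

/-- Mean value inequality for the gradient on the ball of radius `‖d‖` about `x`. It loses the
factor `1/2` of the integral form but needs no integration. -/
theorem norm_gradient_taylor_le {n : ℕ} {F : E n → ℝ} {δ M₀ M₁ : ℝ}
    (hM₀ : 0 ≤ M₀) (hM₁ : 0 ≤ M₁)
    (h : SecondOrderGeneralizedSmooth F δ M₀ M₁) (x d : E n) (hd : ‖d‖ ≤ δ) :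
    ‖gradient F (x + d) - gradient F x - hessian F x d‖
      ≤ (M₀ + M₁ * ‖gradient F x‖) * ‖d‖ ^ 2 := by
  have hM : 0 ≤ M₀ + M₁ * ‖gradient F x‖ := by positivity
  have := (convex_closedBall x ‖d‖).norm_image_sub_le_of_norm_hasFDerivWithin_le'
    (f := gradient F) (f' := hessian F) (φ := hessian F x)
    (C := (M₀ + M₁ * ‖gradient F x‖) * ‖d‖) (x := x) (y := x + d)
    (fun y _ => (h.1.hasFDerivAt_gradient y).hasFDerivWithinAt)
    (fun y hy => by
      rw [Metric.mem_closedBall, dist_eq_norm] at hy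
      rw [norm_sub_rev]
      refine (h.2 x y (by rw [norm_sub_rev]; exact hy.trans hd)).trans ?_
      rw [norm_sub_rev x y]
      gcongr)
    (by simp) (by simp)
  simp only [add_sub_cancel_left] at this
  linarith [this]

/-- By symmetry of the Hessian, the gradient of the remainder in `d` is the remainder estimated in
`norm_gradient_taylor_le`; apply the mean value inequality again. -/
theorem abs_taylor_le {n : ℕ} {F : E n → ℝ} {δ M₀ M₁ : ℝ} (hM₀ : 0 ≤ M₀) (hM₁ : 0 ≤ M₁)
    (h : SecondOrderGeneralizedSmooth F δ M₀ M₁) (x d : E n) (hd : ‖d‖ ≤ δ) :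
    |F (x + d) - model (F x) (gradient F x) (hessian F x) d|
      ≤ (M₀ + M₁ * ‖gradient F x‖) * ‖d‖ ^ 3 := by
  have hM : 0 ≤ M₀ + M₁ * ‖gradient F x‖ := by positivity
  set r : E n → E n := fun y => gradient F (x + y) - gradient F x - hessian F x y with hr
  have hder : ∀ y, HasFDerivAt
      (fun y => F (x + y) - model (F x) (gradient F x) (hessian F x) y) (innerSL ℝ (r y)) y := by
    intro y
    have h1 : HasFDerivAt (fun y => F (x + y)) (innerSL ℝ (gradient F (x + y))) y := by
      have h0 : HasFDerivAt F (innerSL ℝ (gradient F (x + y))) (x + y) :=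
        (h.1.hasGradientAt (x + y)).hasFDerivAt
      exact (h0.comp y ((hasFDerivAt_id y).const_add x)).congr_fderiv (by ext; simp)
    have h2 : HasFDerivAt (fun y => ⟪gradient F x, y⟫) (innerSL ℝ (gradient F x)) y :=
      (innerSL ℝ (gradient F x)).hasFDerivAt
    have h3 := (hasFDerivAt_id y).inner ℝ ((hessian F x).hasFDerivAt (x := y))
    have h4 := h1.sub ((h2.const_add (F x)).add (h3.const_mul (1 / 2)))
    refine h4.congr_fderiv ?_
    ext v
    have hs := h.1.hessian_isSymmetric x y v
    simp only [ContinuousLinearMap.coe_coe] at hs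
    simp only [r, id_eq, _root_.sub_apply, _root_.add_apply,
      innerSL_apply_apply, _root_.smul_apply, ContinuousLinearMap.comp_apply,
      ContinuousLinearMap.prod_apply, fderivInnerCLM_apply, ContinuousLinearMap.id_apply,
      smul_eq_mul, inner_sub_left]
    rw [hs, real_inner_comm (hessian F x y) v, hs]
    ring
  have := (convex_closedBall (0 : E n) ‖d‖).norm_image_sub_le_of_norm_hasFDerivWithin_le
    (C := (M₀ + M₁ * ‖gradient F x‖) * ‖d‖ ^ 2) (x := 0) (y := d)
    (fun y _ => (hder y).hasFDerivWithinAt)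
    (fun y hy => by
      rw [mem_closedBall_zero_iff] at hy
      rw [innerSL_apply_norm]
      refine (norm_gradient_taylor_le hM₀ hM₁ h x y (hy.trans hd)).trans ?_
      gcongr)
    (by simp) (by simp)
  simp only [add_zero, sub_zero] at this
  have e : model (F x) (gradient F x) (hessian F x) 0 = F x := by simp [model]
  rw [e, sub_self, sub_zero, Real.norm_eq_abs] at this
  linarith

/-- The restriction `L₁ ‖x - y‖ ≤ 1` holds for all `y` near `x`, so the gradient is Lipschitz at `x`
with the stated constant, which bounds its derivative. -/
theorem GeneralizedSmooth.norm_hessian_le {n : ℕ} {F : E n → ℝ} {L₀ L₁ : ℝ}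
    (hL₀ : 0 ≤ L₀) (hL₁ : 0 ≤ L₁) (h : GeneralizedSmooth F L₀ L₁) (h2 : TwiceDifferentiable F)
    (x : E n) : ‖hessian F x‖ ≤ L₀ + L₁ * ‖gradient F x‖ := by
  refine (h2.hasFDerivAt_gradient x).le_of_lip' (by positivity) ?_
  have hev : ∀ᶠ y in nhds x, L₁ * ‖x - y‖ < 1 := by
    have hc : Continuous fun y : E n => L₁ * ‖x - y‖ := by fun_prop
    exact hc.continuousAt.eventually_lt continuousAt_const (by simp)
  filter_upwards [hev] with y hy
  have := h.2 x y hy.le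
  rwa [norm_sub_rev, norm_sub_rev x y] at this

theorem GeneralizedSmooth.norm_gradient_le {n : ℕ} {F : E n → ℝ} {L₀ L₁ Δ : ℝ}
    (hL₀ : 0 ≤ L₀) (hL₁ : 0 ≤ L₁) (h : GeneralizedSmooth F L₀ L₁) (hΔ : L₁ * Δ ≤ 1)
    {x y : E n} (hxy : ‖x - y‖ ≤ Δ) :
    ‖gradient F y‖ ≤ (1 + L₁ * Δ) * ‖gradient F x‖ + L₀ * Δ := by
  have h1 := h.2 x y ((mul_le_mul_of_nonneg_left hxy hL₁).trans hΔ)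
  have h2 : (L₀ + L₁ * ‖gradient F x‖) * ‖x - y‖ ≤ (L₀ + L₁ * ‖gradient F x‖) * Δ := by gcongr
  have h3 := norm_sub_norm_le (gradient F y) (gradient F x)
  rw [norm_sub_rev] at h3
  linarith

theorem SecondOrderGeneralizedSmooth.continuous_hessian {n : ℕ} {F : E n → ℝ} {δ M₀ M₁ : ℝ}
    (hδ : 0 < δ) (h : SecondOrderGeneralizedSmooth F δ M₀ M₁) :
    Continuous (hessian F) := by
  rw [continuous_iff_continuousAt]
  intro x
  rw [ContinuousAt, tendsto_iff_norm_sub_tendsto_zero]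
  have hc : Filter.Tendsto (fun y : E n => (M₀ + M₁ * ‖gradient F x‖) * ‖x - y‖) (nhds x)
      (nhds 0) := by
    have : Continuous (fun y : E n => (M₀ + M₁ * ‖gradient F x‖) * ‖x - y‖) := by fun_prop
    simpa using this.tendsto x
  refine squeeze_zero' (Filter.Eventually.of_forall fun _ => norm_nonneg _) ?_ hc
  have hev : ∀ᶠ y in nhds x, ‖x - y‖ < δ := by
    have hc : Continuous fun y : E n => ‖x - y‖ := by fun_prop
    exact hc.continuousAt.eventually_lt continuousAt_const (by simpa using hδ)
  filter_upwards [hev] with y hy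
  rw [norm_sub_rev]
  exact h.2 x y hy.le

theorem SecondOrderGeneralizedSmooth.continuous_lambdaMin_hessian {n : ℕ} (hn : 0 < n)
    {F : E n → ℝ} {δ M₀ M₁ : ℝ} (hδ : 0 < δ) (h : SecondOrderGeneralizedSmooth F δ M₀ M₁) :
    Continuous fun x => lambdaMin (hessian F x) := by
  rw [continuous_iff_continuousAt]
  intro x
  rw [ContinuousAt, tendsto_iff_norm_sub_tendsto_zero]
  have hc : Filter.Tendsto (fun y : E n => ‖hessian F y - hessian F x‖) (nhds x) (nhds 0) := by
    have : Continuous (fun y : E n => ‖hessian F y - hessian F x‖) := by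
      have := h.continuous_hessian hδ
      fun_prop
    simpa using this.tendsto x
  refine squeeze_zero (fun _ => norm_nonneg _) (fun y => ?_) hc
  have h1 := lambdaMin_sub_norm_le hn (h.1.hessian_isSymmetric y) (h.1.hessian_isSymmetric x)
  have h2 := lambdaMin_sub_norm_le hn (h.1.hessian_isSymmetric x) (h.1.hessian_isSymmetric y)
  rw [norm_sub_rev] at h2
  rw [Real.norm_eq_abs, abs_le]
  constructor <;> linarith

/-- Progress of one inexact trust region step, measured by gradient and smallest Hessian
eigenvalue at the new point. -/
theorem step_progress {n : ℕ} (hn : 0 < n) {F : E n → ℝ} {δ M₀ M₁ Δ : ℝ} (hM₀ : 0 ≤ M₀)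
    (hM₁ : 0 ≤ M₁) (hΔ : 0 < Δ) (hΔδ : Δ ≤ δ) (h : SecondOrderGeneralizedSmooth F δ M₀ M₁)
    {x y g : E n} {H : E n →L[ℝ] E n} (hH : (H : E n →ₗ[ℝ] E n).IsSymmetric)
    (hstep : IsTrustRegionStep (F x) g H Δ (y - x)) :
    Δ * ‖gradient F y‖ ≤ 2 * (F x - F y) + 3 * Δ * ‖g - gradient F x‖
        + 2 * Δ ^ 2 * ‖H - hessian F x‖ + 3 * Δ ^ 3 * (M₀ + M₁ * ‖gradient F x‖) ∧
    -(Δ ^ 2 * lambdaMin (hessian F y)) ≤ 2 * (F x - F y) + 3 * Δ * ‖g - gradient F x‖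
        + 2 * Δ ^ 2 * ‖H - hessian F x‖ + 3 * Δ ^ 3 * (M₀ + M₁ * ‖gradient F x‖) := by
  obtain ⟨lam, hlam, hkkt, hcomp, hpsd⟩ := hstep.exists_multiplier hΔ hH
  set d := y - x with hd
  have hy : y = x + d := by simp [d]
  have hdΔ : ‖d‖ ≤ Δ := hstep.1
  have hd0 := norm_nonneg d
  set M := M₀ + M₁ * ‖gradient F x‖ with hMdef
  have hM : 0 ≤ M := by positivity
  set e := g - gradient F x with he
  set D := H - hessian F x with hD
  have hDd : ‖D d‖ ≤ ‖D‖ * Δ := (D.le_opNorm d).trans (by gcongr)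
  have hgrad := norm_gradient_taylor_le hM₀ hM₁ h x d (hdΔ.trans hΔδ)
  have hval := abs_taylor_le hM₀ hM₁ h x d (hdΔ.trans hΔδ)
  rw [← hy, ← hMdef] at hgrad hval
  have hgrad' : ‖gradient F y - gradient F x - hessian F x d‖ ≤ M * Δ ^ 2 :=
    hgrad.trans (by gcongr)
  have hval' : |F y - model (F x) (gradient F x) (hessian F x) d| ≤ M * Δ ^ 3 :=
    hval.trans (by gcongr)
  -- The stationarity equation and `H + lam ≥ 0` make the model decrease by at least `lam ‖d‖² / 2`,
  -- which is `lam Δ² / 2` by complementarity. Replacing `g, H` by the true derivatives costs `Δ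
  -- ‖e‖` and `Δ² ‖D‖ / 2`.
  have hred : lam * Δ ^ 2 / 2 ≤ F x - F y + Δ * ‖e‖ + Δ ^ 2 * ‖D‖ / 2 + M * Δ ^ 3 := by
    have h1 := (abs_le.mp hval').2
    have h2 : model (F x) (gradient F x) (hessian F x) d
        = F x + ⟪H d + g, d⟫ - 1 / 2 * ⟪d, H d⟫ - ⟪e, d⟫ - 1 / 2 * ⟪d, D d⟫ := by
      simp only [model, he, hD, inner_sub_left, inner_sub_right, _root_.sub_apply,
        inner_add_left]
      rw [real_inner_comm d (H d)]
      ring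
    rw [hkkt, inner_neg_left, inner_smul_left, real_inner_self_eq_norm_sq] at h2
    simp only [RCLike.conj_to_real] at h2
    have h3 := hpsd d
    have h4 : -⟪e, d⟫ ≤ Δ * ‖e‖ := by
      have := neg_abs_le ⟪e, d⟫
      have := abs_real_inner_le_norm e d
      nlinarith [norm_nonneg e]
    have h5 : -⟪d, D d⟫ ≤ Δ ^ 2 * ‖D‖ := by
      have h6 := neg_norm_mul_le_inner D d
      have : ‖D‖ * ‖d‖ ^ 2 ≤ ‖D‖ * Δ ^ 2 := by gcongr
      linarith
    linarith
  have hM3 : 0 ≤ M * Δ ^ 3 := by positivity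
  have hDe : 0 ≤ Δ * ‖e‖ := by positivity
  constructor
  -- The new gradient is the Taylor remainder, minus the two estimation errors, minus the multiplier
  -- term.
  · have h1 : gradient F y = (gradient F y - gradient F x - hessian F x d) - e - D d - lam • d := by
      have : lam • d = -(H d + g) := by rw [hkkt, neg_neg]
      rw [this]
      simp only [he, hD, _root_.sub_apply]
      abel
    have h2 : ‖gradient F y‖ ≤ M * Δ ^ 2 + ‖e‖ + ‖D‖ * Δ + lam * Δ := by
      rw [h1]
      refine (norm_sub_le _ _).trans (add_le_add ((norm_sub_le _ _).trans
        (add_le_add ((norm_sub_le _ _).trans (add_le_add hgrad' le_rfl)) hDd)) ?_)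
      rw [norm_smul, Real.norm_of_nonneg hlam]
      gcongr
    have h3 := mul_le_mul_of_nonneg_left h2 hΔ.le
    nlinarith
  -- Start from `H ≥ -lam` and move from `H` to the Hessian at `x`, then to the Hessian at `y`.
  · have h1 : -lam - ‖D‖ - M * Δ ≤ lambdaMin (hessian F y) := by
      refine le_lambdaMin hn (h.1.hessian_isSymmetric y) fun v => ?_
      have h2 := hpsd v
      have h3 := neg_norm_mul_le_inner (hessian F x - H) v
      have h4 := neg_norm_mul_le_inner (hessian F y - hessian F x) v
      have h5 : ‖hessian F y - hessian F x‖ ≤ M * Δ := by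
        rw [norm_sub_rev]
        have hxy : ‖x - y‖ = ‖d‖ := by rw [norm_sub_rev]
        refine (h.2 x y (by rw [hxy]; linarith)).trans ?_
        rw [hxy]
        gcongr
      have h6 := mul_le_mul_of_nonneg_right h5 (sq_nonneg ‖v‖)
      rw [norm_sub_rev, ← hD] at h3
      simp only [_root_.sub_apply, inner_sub_right] at h3 h4
      linarith
    have h2 := mul_le_mul_of_nonneg_left h1 (sq_nonneg Δ)
    nlinarith

/-! ### Trace inequalities and matrix Rademacher series -/

section Trace

variable {V : Type*} [NormedAddCommGroup V] [InnerProductSpace ℝ V]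

theorem isSymmetric_pow {W : Module.End ℝ V} (hW : W.IsSymmetric) (q : ℕ) :
    (W ^ q).IsSymmetric := by
  induction q with
  | zero => intro x y; simp
  | succ q ih =>
    intro x y
    rw [pow_succ, Module.End.mul_apply, ih, hW, ← Module.End.mul_apply, ← pow_succ', ← pow_succ]

/-- A signed sum of operators. -/
def signedSum {ι : Type*} [Fintype ι] {M : Type*} [AddCommGroup M] [Module ℝ M]
    (H : ι → M) (σ : ι → ℤˣ) : M :=
  ∑ i, (((σ i : ℤ) : ℝ)) • H i

theorem signedSum_isSymmetric {ι : Type*} [Fintype ι] {H : ι → Module.End ℝ V}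
    (hH : ∀ i, (H i).IsSymmetric) (σ : ι → ℤˣ) : (signedSum H σ).IsSymmetric := by
  intro x y
  simp only [signedSum, LinearMap.sum_apply, LinearMap.smul_apply, sum_inner, inner_sum,
    inner_smul_left, inner_smul_right, RCLike.conj_to_real, hH _ x y]

variable [FiniteDimensional ℝ V]

theorem pow_apply_eigenvectorBasis {W : Module.End ℝ V} (hW : W.IsSymmetric) (q : ℕ)
    (i : Fin (Module.finrank ℝ V)) :
    (W ^ q) (hW.eigenvectorBasis rfl i)
      = hW.eigenvalues rfl i ^ q • hW.eigenvectorBasis rfl i := by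
  induction q with
  | zero => simp
  | succ q ih =>
    have h := hW.apply_eigenvectorBasis rfl i
    simp only [RCLike.ofReal_real_eq_id, id_eq] at h
    rw [pow_succ, Module.End.mul_apply, h, map_smul, ih, smul_smul, pow_succ, mul_comm]

theorem inner_pow_apply {W : Module.End ℝ V} (hW : W.IsSymmetric) (q : ℕ) (z : V) :
    ⟪z, (W ^ q) z⟫
      = ∑ i, hW.eigenvalues rfl i ^ q * ⟪hW.eigenvectorBasis rfl i, z⟫ ^ 2 := by
  rw [← OrthonormalBasis.sum_inner_mul_inner (hW.eigenvectorBasis rfl)]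
  refine Finset.sum_congr rfl fun i _ => ?_
  rw [← isSymmetric_pow hW q, pow_apply_eigenvectorBasis hW, inner_smul_left, real_inner_comm]
  simp only [RCLike.conj_to_real]
  ring

theorem trace_pow {W : Module.End ℝ V} (hW : W.IsSymmetric) (q : ℕ) :
    LinearMap.trace ℝ V (W ^ q) = ∑ i, hW.eigenvalues rfl i ^ q := by
  rw [LinearMap.trace_eq_sum_inner _ (hW.eigenvectorBasis rfl)]
  refine Finset.sum_congr rfl fun i _ => ?_
  rw [pow_apply_eigenvectorBasis hW, inner_smul_right, real_inner_self_eq_norm_sq]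
  simp

/-- Using eigenbases of both `W` and `Y`, the trace becomes a sum with nonnegative weights over
pairs of eigenvalues. This reduces inequalities between noncommuting operators to scalar ones. -/
theorem trace_mul_pow_mul_pow {H W Y : Module.End ℝ V} (hH : H.IsSymmetric) (hW : W.IsSymmetric)
    (hY : Y.IsSymmetric) (p q : ℕ) :
    LinearMap.trace ℝ V (H * W ^ p * (H * Y ^ q))
      = ∑ j, ∑ i, hW.eigenvalues rfl i ^ p * hY.eigenvalues rfl j ^ q
        * ⟪hW.eigenvectorBasis rfl i, H (hY.eigenvectorBasis rfl j)⟫ ^ 2 := by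
  rw [LinearMap.trace_eq_sum_inner _ (hY.eigenvectorBasis rfl)]
  refine Finset.sum_congr rfl fun j _ => ?_
  simp only [Module.End.mul_apply]
  rw [pow_apply_eigenvectorBasis hY, map_smul, map_smul, map_smul, inner_smul_right, ← hH,
    inner_pow_apply hW, Finset.mul_sum]
  exact Finset.sum_congr rfl fun i _ => by ring

/-- For nonnegative numbers this is `(a ^ p - b ^ p) * (a ^ q - b ^ q) ≥ 0`; evenness of `p + q`
allows passing to absolute values. -/
theorem pow_mul_pow_add_le {w y : ℝ} {p q : ℕ} (h : Even (p + q)) :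
    w ^ p * y ^ q + w ^ q * y ^ p ≤ w ^ (p + q) + y ^ (p + q) := by
  have key : ∀ a b : ℝ, 0 ≤ a → 0 ≤ b →
      a ^ p * b ^ q + a ^ q * b ^ p ≤ a ^ (p + q) + b ^ (p + q) := by
    intro a b ha hb
    have : 0 ≤ (a ^ p - b ^ p) * (a ^ q - b ^ q) := by
      rcases le_total a b with hab | hab
      · exact mul_nonneg_of_nonpos_of_nonpos
          (sub_nonpos.mpr (pow_le_pow_left₀ ha hab _)) (sub_nonpos.mpr (pow_le_pow_left₀ ha hab _))
      · exact mul_nonneg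
          (sub_nonneg.mpr (pow_le_pow_left₀ hb hab _)) (sub_nonneg.mpr (pow_le_pow_left₀ hb hab _))
    rw [pow_add, pow_add]
    linarith
  have h1 := key |w| |y| (abs_nonneg _) (abs_nonneg _)
  rw [h.pow_abs, h.pow_abs] at h1
  have h2 : w ^ p * y ^ q ≤ |w| ^ p * |y| ^ q := by
    rw [← abs_pow, ← abs_pow, ← abs_mul]; exact le_abs_self _
  have h3 : w ^ q * y ^ p ≤ |w| ^ q * |y| ^ p := by
    rw [← abs_pow, ← abs_pow, ← abs_mul]; exact le_abs_self _
  linarith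

theorem trace_mul_pow_mul_pow_add_le {H W Y : Module.End ℝ V} (hH : H.IsSymmetric)
    (hW : W.IsSymmetric) (hY : Y.IsSymmetric) {p q : ℕ} (h : Even (p + q)) :
    LinearMap.trace ℝ V (H * W ^ p * (H * Y ^ q)) + LinearMap.trace ℝ V (H * W ^ q * (H * Y ^ p))
      ≤ LinearMap.trace ℝ V (H * H * W ^ (p + q)) + LinearMap.trace ℝ V (H * H * Y ^ (p + q)) := by
  -- Inserting a zeroth power gives all four traces the shape of `trace_mul_pow_mul_pow`, so that
  -- they can be compared termwise.
  have e1 : LinearMap.trace ℝ V (H * H * W ^ (p + q))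
      = LinearMap.trace ℝ V (H * W ^ (p + q) * (H * Y ^ 0)) := by
    rw [pow_zero, mul_one, mul_assoc, LinearMap.trace_mul_comm, mul_assoc]
  have e2 : LinearMap.trace ℝ V (H * H * Y ^ (p + q))
      = LinearMap.trace ℝ V (H * W ^ 0 * (H * Y ^ (p + q))) := by
    rw [pow_zero, mul_one, mul_assoc]
  rw [e1, e2, trace_mul_pow_mul_pow hH hW hY, trace_mul_pow_mul_pow hH hW hY,
    trace_mul_pow_mul_pow hH hW hY, trace_mul_pow_mul_pow hH hW hY, ← Finset.sum_add_distrib,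
    ← Finset.sum_add_distrib]
  refine Finset.sum_le_sum fun j _ => ?_
  rw [← Finset.sum_add_distrib, ← Finset.sum_add_distrib]
  refine Finset.sum_le_sum fun i _ => ?_
  rw [← add_mul, ← add_mul]
  refine mul_le_mul_of_nonneg_right ?_ (sq_nonneg _)
  rw [pow_zero, mul_one, pow_zero, one_mul]
  exact pow_mul_pow_add_le h

/-- In an eigenbasis of `W`, the diagonal entries of `H * H` are `‖H u‖² ≤ c²`, and the even powers
of the eigenvalues are nonnegative. -/
theorem trace_mul_self_mul_pow_le {H W : Module.End ℝ V} (hH : H.IsSymmetric)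
    (hW : W.IsSymmetric) {k : ℕ} (hk : Even k) {c : ℝ} (hc : ∀ v, ‖H v‖ ≤ c * ‖v‖) :
    LinearMap.trace ℝ V (H * H * W ^ k) ≤ c ^ 2 * LinearMap.trace ℝ V (W ^ k) := by
  rw [trace_pow hW, LinearMap.trace_eq_sum_inner _ (hW.eigenvectorBasis rfl), Finset.mul_sum]
  refine Finset.sum_le_sum fun i _ => ?_
  simp only [Module.End.mul_apply]
  rw [pow_apply_eigenvectorBasis hW, map_smul, map_smul, inner_smul_right, ← hH,
    real_inner_self_eq_norm_sq, mul_comm]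
  refine mul_le_mul_of_nonneg_right ?_ (hk.pow_nonneg _)
  have h1 := hc (hW.eigenvectorBasis rfl i)
  rw [OrthonormalBasis.norm_eq_one, mul_one] at h1
  exact pow_le_pow_left₀ (norm_nonneg _) h1 2

theorem pow_sub_pow_eq_sum {R : Type*} [Ring R] (X Y : R) (k : ℕ) :
    X ^ (k + 1) - Y ^ (k + 1) = ∑ q ∈ Finset.range (k + 1), X ^ q * (X - Y) * Y ^ (k - q) := by
  induction k with
  | zero => simp
  | succ k ih =>
    rw [Finset.sum_range_succ']
    have : ∑ q ∈ Finset.range (k + 1), X ^ (q + 1) * (X - Y) * Y ^ (k + 1 - (q + 1))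
        = X * (X ^ (k + 1) - Y ^ (k + 1)) := by
      rw [ih, Finset.mul_sum]
      refine Finset.sum_congr rfl fun q _ => ?_
      rw [Nat.add_sub_add_right, pow_succ' X q]
      simp only [mul_assoc]
    rw [this, pow_zero, one_mul, Nat.sub_zero, mul_sub, sub_mul, ← pow_succ', ← pow_succ']
    abel

theorem signedSum_sub_flip {ι : Type*} [Fintype ι] [DecidableEq ι] {M : Type*} [AddCommGroup M]
    [Module ℝ M] (H : ι → M) (σ : ι → ℤˣ) (i : ι) :
    signedSum H σ - signedSum H (σ * Pi.mulSingle i (-1)) = (2 * ((σ i : ℤ) : ℝ)) • H i := by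
  simp only [signedSum]
  rw [← Finset.sum_sub_distrib, Finset.sum_eq_single i]
  · rw [← sub_smul]; congr 1; simp; ring
  · intro j _ hj
    simp [Pi.mulSingle_eq_of_ne hj]
  · simp

theorem sign_mul_self (u : ℤˣ) : ((u : ℤ) : ℝ) * ((u : ℤ) : ℝ) = 1 := by
  rcases Int.units_eq_one_or u with rfl | rfl <;> simp

/-- A discrete integration by parts in the sign `σ i`. Pairing `σ` with its flip at `i` replaces the
`(k + 1)`st power by a difference of two such powers, which telescopes into `k + 1` terms each
containing the increment `2 σ i H i`. Pairing the exponents `q` and `k - q` then allows the two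
copies of `H i` to be brought together by `trace_mul_pow_mul_pow_add_le`. -/
theorem sum_trace_flip_le {ι : Type*} [Fintype ι] [DecidableEq ι] {H : ι → Module.End ℝ V}
    (hH : ∀ i, (H i).IsSymmetric) {k : ℕ} (hk : Even k) (i : ι) :
    ∑ σ : ι → ℤˣ, ((σ i : ℤ) : ℝ) * LinearMap.trace ℝ V (H i * signedSum H σ ^ (k + 1))
      ≤ (k + 1) * ∑ σ : ι → ℤˣ, LinearMap.trace ℝ V (H i * H i * signedSum H σ ^ k) := by
  set τ : ι → ℤˣ := Pi.mulSingle i (-1) with hτ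
  have flip : ∀ φ : (ι → ℤˣ) → ℝ, ∑ σ, φ (σ * τ) = ∑ σ, φ σ := fun φ =>
    Equiv.sum_comp (Equiv.mulRight τ) φ
  have pair : ∀ σ : ι → ℤˣ,
      ((σ i : ℤ) : ℝ) * LinearMap.trace ℝ V (H i * signedSum H σ ^ (k + 1))
        - ((σ i : ℤ) : ℝ) * LinearMap.trace ℝ V (H i * signedSum H (σ * τ) ^ (k + 1))
      ≤ (k + 1) * (LinearMap.trace ℝ V (H i * H i * signedSum H σ ^ k)
        + LinearMap.trace ℝ V (H i * H i * signedSum H (σ * τ) ^ k)) := by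
    intro σ
    set X := signedSum H σ
    set Y := signedSum H (σ * τ)
    have hX : X.IsSymmetric := signedSum_isSymmetric hH _
    have hY : Y.IsSymmetric := signedSum_isSymmetric hH _
    have e1 : ((σ i : ℤ) : ℝ) * LinearMap.trace ℝ V (H i * X ^ (k + 1))
        - ((σ i : ℤ) : ℝ) * LinearMap.trace ℝ V (H i * Y ^ (k + 1))
        = 2 * ∑ q ∈ Finset.range (k + 1), LinearMap.trace ℝ V (H i * X ^ q * (H i * Y ^ (k - q))) := by
      rw [← mul_sub, ← map_sub, ← mul_sub, pow_sub_pow_eq_sum, signedSum_sub_flip, Finset.mul_sum,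
        map_sum, Finset.mul_sum, Finset.mul_sum]
      refine Finset.sum_congr rfl fun q _ => ?_
      rw [mul_smul_comm, smul_mul_assoc, mul_smul_comm, map_smul, smul_eq_mul, ← mul_assoc,
        show ((σ i : ℤ) : ℝ) * (2 * ((σ i : ℤ) : ℝ)) = 2 * (((σ i : ℤ) : ℝ) * ((σ i : ℤ) : ℝ)) by ring,
        sign_mul_self, mul_one]
      simp only [mul_assoc]
    have e2 : ∑ q ∈ Finset.range (k + 1), LinearMap.trace ℝ V (H i * X ^ q * (H i * Y ^ (k - q)))
        = ∑ q ∈ Finset.range (k + 1),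
          LinearMap.trace ℝ V (H i * X ^ (k - q) * (H i * Y ^ q)) := by
      rw [← Finset.sum_range_reflect]
      refine Finset.sum_congr rfl fun q hq => ?_
      have : q ≤ k := Nat.lt_succ_iff.mp (Finset.mem_range.mp hq)
      rw [Nat.add_sub_cancel, Nat.sub_sub_self this]
    rw [e1, two_mul]
    nth_rewrite 2 [e2]
    rw [← Finset.sum_add_distrib]
    have : ∀ q ∈ Finset.range (k + 1),
        LinearMap.trace ℝ V (H i * X ^ q * (H i * Y ^ (k - q)))
          + LinearMap.trace ℝ V (H i * X ^ (k - q) * (H i * Y ^ q))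
        ≤ LinearMap.trace ℝ V (H i * H i * X ^ k) + LinearMap.trace ℝ V (H i * H i * Y ^ k) := by
      intro q hq
      have hqk : q + (k - q) = k := by have := Finset.mem_range.mp hq; omega
      have := trace_mul_pow_mul_pow_add_le (hH i) hX hY (p := q) (q := k - q) (by rwa [hqk])
      rwa [hqk] at this
    refine (Finset.sum_le_sum this).trans (le_of_eq ?_)
    rw [Finset.sum_const, Finset.card_range, nsmul_eq_mul, Nat.cast_add, Nat.cast_one]
  have hsum := Finset.sum_le_sum fun σ (_ : σ ∈ Finset.univ) => pair σ
  rw [Finset.sum_sub_distrib, ← Finset.mul_sum, Finset.sum_add_distrib,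
    flip (fun σ => LinearMap.trace ℝ V (H i * H i * signedSum H σ ^ k))] at hsum
  have e3 : ∑ σ : ι → ℤˣ,
      ((σ i : ℤ) : ℝ) * LinearMap.trace ℝ V (H i * signedSum H (σ * τ) ^ (k + 1))
      = -∑ σ : ι → ℤˣ, ((σ i : ℤ) : ℝ) * LinearMap.trace ℝ V (H i * signedSum H σ ^ (k + 1)) := by
    rw [← flip (fun σ => ((σ i : ℤ) : ℝ) * LinearMap.trace ℝ V (H i * signedSum H σ ^ (k + 1))),
      ← Finset.sum_neg_distrib]
    refine Finset.sum_congr rfl fun σ _ => ?_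
    simp [hτ]
  rw [e3] at hsum
  linarith

/-- Expanding one factor of the power as `∑ σ i H i` prepares it for `sum_trace_flip_le`. Two powers
of the series are exchanged for the factor `(k + 1) ∑ c i ^ 2`. -/
theorem sum_trace_pow_le {ι : Type*} [Fintype ι] [DecidableEq ι] {H : ι → Module.End ℝ V}
    (hH : ∀ i, (H i).IsSymmetric) {c : ι → ℝ} (hc : ∀ i v, ‖H i v‖ ≤ c i * ‖v‖)
    {k : ℕ} (hk : Even k) :
    ∑ σ : ι → ℤˣ, LinearMap.trace ℝ V (signedSum H σ ^ (k + 2))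
      ≤ (k + 1) * (∑ i, c i ^ 2) * ∑ σ : ι → ℤˣ, LinearMap.trace ℝ V (signedSum H σ ^ k) := by
  have e : ∀ σ : ι → ℤˣ, LinearMap.trace ℝ V (signedSum H σ ^ (k + 2))
      = ∑ i, ((σ i : ℤ) : ℝ) * LinearMap.trace ℝ V (H i * signedSum H σ ^ (k + 1)) := by
    intro σ
    rw [pow_succ']
    nth_rewrite 1 [signedSum]
    rw [Finset.sum_mul, map_sum]
    exact Finset.sum_congr rfl fun i _ => by rw [smul_mul_assoc, map_smul, smul_eq_mul]
  rw [Finset.sum_congr rfl fun σ _ => e σ, Finset.sum_comm, mul_assoc, Finset.sum_mul,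
    Finset.mul_sum]
  refine Finset.sum_le_sum fun i _ => (sum_trace_flip_le hH hk i).trans ?_
  refine mul_le_mul_of_nonneg_left ?_ (by positivity)
  rw [Finset.mul_sum]
  exact Finset.sum_le_sum fun σ _ =>
    trace_mul_self_mul_pow_le (hH i) (signedSum_isSymmetric hH σ) hk (hc i)

/-- Iteration of `sum_trace_pow_le` down to power `0`, whose trace is the dimension. Each odd factor
`2 r + 1` is bounded crudely by `2 p`. -/
theorem sum_trace_even_pow_le {ι : Type*} [Fintype ι] [DecidableEq ι] {H : ι → Module.End ℝ V}
    (hH : ∀ i, (H i).IsSymmetric) {c : ι → ℝ} (hc : ∀ i v, ‖H i v‖ ≤ c i * ‖v‖) {p r : ℕ}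
    (hr : r ≤ p) :
    ∑ σ : ι → ℤˣ, LinearMap.trace ℝ V (signedSum H σ ^ (2 * r))
      ≤ (2 * p * ∑ i, c i ^ 2) ^ r * (Fintype.card (ι → ℤˣ) * Module.finrank ℝ V) := by
  have hv : 0 ≤ ∑ i, c i ^ 2 := Finset.sum_nonneg fun i _ => sq_nonneg _
  induction r with
  | zero => simp
  | succ r ih =>
    have h1 := sum_trace_pow_le hH hc (k := 2 * r) (by simp)
    have h2 := ih (by omega)
    rw [show 2 * (r + 1) = 2 * r + 2 by ring]
    refine h1.trans ?_
    rw [pow_succ', mul_assoc (2 * (p : ℝ) * ∑ i, c i ^ 2)]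
    have h3 : ((2 * r : ℕ) : ℝ) + 1 ≤ 2 * p := by exact_mod_cast (by omega : 2 * r + 1 ≤ 2 * p)
    refine mul_le_mul (mul_le_mul_of_nonneg_right h3 hv) h2 ?_ (by positivity)
    exact Finset.sum_nonneg fun σ _ => by
      rw [trace_pow (signedSum_isSymmetric hH σ)]
      exact Finset.sum_nonneg fun i _ => (even_two_mul r).pow_nonneg _

theorem norm_pow_le_trace [Nontrivial V] {X : V →L[ℝ] V}
    (hX : (X : Module.End ℝ V).IsSymmetric) (p : ℕ) :
    ‖X‖ ^ (2 * p) ≤ LinearMap.trace ℝ V ((X : Module.End ℝ V) ^ (2 * p)) := by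
  have : Nonempty (Fin (Module.finrank ℝ V)) := ⟨⟨0, Module.finrank_pos⟩⟩
  obtain ⟨i₀, hi₀⟩ := Finite.exists_max fun i => |hX.eigenvalues rfl i|
  have h1 : ‖X‖ ≤ |hX.eigenvalues rfl i₀| := by
    refine X.opNorm_le_bound (abs_nonneg _) fun v => ?_
    rw [← sq_le_sq₀ (norm_nonneg _) (by positivity), mul_pow, sq_abs]
    have e1 : ‖X v‖ ^ 2 = ⟪v, ((X : Module.End ℝ V) ^ 2) v⟫ := by
      rw [pow_two (X : Module.End ℝ V), Module.End.mul_apply, ← hX, real_inner_self_eq_norm_sq]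
      rfl
    have e2 : ‖v‖ ^ 2 = ∑ i, ⟪hX.eigenvectorBasis rfl i, v⟫ ^ 2 := by
      have := inner_pow_apply hX 0 v
      simpa [real_inner_self_eq_norm_sq] using this
    rw [e1, inner_pow_apply hX, e2, Finset.mul_sum]
    exact Finset.sum_le_sum fun i _ =>
      mul_le_mul_of_nonneg_right (sq_le_sq.mpr (hi₀ i)) (sq_nonneg _)
  rw [trace_pow hX]
  calc ‖X‖ ^ (2 * p) ≤ |hX.eigenvalues rfl i₀| ^ (2 * p) :=
        pow_le_pow_left₀ (norm_nonneg _) h1 _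
    _ = hX.eigenvalues rfl i₀ ^ (2 * p) := (even_two_mul p).pow_abs _
    _ ≤ _ := Finset.single_le_sum (f := fun i => hX.eigenvalues rfl i ^ (2 * p))
        (fun i _ => (even_two_mul p).pow_nonneg _) (Finset.mem_univ i₀)

/-- The second moment of a Rademacher series of symmetric operators grows only logarithmically
with the dimension. -/
theorem sum_norm_sq_signedSum_le {ι : Type*} [Fintype ι] [DecidableEq ι]
    (hV : 2 ≤ Module.finrank ℝ V) {A : ι → V →L[ℝ] V}
    (hA : ∀ i, (A i : Module.End ℝ V).IsSymmetric) :
    ∑ σ : ι → ℤˣ, ‖signedSum A σ‖ ^ 2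
      ≤ Fintype.card (ι → ℤˣ) * (14 * Real.log (Module.finrank ℝ V) * ∑ i, ‖A i‖ ^ 2) := by
  have : Nontrivial V := Module.nontrivial_of_finrank_pos (R := ℝ) (by omega)
  set n := Module.finrank ℝ V
  have hn : (2 : ℝ) ≤ n := by exact_mod_cast hV
  have hlog2 : (0.69 : ℝ) ≤ Real.log n :=
    (by linarith [Real.log_two_gt_d9] : (0.69 : ℝ) ≤ Real.log 2).trans
      (Real.log_le_log (by norm_num) hn)
  -- With this exponent `n ≤ e ^ p`, so the dimension costs only a factor `e` after the `p`th root.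
  set p := ⌈Real.log n⌉₊ with hp
  have hp1 : Real.log n ≤ p := Nat.le_ceil _
  have hp2 : (p : ℝ) < Real.log n + 1 := Nat.ceil_lt_add_one (by linarith)
  have hp0 : p ≠ 0 := by
    intro h0; rw [h0] at hp1; norm_num at hp1; linarith
  set N : ℝ := (Fintype.card (ι → ℤˣ) : ℝ) with hN
  have hNpos : 0 < N := by rw [hN]; exact_mod_cast Fintype.card_pos
  set v := ∑ i, ‖A i‖ ^ 2 with hv
  have hv0 : 0 ≤ v := Finset.sum_nonneg fun i _ => sq_nonneg _
  have hcoe : ∀ σ : ι → ℤˣ, ((signedSum A σ : V →L[ℝ] V) : Module.End ℝ V)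
      = signedSum (fun i => (A i : Module.End ℝ V)) σ := by
    intro σ
    ext x
    simp [signedSum]
  have hsum : ∑ σ : ι → ℤˣ, (‖signedSum A σ‖ ^ 2) ^ p ≤ (2 * p * v) ^ p * (N * n) := by
    refine le_trans (Finset.sum_le_sum fun σ _ => ?_)
      (sum_trace_even_pow_le hA (fun i v => (A i).le_opNorm v) (le_refl p))
    rw [← pow_mul, ← hcoe]
    refine norm_pow_le_trace ?_ p
    rw [hcoe]
    exact signedSum_isSymmetric hA σ
  -- Jensen's inequality for the uniform distribution on signs passes from the `p`th moment of
  -- `‖·‖²` to the first.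
  have hjen : (∑ σ : ι → ℤˣ, N⁻¹ * ‖signedSum A σ‖ ^ 2) ^ p
      ≤ ∑ σ : ι → ℤˣ, N⁻¹ * (‖signedSum A σ‖ ^ 2) ^ p := by
    refine Real.pow_arith_mean_le_arith_mean_pow _ _ _ (fun _ _ => by positivity) ?_
      (fun _ _ => by positivity) p
    rw [Finset.sum_const, nsmul_eq_mul, Finset.card_univ, ← hN, mul_inv_cancel₀ hNpos.ne']
  rw [← Finset.mul_sum, ← Finset.mul_sum] at hjen
  have hnexp : (n : ℝ) ≤ (Real.exp 1) ^ p := by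
    rw [← Real.exp_nat_mul, mul_one, ← Real.log_le_iff_le_exp (by linarith)]
    exact hp1
  have hfin : (N⁻¹ * ∑ σ : ι → ℤˣ, ‖signedSum A σ‖ ^ 2) ^ p ≤ (2 * p * v * Real.exp 1) ^ p := by
    refine hjen.trans ?_
    rw [inv_mul_le_iff₀ hNpos]
    refine hsum.trans ?_
    rw [mul_pow _ (Real.exp 1)]
    have : 0 ≤ (2 * p * v) ^ p := by positivity
    nlinarith [mul_le_mul_of_nonneg_left hnexp (mul_nonneg this hNpos.le)]
  have hle := le_of_pow_le_pow_left₀ hp0 (by positivity) hfin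
  rw [inv_mul_le_iff₀ hNpos] at hle
  refine hle.trans (mul_le_mul_of_nonneg_left ?_ hNpos.le)
  have he : Real.exp 1 < 2.7183 := Real.exp_one_lt_d9.trans (by norm_num)
  -- Since `log n ≥ 0.69`, rounding gives `p ≤ 2.5 log n`; then `5 e < 14`.
  have h7 : 2 * (p : ℝ) * Real.exp 1 ≤ 14 * Real.log n := by
    have : (p : ℝ) ≤ 2.5 * Real.log n := by linarith
    nlinarith [Real.exp_pos 1]
  nlinarith

end Trace

/-! ### Moments of averages of independent samples -/

section Averages

variable {Ξ : Type*} [MeasurableSpace Ξ] {P : Measure Ξ}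

theorem ofReal_norm_sq {B : Type*} [NormedAddCommGroup B] (b : B) :
    ENNReal.ofReal (‖b‖ ^ 2) = ‖b‖ₑ ^ 2 := by
  rw [ENNReal.ofReal_pow (norm_nonneg _), ofReal_norm]

theorem memLp_two_of_lintegral_le {B : Type*} [NormedAddCommGroup B] {Z : Ξ → B} {v : ℝ}
    (hm : AEStronglyMeasurable Z P) (h : ∫⁻ s, ENNReal.ofReal (‖Z s‖ ^ 2) ∂P ≤ ENNReal.ofReal v) :
    MemLp Z 2 P := by
  rw [← integrable_norm_rpow_iff hm (by norm_num) (by norm_num)]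
  simp only [ENNReal.toReal_ofNat, Real.rpow_two]
  refine ⟨(hm.norm.pow 2), ?_⟩
  rw [hasFiniteIntegral_iff_ofReal (Filter.Eventually.of_forall fun s => by positivity)]
  exact h.trans_lt ENNReal.ofReal_lt_top

variable [IsProbabilityMeasure P]

theorem sq_lintegral_le_lintegral_sq {g : Ξ → ENNReal} (hg : AEMeasurable g P) :
    (∫⁻ s, g s ∂P) ^ 2 ≤ ∫⁻ s, g s ^ 2 ∂P := by
  have h := ENNReal.lintegral_mul_le_Lp_mul_Lq P Real.HolderConjugate.two_two hg
    (aemeasurable_const (b := (1 : ENNReal)))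
  simp only [Pi.mul_apply, mul_one, ENNReal.one_rpow, lintegral_const, measure_univ] at h
  calc (∫⁻ s, g s ∂P) ^ 2 ≤ ((∫⁻ s, g s ^ (2 : ℝ) ∂P) ^ (1 / 2 : ℝ)) ^ 2 := by gcongr
    _ = ∫⁻ s, g s ^ 2 ∂P := by
      rw [← ENNReal.rpow_natCast, ← ENNReal.rpow_mul]
      simp

/-- Jensen's inequality: `z` is the mean of `z - S`, so subtracting a centred variable cannot lower
the second moment. -/
theorem enorm_sq_le_lintegral_sub {B : Type*} [NormedAddCommGroup B] [NormedSpace ℝ B]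
    [CompleteSpace B] {S : Ξ → B} (hS : Integrable S P) (h0 : ∫ s, S s ∂P = 0) (z : B) :
    ‖z‖ₑ ^ 2 ≤ ∫⁻ s, ‖z - S s‖ₑ ^ 2 ∂P := by
  have h1 : z = ∫ s, (z - S s) ∂P := by
    rw [integral_sub (integrable_const _) hS, h0]; simp
  have hI : Integrable (fun s => z - S s) P := (integrable_const _).sub hS
  calc ‖z‖ₑ ^ 2 = ‖∫ s, (z - S s) ∂P‖ₑ ^ 2 := by rw [← h1]
    _ ≤ (∫⁻ s, ‖z - S s‖ₑ ∂P) ^ 2 := by gcongr; exact enorm_integral_le_lintegral_enorm _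
    _ ≤ _ := sq_lintegral_le_lintegral_sq hI.aestronglyMeasurable.enorm

/-- Symmetrization: subtract an independent copy of the sample and regroup the two samples into
independent pairs. -/
theorem lintegral_enorm_sq_sum_le_symmetrized {B : Type*} [NormedAddCommGroup B]
    [NormedSpace ℝ B] [CompleteSpace B] [MeasurableSpace B] [BorelSpace B]
    [SecondCountableTopology B] {A : Ξ → B} (hA : Measurable A) (hI : Integrable A P)
    (h0 : ∫ s, A s ∂P = 0) (m : ℕ) :
    ∫⁻ y, ‖∑ j, A (y j)‖ₑ ^ 2 ∂(Measure.pi fun _ : Fin m => P)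
      ≤ ∫⁻ z, ‖∑ j, (A (z j).1 - A (z j).2)‖ₑ ^ 2 ∂(Measure.pi fun _ : Fin m => P.prod P) := by
  set π := Measure.pi fun _ : Fin m => P with hπ
  have hSm : Measurable fun y : Fin m → Ξ => ∑ j, A (y j) := by fun_prop
  have hIj : ∀ j, Integrable (fun y : Fin m → Ξ => A (y j)) π := fun j =>
    (measurePreserving_eval (fun _ : Fin m => P) j).integrable_comp_of_integrable hI
  have hSI : Integrable (fun y : Fin m → Ξ => ∑ j, A (y j)) π :=
    integrable_finsetSum _ fun j _ => hIj j
  have hS0 : ∫ y, ∑ j, A (y j) ∂π = 0 := by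
    rw [integral_finsetSum _ fun j _ => hIj j]
    refine Finset.sum_eq_zero fun j _ => ?_
    have := integral_map (μ := π) (φ := Function.eval j) (f := A)
      (measurable_pi_apply j).aemeasurable hA.aestronglyMeasurable
    rw [(measurePreserving_eval (fun _ : Fin m => P) j).map_eq, h0] at this
    exact this.symm
  have hmp := measurePreserving_arrowProdEquivProdArrow Ξ Ξ (Fin m) (fun _ => P) (fun _ => P)
  calc ∫⁻ y, ‖∑ j, A (y j)‖ₑ ^ 2 ∂π
      ≤ ∫⁻ y, ∫⁻ y', ‖∑ j, A (y j) - ∑ j, A (y' j)‖ₑ ^ 2 ∂π ∂π :=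
        lintegral_mono fun y => enorm_sq_le_lintegral_sub hSI hS0 _
    _ = ∫⁻ w, ‖∑ j, A (w.1 j) - ∑ j, A (w.2 j)‖ₑ ^ 2 ∂(π.prod π) := by
        rw [lintegral_prod]
        fun_prop
    _ = _ := by
        rw [← hmp.map_eq, lintegral_map (by fun_prop) hmp.measurable]
        refine lintegral_congr fun z => ?_
        rw [Finset.sum_sub_distrib]
        rfl

/-- Swapping the two entries of a pair preserves the product law and changes the sign of their
difference, so signs may be inserted freely. -/
theorem lintegral_enorm_sq_signedSum_eq {B : Type*} [NormedAddCommGroup B]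
    [NormedSpace ℝ B] [MeasurableSpace B] [BorelSpace B]
    [SecondCountableTopology B] {A : Ξ → B} (hA : Measurable A) (m : ℕ) (σ : Fin m → ℤˣ) :
    ∫⁻ z, ‖signedSum (fun j => A (z j).1 - A (z j).2) σ‖ₑ ^ 2
        ∂(Measure.pi fun _ : Fin m => P.prod P)
      = ∫⁻ z, ‖∑ j, (A (z j).1 - A (z j).2)‖ₑ ^ 2 ∂(Measure.pi fun _ : Fin m => P.prod P) := by
  have hmp : MeasurePreserving
      (fun (z : Fin m → Ξ × Ξ) j => (if σ j = 1 then id else Prod.swap) (z j))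
      (Measure.pi fun _ : Fin m => P.prod P) (Measure.pi fun _ : Fin m => P.prod P) := by
    refine measurePreserving_pi _ _ fun j => ?_
    split_ifs
    · exact MeasurePreserving.id _
    · exact Measure.measurePreserving_swap
  conv_rhs => rw [← hmp.map_eq]
  rw [lintegral_map (by fun_prop) hmp.measurable]
  refine lintegral_congr fun z => ?_
  congr 2
  simp only [signedSum]
  refine Finset.sum_congr rfl fun j _ => ?_
  rcases Int.units_eq_one_or (σ j) with h | h <;> simp [h]

/-- The second moment of an average of independent centred symmetric random operators. -/
theorem lintegral_norm_sq_average_operator_le {n : ℕ} (hn : 2 ≤ n) {A : Ξ → E n →L[ℝ] E n}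
    (hA : Measurable A) (hI : Integrable A P) (h0 : ∫ s, A s ∂P = 0)
    (hsymm : ∀ s, (A s : E n →ₗ[ℝ] E n).IsSymmetric) {v : ℝ}
    (hv : ∫⁻ s, ENNReal.ofReal (‖A s‖ ^ 2) ∂P ≤ ENNReal.ofReal v) {m : ℕ} (hm : 0 < m) :
    ∫⁻ y, ENNReal.ofReal (‖(m : ℝ)⁻¹ • ∑ j, A (y j)‖ ^ 2) ∂(Measure.pi fun _ : Fin m => P)
      ≤ ENNReal.ofReal (56 * Real.log n / m * v) := by
  have hlog : 0 ≤ Real.log n := Real.log_natCast_nonneg n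
  set ρ := Measure.pi fun _ : Fin m => P.prod P with hρ
  set I := ∫⁻ z, ‖∑ j, (A (z j).1 - A (z j).2)‖ₑ ^ 2 ∂ρ with hIdef
  have hDm : ∀ j : Fin m, Measurable fun z : Fin m → Ξ × Ξ => A (z j).1 - A (z j).2 := by
    intro j; fun_prop
  have hSm : ∀ σ : Fin m → ℤˣ,
      Measurable fun z : Fin m → Ξ × Ξ => signedSum (fun j => A (z j).1 - A (z j).2) σ := by
    intro σ
    simp only [signedSum]
    fun_prop
  -- The factor `4` comes from `‖a - b‖² ≤ 2 ‖a‖² + 2 ‖b‖²`, and with the `14` of the Rademacher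
  -- bound it gives the final `56`.
  have hpair : ∫⁻ w, ENNReal.ofReal (‖A w.1 - A w.2‖ ^ 2) ∂(P.prod P)
      ≤ 4 * ENNReal.ofReal v := by
    calc ∫⁻ w, ENNReal.ofReal (‖A w.1 - A w.2‖ ^ 2) ∂(P.prod P)
        ≤ ∫⁻ w, (2 * ENNReal.ofReal (‖A w.1‖ ^ 2) + 2 * ENNReal.ofReal (‖A w.2‖ ^ 2))
            ∂(P.prod P) := by
          refine lintegral_mono fun w => ?_
          have h2 : 2 * ENNReal.ofReal (‖A w.1‖ ^ 2) + 2 * ENNReal.ofReal (‖A w.2‖ ^ 2)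
              = ENNReal.ofReal (2 * ‖A w.1‖ ^ 2 + 2 * ‖A w.2‖ ^ 2) := by
            rw [ENNReal.ofReal_add (by positivity) (by positivity),
              ENNReal.ofReal_mul (by norm_num), ENNReal.ofReal_mul (by norm_num),
              ENNReal.ofReal_ofNat]
          rw [h2]
          refine ENNReal.ofReal_le_ofReal ?_
          have := norm_sub_le (A w.1) (A w.2)
          nlinarith [norm_nonneg (A w.1 - A w.2), sq_nonneg (‖A w.1‖ - ‖A w.2‖)]
      _ = 2 * ∫⁻ s, ENNReal.ofReal (‖A s‖ ^ 2) ∂P + 2 * ∫⁻ s, ENNReal.ofReal (‖A s‖ ^ 2) ∂P := by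
          rw [lintegral_add_left (by fun_prop), lintegral_const_mul _ (by fun_prop),
            lintegral_const_mul _ (by fun_prop)]
          congr 2
          · rw [lintegral_prod _ (by fun_prop)]; simp
          · rw [lintegral_prod _ (by fun_prop)]; simp
      _ ≤ 2 * ENNReal.ofReal v + 2 * ENNReal.ofReal v := by gcongr
      _ = 4 * ENNReal.ofReal v := by rw [← add_mul]; norm_num
  have hN : (Fintype.card (Fin m → ℤˣ) : ENNReal) ≠ 0 := by
    exact_mod_cast Fintype.card_ne_zero
  -- All sign patterns give the same integral, so it equals its average over signs. The Rademacher
  -- bound then applies pointwise under the integral.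
  have hsum : (Fintype.card (Fin m → ℤˣ) : ENNReal) * I
      ≤ Fintype.card (Fin m → ℤˣ) *
        (ENNReal.ofReal (14 * Real.log n) * (m * (4 * ENNReal.ofReal v))) := by
    calc (Fintype.card (Fin m → ℤˣ) : ENNReal) * I
        = ∑ σ : Fin m → ℤˣ, ∫⁻ z, ‖signedSum (fun j => A (z j).1 - A (z j).2) σ‖ₑ ^ 2 ∂ρ := by
          rw [Finset.sum_congr rfl fun σ _ => lintegral_enorm_sq_signedSum_eq (P := P) hA m σ]
          rw [Finset.sum_const, nsmul_eq_mul, Finset.card_univ]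
      _ = ∫⁻ z, ∑ σ : Fin m → ℤˣ, ‖signedSum (fun j => A (z j).1 - A (z j).2) σ‖ₑ ^ 2 ∂ρ := by
          rw [lintegral_finsetSum]
          intro σ _
          exact (hSm σ).enorm.pow_const 2
      _ ≤ ∫⁻ z, (Fintype.card (Fin m → ℤˣ) : ENNReal) * (ENNReal.ofReal (14 * Real.log n) *
            ∑ j, ENNReal.ofReal (‖A (z j).1 - A (z j).2‖ ^ 2)) ∂ρ := by
          refine lintegral_mono fun z => ?_
          have := sum_norm_sq_signedSum_le (V := E n) (by simpa using hn)
            (A := fun j => A (z j).1 - A (z j).2) (fun j => by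
              have := (hsymm (z j).1).sub (hsymm (z j).2)
              simpa using this)
          rw [finrank_euclideanSpace_fin] at this
          rw [← ENNReal.ofReal_sum_of_nonneg (fun _ _ => by positivity),
            ← ENNReal.ofReal_mul (by positivity), ← ENNReal.ofReal_natCast,
            ← ENNReal.ofReal_mul (by positivity)]
          simp only [← ofReal_norm_sq]
          rw [← ENNReal.ofReal_sum_of_nonneg (fun _ _ => by positivity)]
          exact ENNReal.ofReal_le_ofReal this
      _ = Fintype.card (Fin m → ℤˣ) * (ENNReal.ofReal (14 * Real.log n) *
            ∑ _j : Fin m, ∫⁻ w, ENNReal.ofReal (‖A w.1 - A w.2‖ ^ 2) ∂(P.prod P)) := by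
          rw [lintegral_const_mul _ (by fun_prop), lintegral_const_mul _ (by fun_prop),
            lintegral_finsetSum _ (by fun_prop)]
          congr 2
          refine Finset.sum_congr rfl fun j _ => ?_
          have := lintegral_map (μ := ρ) (f := fun w : Ξ × Ξ => ENNReal.ofReal (‖A w.1 - A w.2‖ ^ 2))
            (g := Function.eval j) (by fun_prop) (measurable_pi_apply j)
          rw [(measurePreserving_eval (fun _ : Fin m => P.prod P) j).map_eq] at this
          exact this.symm
      _ ≤ _ := by
          gcongr
          rw [Finset.sum_const, Finset.card_univ, Fintype.card_fin, nsmul_eq_mul]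
          gcongr
  have hI2 : I ≤ ENNReal.ofReal (14 * Real.log n) * (m * (4 * ENNReal.ofReal v)) :=
    (ENNReal.mul_le_mul_iff_right hN (ENNReal.natCast_ne_top _)).mp hsum
  have hm' : (0 : ℝ) < m := by exact_mod_cast hm
  calc ∫⁻ y, ENNReal.ofReal (‖(m : ℝ)⁻¹ • ∑ j, A (y j)‖ ^ 2) ∂(Measure.pi fun _ : Fin m => P)
      = ENNReal.ofReal ((m : ℝ)⁻¹ ^ 2) *
        ∫⁻ y, ‖∑ j, A (y j)‖ₑ ^ 2 ∂(Measure.pi fun _ : Fin m => P) := by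
        rw [← lintegral_const_mul _ (by fun_prop)]
        refine lintegral_congr fun y => ?_
        rw [norm_smul, mul_pow, ENNReal.ofReal_mul (by positivity),
          ofReal_norm_sq (∑ j, A (y j)),
          Real.norm_of_nonneg (by positivity)]
    _ ≤ ENNReal.ofReal ((m : ℝ)⁻¹ ^ 2) *
        (ENNReal.ofReal (14 * Real.log n) * (m * (4 * ENNReal.ofReal v))) := by
        gcongr
        exact (lintegral_enorm_sq_sum_le_symmetrized hA hI h0 m).trans hI2
    _ = ENNReal.ofReal (56 * Real.log n / m * v) := by
        rw [← ENNReal.ofReal_ofNat 4, ← ENNReal.ofReal_natCast,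
          ← ENNReal.ofReal_mul (by norm_num), ← ENNReal.ofReal_mul (by positivity),
          ← ENNReal.ofReal_mul (by positivity), ← ENNReal.ofReal_mul (by positivity)]
        congr 1
        field_simp
        ring

/-- The second moment of an average of independent centred random vectors, with a shift. -/
theorem lintegral_norm_sq_add_average_le {n : ℕ} {Z : Ξ → E n}
    (hZ : Measurable Z) (h0 : ∫ s, Z s ∂P = 0) {v : ℝ}
    (hv : ∫⁻ s, ENNReal.ofReal (‖Z s‖ ^ 2) ∂P ≤ ENNReal.ofReal v) (hv0 : 0 ≤ v)
    {m : ℕ} (hm : 0 < m) (e : E n) :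
    ∫⁻ y, ENNReal.ofReal (‖e + (m : ℝ)⁻¹ • ∑ j, Z (y j)‖ ^ 2) ∂(Measure.pi fun _ : Fin m => P)
      ≤ ENNReal.ofReal (‖e‖ ^ 2 + v / m) := by
  set π := Measure.pi fun _ : Fin m => P with hπ
  have hm' : (0 : ℝ) < m := by exact_mod_cast hm
  have hL : MemLp Z 2 P := memLp_two_of_lintegral_le hZ.aestronglyMeasurable hv
  have hev := fun j => measurePreserving_eval (fun _ : Fin m => P) j
  have hLj : ∀ j, MemLp (fun y : Fin m → Ξ => Z (y j)) 2 π := fun j =>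
    hL.comp_measurePreserving (hev j)
  have hIj : ∀ j, Integrable (fun y : Fin m → Ξ => Z (y j)) π := fun j =>
    (hLj j).integrable (by norm_num)
  have hmean : ∀ j, ∫ y, Z (y j) ∂π = 0 := by
    intro j
    have := integral_map (μ := π) (φ := Function.eval j) (f := Z)
      (measurable_pi_apply j).aemeasurable hZ.aestronglyMeasurable
    rw [(hev j).map_eq, h0] at this
    exact this.symm
  have hind := iIndepFun_pi (μ := fun _ : Fin m => P) (X := fun _ => Z) fun _ => hZ.aemeasurable
  have hinnerI : ∀ i j, Integrable (fun y : Fin m → Ξ => ⟪Z (y i), Z (y j)⟫) π := by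
    intro i j
    refine Integrable.mono' (((hLj i).integrable_norm_pow (by norm_num)).add
      ((hLj j).integrable_norm_pow (by norm_num)))
      (by fun_prop) (Filter.Eventually.of_forall fun y => ?_)
    rw [Real.norm_eq_abs]
    refine (abs_real_inner_le_norm _ _).trans ?_
    change _ ≤ ‖Z (y i)‖ ^ 2 + ‖Z (y j)‖ ^ 2
    nlinarith [sq_nonneg (‖Z (y i)‖ - ‖Z (y j)‖), sq_nonneg (‖Z (y i)‖ + ‖Z (y j)‖)]
  -- Only the diagonal survives. The bound has no dimensional factor because the norm on vectors is
  -- Hilbertian.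
  have hcross : ∀ i j, i ≠ j → ∫ y, ⟪Z (y i), Z (y j)⟫ ∂π = 0 := by
    intro i j hij
    have h : ∫ y, ⟪Z (y i), Z (y j)⟫ ∂π = ⟪∫ y, Z (y i) ∂π, ∫ y, Z (y j) ∂π⟫ :=
      (hind.indepFun hij).integral_bilin (hIj i) (hIj j) (innerSL ℝ)
    rw [h, hmean, inner_zero_left]
  have hdiag : ∀ j, ∫ y, ⟪Z (y j), Z (y j)⟫ ∂π ≤ v := by
    intro j
    have h1 := integral_map (μ := π) (φ := Function.eval j) (f := fun s => ‖Z s‖ ^ 2)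
      (measurable_pi_apply j).aemeasurable (by fun_prop)
    rw [(hev j).map_eq] at h1
    have h2 : ∫ s, ‖Z s‖ ^ 2 ∂P ≤ v := by
      rw [integral_eq_lintegral_of_nonneg_ae (Filter.Eventually.of_forall fun s => by positivity)
        (by fun_prop)]
      exact ENNReal.toReal_le_of_le_ofReal hv0 hv
    simp only [real_inner_self_eq_norm_sq]
    rw [h1] at h2
    exact h2
  have hexp : ∀ y : Fin m → Ξ, ‖e + (m : ℝ)⁻¹ • ∑ j, Z (y j)‖ ^ 2
      = ‖e‖ ^ 2 + 2 * (m : ℝ)⁻¹ * ∑ j, ⟪e, Z (y j)⟫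
        + (m : ℝ)⁻¹ ^ 2 * ∑ i, ∑ j, ⟪Z (y i), Z (y j)⟫ := by
    intro y
    rw [norm_add_sq_real, inner_smul_right, inner_sum, norm_smul, mul_pow,
      Real.norm_of_nonneg (by positivity), ← real_inner_self_eq_norm_sq (∑ j, Z (y j)), sum_inner]
    simp only [inner_sum]
    ring
  have hI1 : Integrable (fun y : Fin m → Ξ => ∑ j, ⟪e, Z (y j)⟫) π :=
    integrable_finsetSum _ fun j _ => (hIj j).const_inner e
  have hI2 : Integrable (fun y : Fin m → Ξ => ∑ i, ∑ j, ⟪Z (y i), Z (y j)⟫) π :=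
    integrable_finsetSum _ fun i _ => integrable_finsetSum _ fun j _ => hinnerI i j
  have hlin : ∫ y, ∑ j, ⟪e, Z (y j)⟫ ∂π = 0 := by
    rw [integral_finsetSum _ fun j _ => (hIj j).const_inner e]
    refine Finset.sum_eq_zero fun j _ => ?_
    rw [integral_inner (hIj j), hmean, inner_zero_right]
  have hquad : ∫ y, ∑ i, ∑ j, ⟪Z (y i), Z (y j)⟫ ∂π ≤ m * v := by
    rw [integral_finsetSum _ fun i _ => integrable_finsetSum _ fun j _ => hinnerI i j]
    have : ∀ i ∈ Finset.univ, ∫ y, ∑ j, ⟪Z (y i), Z (y j)⟫ ∂π ≤ v := by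
      intro i _
      rw [integral_finsetSum _ fun j _ => hinnerI i j,
        Finset.sum_eq_single i (fun j _ hj => hcross i j hj.symm) (by simp)]
      exact hdiag i
    refine (Finset.sum_le_sum this).trans (le_of_eq ?_)
    simp
  rw [← ofReal_integral_eq_lintegral_ofReal]
  · refine ENNReal.ofReal_le_ofReal ?_
    simp only [hexp]
    have hI3 : Integrable (fun y : Fin m → Ξ => ‖e‖ ^ 2 + 2 * (m : ℝ)⁻¹ * ∑ j, ⟪e, Z (y j)⟫) π :=
      (integrable_const _).add (hI1.const_mul _)
    rw [integral_add hI3 (hI2.const_mul _),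
      integral_add (integrable_const _) (hI1.const_mul _), integral_const_mul, integral_const_mul,
      hlin]
    have h5 : (m : ℝ)⁻¹ ^ 2 * ∫ y, ∑ i, ∑ j, ⟪Z (y i), Z (y j)⟫ ∂π ≤ (m : ℝ)⁻¹ ^ 2 * (m * v) := by
      gcongr
    have h6 : (m : ℝ)⁻¹ ^ 2 * (m * v) = v / m := by field_simp
    have h7 : ∫ _, ‖e‖ ^ 2 ∂π = ‖e‖ ^ 2 := by simp
    rw [h7]
    linarith
  · simp only [hexp]
    exact ((integrable_const _).add (hI1.const_mul _)).add (hI2.const_mul _)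
  · exact Filter.Eventually.of_forall fun y => by positivity

end Averages

/-! ### Measurability of gradients and Hessians -/

section Measurability

variable {n : ℕ} {Ξ : Type*}

theorem tendsto_difference_quotient {B : Type*} [NormedAddCommGroup B] [NormedSpace ℝ B]
    {φ : E n → B} {x : E n} {φ' : E n →L[ℝ] B} (h : HasFDerivAt φ φ' x) (v : E n) :
    Filter.Tendsto (fun k : ℕ => (k : ℝ) • (φ (x + (k : ℝ)⁻¹ • v) - φ x)) Filter.atTop
      (nhds (φ' v)) := by
  refine h.lim v ?_
  exact tendsto_norm_atTop_atTop.comp tendsto_natCast_atTop_atTop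

theorem measurable_of_inner_basis {α : Type*} [MeasurableSpace α] {φ : α → E n}
    (h : ∀ v : E n, Measurable fun a => ⟪φ a, v⟫) : Measurable φ := by
  have e : φ = fun a => ∑ i, ⟪φ a, EuclideanSpace.basisFun (Fin n) ℝ i⟫
      • EuclideanSpace.basisFun (Fin n) ℝ i := by
    funext a
    conv_lhs => rw [← (EuclideanSpace.basisFun (Fin n) ℝ).sum_repr' (φ a)]
    exact Finset.sum_congr rfl fun i _ => by rw [real_inner_comm]
  rw [e]
  have := fun i => h (EuclideanSpace.basisFun (Fin n) ℝ i)
  fun_prop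

theorem measurable_clm_of_apply {α : Type*} [MeasurableSpace α] {A : α → E n →L[ℝ] E n}
    (h : ∀ v : E n, Measurable fun a => A a v) : Measurable A := by
  have e : A = fun a => ∑ i, ContinuousLinearMap.smulRightL ℝ (E n) (E n)
      (innerSL ℝ (EuclideanSpace.basisFun (Fin n) ℝ i))
      (A a (EuclideanSpace.basisFun (Fin n) ℝ i)) := by
    funext a
    ext1 v
    conv_lhs => rw [← (EuclideanSpace.basisFun (Fin n) ℝ).sum_repr' v]
    simp
  rw [e]
  refine Finset.measurable_sum _ fun i _ => ?_
  exact (ContinuousLinearMap.continuous _).measurable.comp (h _)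

variable [MeasurableSpace Ξ] {P : Measure Ξ} {f : E n → Ξ → ℝ} {F : E n → ℝ}

/-- Carathéodory's criterion: continuous in the point, and measurable in the sample as a limit of
difference quotients. -/
theorem IsStochasticObjective.measurable_gradient (h : IsStochasticObjective P f F) :
    Measurable fun p : E n × Ξ => gradient (fun y => f y p.2) p.1 := by
  refine measurable_uncurry_of_continuous_of_measurable
    (u := fun (x : E n) (s : Ξ) => gradient (fun y => f y s) x)
    (fun s => (h.twiceDifferentiable s).continuous_gradient) fun x => ?_
  refine measurable_of_inner_basis fun v => ?_
  refine measurable_of_tendsto_metrizable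
    (f := fun (k : ℕ) (s : Ξ) => (k : ℝ) • (f (x + (k : ℝ)⁻¹ • v) s - f x s)) (fun k => ?_) ?_
  · have h1 := h.measurable (x + (k : ℝ)⁻¹ • v)
    have h2 := h.measurable x
    fun_prop
  · rw [tendsto_pi_nhds]
    intro s
    exact tendsto_difference_quotient ((h.twiceDifferentiable s).hasGradientAt x).hasFDerivAt v

/-- The component Hessians need not be continuous in the point, so Carathéodory's criterion is not
available. Joint measurability comes from difference quotients of the jointly measurable gradient.
-/
theorem IsStochasticObjective.measurable_hessian (h : IsStochasticObjective P f F) :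
    Measurable fun p : E n × Ξ => hessian (fun y => f y p.2) p.1 := by
  refine measurable_clm_of_apply fun v => ?_
  refine measurable_of_tendsto_metrizable
    (f := fun (k : ℕ) (p : E n × Ξ) => (k : ℝ) •
      (gradient (fun y => f y p.2) (p.1 + (k : ℝ)⁻¹ • v) - gradient (fun y => f y p.2) p.1))
    (fun k => ?_) ?_
  · have h1 := h.measurable_gradient
    have h2 : Measurable fun p : E n × Ξ =>
        gradient (fun y => f y p.2) (p.1 + (k : ℝ)⁻¹ • v) :=
      h1.comp (g := fun p : E n × Ξ => gradient (fun y => f y p.2) p.1)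
        (f := fun p : E n × Ξ => (p.1 + (k : ℝ)⁻¹ • v, p.2)) (by fun_prop)
    fun_prop
  · rw [tendsto_pi_nhds]
    intro p
    exact tendsto_difference_quotient ((h.twiceDifferentiable p.2).hasFDerivAt_gradient p.1) v

end Measurability

/-! ### Batches -/

theorem gradient_batchFun {n : ℕ} {Ξ : Type*} {f : E n → Ξ → ℝ}
    (h : ∀ s, TwiceDifferentiable fun x => f x s) {m : ℕ} (S : Fin m → Ξ) (x : E n) :
    gradient (batchFun f S) x = (m : ℝ)⁻¹ • ∑ j, gradient (fun y => f y (S j)) x := by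
  refine HasGradientAt.gradient ?_
  have h1 : ∀ j, HasFDerivAt (fun y => f y (S j)) (innerSL ℝ (gradient (fun y => f y (S j)) x)) x :=
    fun j => ((h (S j)).hasGradientAt x).hasFDerivAt
  have h2 := (HasFDerivAt.fun_sum (u := Finset.univ) fun j _ => h1 j).const_mul (m : ℝ)⁻¹
  rw [hasGradientAt_iff_hasFDerivAt]
  refine h2.congr_fderiv ?_
  ext v
  simp

theorem hessian_batchFun {n : ℕ} {Ξ : Type*} {f : E n → Ξ → ℝ}
    (h : ∀ s, TwiceDifferentiable fun x => f x s) {m : ℕ} (S : Fin m → Ξ) (x : E n) :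
    hessian (batchFun f S) x = (m : ℝ)⁻¹ • ∑ j, hessian (fun y => f y (S j)) x := by
  have e : gradient (batchFun f S)
      = fun x => (m : ℝ)⁻¹ • ∑ j, gradient (fun y => f y (S j)) x :=
    funext fun x => gradient_batchFun h S x
  rw [hessian, e]
  exact ((HasFDerivAt.fun_sum (u := Finset.univ) fun j _ =>
    (h (S j)).hasFDerivAt_gradient x).const_smul (m : ℝ)⁻¹).fderiv

theorem hessian_batchFun_isSymmetric {n : ℕ} {Ξ : Type*} {f : E n → Ξ → ℝ}
    (h : ∀ s, TwiceDifferentiable fun x => f x s) {m : ℕ} (S : Fin m → Ξ) (x : E n) :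
    (hessian (batchFun f S) x : E n →ₗ[ℝ] E n).IsSymmetric := by
  rw [hessian_batchFun h]
  intro v w
  have hs := fun j => (h (S j)).hessian_isSymmetric x v w
  simp only [ContinuousLinearMap.coe_coe] at hs
  simp only [ContinuousLinearMap.coe_coe, _root_.smul_apply, _root_.sum_apply,
    inner_smul_left, inner_smul_right, sum_inner, inner_sum, RCLike.conj_to_real, hs]

/-! ### Mean square smoothness of the components -/

section MeanSquare

/-- Fundamental theorem of calculus followed by Cauchy-Schwarz. The derivative is not assumed
integrable: either the right side is infinite, or its finiteness supplies integrability. -/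
theorem enorm_sub_sq_le_lintegral_deriv {B : Type*} [NormedAddCommGroup B] [NormedSpace ℝ B]
    [CompleteSpace B] {γ γ' : ℝ → B} (h : ∀ u, HasDerivAt γ (γ' u) u) :
    ‖γ 1 - γ 0‖ₑ ^ 2 ≤ ∫⁻ u in Set.Ioc (0 : ℝ) 1, ‖γ' u‖ₑ ^ 2 := by
  set ν := (volume : Measure ℝ).restrict (Set.Ioc (0 : ℝ) 1) with hν
  have : IsProbabilityMeasure ν := ⟨by simp [hν]⟩
  have e : γ' = deriv γ := funext fun u => (h u).deriv.symm
  have hm : AEStronglyMeasurable γ' ν := by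
    rw [e]; exact (stronglyMeasurable_deriv γ).aestronglyMeasurable
  by_cases htop : ∫⁻ u, ‖γ' u‖ₑ ^ 2 ∂ν = ⊤
  · rw [htop]; exact le_top
  have hint : Integrable γ' ν := by
    refine ⟨hm, ?_⟩
    rw [hasFiniteIntegral_iff_enorm]
    have h1 := sq_lintegral_le_lintegral_sq (P := ν) hm.enorm
    have h2 := h1.trans_lt (lt_top_iff_ne_top.mpr htop)
    exact (ENNReal.pow_lt_top_iff.mp h2).resolve_right (by norm_num)
  have hftc : ∫ u in (0 : ℝ)..1, γ' u = γ 1 - γ 0 :=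
    intervalIntegral.integral_eq_sub_of_hasDerivAt (fun u _ => h u)
      ((intervalIntegrable_iff_integrableOn_Ioc_of_le zero_le_one).mpr hint)
  rw [← hftc, intervalIntegral.integral_of_le zero_le_one]
  calc ‖∫ u, γ' u ∂ν‖ₑ ^ 2 ≤ (∫⁻ u, ‖γ' u‖ₑ ∂ν) ^ 2 := by
        gcongr; exact enorm_integral_le_lintegral_enorm _
    _ ≤ _ := sq_lintegral_le_lintegral_sq hm.enorm

variable {n : ℕ} {Ξ : Type*} [MeasurableSpace Ξ] {P : Measure Ξ} [IsProbabilityMeasure P]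
  {f : E n → Ξ → ℝ} {F : E n → ℝ}

/-- Integrate the component Hessian along the segment from `x` to `y` and exchange the two integrals
by Tonelli. A second moment bound for the Hessian at each point of the segment then suffices. -/
theorem IsStochasticObjective.lintegral_gradient_sub_sq_le (h : IsStochasticObjective P f F)
    {x y : E n} {c : ENNReal}
    (hc : ∀ z, ‖x - z‖ ≤ ‖x - y‖ → ∫⁻ s, ‖hessian (fun y => f y s) z‖ₑ ^ 2 ∂P ≤ c) :
    ∫⁻ s, ‖gradient (fun y => f y s) y - gradient (fun y => f y s) x‖ₑ ^ 2 ∂P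
      ≤ ‖y - x‖ₑ ^ 2 * c := by
  set ν := (volume : Measure ℝ).restrict (Set.Ioc (0 : ℝ) 1) with hν
  have : IsProbabilityMeasure ν := ⟨by simp [hν]⟩
  have hmeas : Measurable fun p : Ξ × ℝ =>
      hessian (fun y => f y p.1) (x + p.2 • (y - x)) :=
    h.measurable_hessian.comp (g := fun p : E n × Ξ => hessian (fun y => f y p.2) p.1)
      (f := fun p : Ξ × ℝ => (x + p.2 • (y - x), p.1)) (by fun_prop)
  have hpt : ∀ s, ‖gradient (fun y => f y s) y - gradient (fun y => f y s) x‖ₑ ^ 2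
      ≤ ∫⁻ u, ‖y - x‖ₑ ^ 2 * ‖hessian (fun y => f y s) (x + u • (y - x))‖ₑ ^ 2 ∂ν := by
    intro s
    have hd : ∀ u : ℝ, HasDerivAt (fun u : ℝ => gradient (fun y => f y s) (x + u • (y - x)))
        (hessian (fun y => f y s) (x + u • (y - x)) (y - x)) u := by
      intro u
      have h1 : HasDerivAt (fun u : ℝ => x + u • (y - x)) (y - x) u := by
        simpa using ((hasDerivAt_id u).smul_const (y - x)).const_add x
      exact ((h.twiceDifferentiable s).hasFDerivAt_gradient _).comp_hasDerivAt u h1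
    have h2 := enorm_sub_sq_le_lintegral_deriv hd
    simp only [one_smul, zero_smul, add_zero, add_sub_cancel] at h2
    refine h2.trans (lintegral_mono fun u => ?_)
    rw [← mul_pow]
    gcongr
    rw [mul_comm]
    exact ContinuousLinearMap.le_opENorm _ _
  calc ∫⁻ s, ‖gradient (fun y => f y s) y - gradient (fun y => f y s) x‖ₑ ^ 2 ∂P
      ≤ ∫⁻ s, ∫⁻ u, ‖y - x‖ₑ ^ 2 * ‖hessian (fun y => f y s) (x + u • (y - x))‖ₑ ^ 2 ∂ν ∂P :=
        lintegral_mono hpt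
    _ = ∫⁻ u, ∫⁻ s, ‖y - x‖ₑ ^ 2 * ‖hessian (fun y => f y s) (x + u • (y - x))‖ₑ ^ 2 ∂P ∂ν := by
        refine lintegral_lintegral_swap ?_
        exact ((hmeas.enorm.pow_const 2).const_mul _).aemeasurable
    _ ≤ ∫⁻ _u, ‖y - x‖ₑ ^ 2 * c ∂ν := by
        refine setLIntegral_mono measurable_const fun u hu => ?_
        rw [lintegral_const_mul _ ?_]
        · gcongr
          refine hc _ ?_
          rw [sub_add_cancel_left, norm_neg, norm_smul, norm_sub_rev x y,
            Real.norm_of_nonneg hu.1.le]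
          exact mul_le_of_le_one_left (norm_nonneg _) hu.2
        · exact (hmeas.comp (measurable_prodMk_right (y := u))).enorm.pow_const 2
    _ = ‖y - x‖ₑ ^ 2 * c := by simp

theorem HessianVarianceBounded.lintegral_hessian_sq_le {K₀ K₁ : ℝ} (hK₀ : 0 ≤ K₀) (hK₁ : 0 ≤ K₁)
    (h : HessianVarianceBounded P f F K₀ K₁) {z : E n} {l : ℝ} (hl : ‖hessian F z‖ ≤ l) :
    ∫⁻ s, ‖hessian (fun y => f y s) z‖ₑ ^ 2 ∂P
      ≤ ENNReal.ofReal ((2 * (K₀ + K₁ * ‖gradient F z‖ + l)) ^ 2) := by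
  have hl0 : 0 ≤ l := (norm_nonneg _).trans hl
  have hI := h.integrable_sq z
  have hI2 : Integrable (fun s => 2 * ‖hessian (fun y => f y s) z - hessian F z‖ ^ 2 + 2 * l ^ 2) P :=
    (hI.const_mul 2).add (integrable_const _)
  calc ∫⁻ s, ‖hessian (fun y => f y s) z‖ₑ ^ 2 ∂P
      ≤ ∫⁻ s, ENNReal.ofReal (2 * ‖hessian (fun y => f y s) z - hessian F z‖ ^ 2 + 2 * l ^ 2) ∂P := by
        refine lintegral_mono fun s => ?_
        rw [← ofReal_norm_sq]
        refine ENNReal.ofReal_le_ofReal ?_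
        have h1 : ‖hessian (fun y => f y s) z‖
            ≤ ‖hessian (fun y => f y s) z - hessian F z‖ + l := by
          have := norm_add_le (hessian (fun y => f y s) z - hessian F z) (hessian F z)
          rw [sub_add_cancel] at this
          linarith
        nlinarith [norm_nonneg (hessian (fun y => f y s) z),
          sq_nonneg (‖hessian (fun y => f y s) z - hessian F z‖ - l)]
    _ = ENNReal.ofReal (∫ s, (2 * ‖hessian (fun y => f y s) z - hessian F z‖ ^ 2 + 2 * l ^ 2) ∂P) :=
        (ofReal_integral_eq_lintegral_ofReal hI2
          (Filter.Eventually.of_forall fun s => by positivity)).symm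
    _ ≤ _ := by
        refine ENNReal.ofReal_le_ofReal ?_
        rw [integral_add (hI.const_mul 2) (integrable_const _), integral_const_mul, integral_const]
        have hv := h.variance_le z
        have hG := norm_nonneg (gradient F z)
        have : 0 ≤ K₁ * ‖gradient F z‖ := by positivity
        simp only [probReal_univ, smul_eq_mul, one_mul]
        nlinarith [mul_nonneg hK₀ this, mul_nonneg hK₀ hl0, mul_nonneg this hl0]

/-- Components of an objective with bounded Hessian variance have mean square Lipschitz
gradients. -/
theorem lintegral_centred_gradient_difference_le {L₀ L₁ K₀ K₁ Δ : ℝ} (hL₀ : 0 ≤ L₀)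
    (hL₁ : 0 ≤ L₁) (hK₀ : 0 ≤ K₀) (hK₁ : 0 ≤ K₁) (hΔ1 : Δ ≤ 1)
    (hLΔ : L₁ * Δ ≤ 1) (h : IsStochasticObjective P f F) (hF : TwiceDifferentiable F)
    (hsm : GeneralizedSmooth F L₀ L₁)
    (hK : HessianVarianceBounded P f F K₀ K₁) {x y : E n} (hxy : ‖x - y‖ ≤ Δ) :
    ∫⁻ s, ENNReal.ofReal (‖(gradient (fun y => f y s) y - gradient F y)
        - (gradient (fun y => f y s) x - gradient F x)‖ ^ 2) ∂P
      ≤ ENNReal.ofReal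
        ((Δ * (4 * (K₀ + L₀ + (K₁ + L₁) * (2 * ‖gradient F x‖ + L₀)))) ^ 2) := by
  have hΔ : 0 ≤ Δ := (norm_nonneg _).trans hxy
  have hGx := norm_nonneg (gradient F x)
  set Γ := 2 * ‖gradient F x‖ + L₀ with hΓ
  have hΓ0 : 0 ≤ Γ := by positivity
  -- `c` bounds both the root mean square of the component Hessians near `x` and the Lipschitz
  -- constant of the mean gradient. Centring doubles it, whence the `4` in the statement.
  set c := 2 * (K₀ + L₀ + (K₁ + L₁) * Γ) with hc
  have hc0 : 0 ≤ c := by positivity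
  have hnear : ∀ z, ‖x - z‖ ≤ ‖x - y‖ → ‖gradient F z‖ ≤ Γ := by
    intro z hz
    have h1 := hsm.norm_gradient_le hL₀ hL₁ hLΔ (hz.trans hxy)
    nlinarith
  have hD : ∫⁻ s, ‖gradient (fun y => f y s) y - gradient (fun y => f y s) x‖ₑ ^ 2 ∂P
      ≤ ENNReal.ofReal ((Δ * c) ^ 2) := by
    refine (h.lintegral_gradient_sub_sq_le (c := ENNReal.ofReal (c ^ 2)) fun z hz => ?_).trans ?_
    · refine (hK.lintegral_hessian_sq_le hK₀ hK₁ (hsm.norm_hessian_le hL₀ hL₁ hF z)).trans ?_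
      refine ENNReal.ofReal_le_ofReal ?_
      have := hnear z hz
      refine pow_le_pow_left₀ (by positivity) ?_ 2
      rw [hc]
      nlinarith [mul_le_mul_of_nonneg_left this hK₁, mul_le_mul_of_nonneg_left this hL₁]
    · rw [← ofReal_norm_sq, ← ENNReal.ofReal_mul (by positivity), norm_sub_rev y x, mul_pow Δ c]
      exact ENNReal.ofReal_le_ofReal
        (mul_le_mul_of_nonneg_right (pow_le_pow_left₀ (norm_nonneg _) hxy 2) (sq_nonneg _))
  have hmean : ‖gradient F y - gradient F x‖ ≤ Δ * c := by
    rw [norm_sub_rev]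
    refine (hsm.2 x y ((mul_le_mul_of_nonneg_left hxy hL₁).trans hLΔ)).trans ?_
    rw [mul_comm]
    refine mul_le_mul hxy ?_ (by positivity) hΔ
    nlinarith [mul_nonneg hK₁ hΓ0, mul_nonneg hL₁ hGx, mul_nonneg hL₁ hL₀]
  calc ∫⁻ s, ENNReal.ofReal (‖(gradient (fun y => f y s) y - gradient F y)
        - (gradient (fun y => f y s) x - gradient F x)‖ ^ 2) ∂P
      ≤ ∫⁻ s, (ENNReal.ofReal 2 *
          ‖gradient (fun y => f y s) y - gradient (fun y => f y s) x‖ₑ ^ 2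
          + ENNReal.ofReal (2 * (Δ * c) ^ 2)) ∂P := by
        refine lintegral_mono fun s => ?_
        rw [← ofReal_norm_sq, ← ENNReal.ofReal_mul (by norm_num),
          ← ENNReal.ofReal_add (by positivity) (by positivity)]
        refine ENNReal.ofReal_le_ofReal ?_
        have h1 := norm_sub_le (gradient (fun y => f y s) y - gradient (fun y => f y s) x)
          (gradient F y - gradient F x)
        rw [sub_sub_sub_comm]
        set a := ‖gradient (fun y => f y s) y - gradient (fun y => f y s) x‖
        have h2 := norm_nonneg (gradient (fun y => f y s) y - gradient (fun y => f y s) x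
          - (gradient F y - gradient F x))
        have h3 : ‖gradient (fun y => f y s) y - gradient (fun y => f y s) x
          - (gradient F y - gradient F x)‖ ≤ a + Δ * c := h1.trans (by linarith)
        nlinarith [sq_nonneg (a - Δ * c)]
    _ = ENNReal.ofReal 2 *
          (∫⁻ s, ‖gradient (fun y => f y s) y - gradient (fun y => f y s) x‖ₑ ^ 2 ∂P)
          + ENNReal.ofReal (2 * (Δ * c) ^ 2) := by
        rw [lintegral_add_right _ measurable_const, lintegral_const_mul' _ _ (by simp)]
        simp
    _ ≤ ENNReal.ofReal 2 * ENNReal.ofReal ((Δ * c) ^ 2) + ENNReal.ofReal (2 * (Δ * c) ^ 2) := by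
        gcongr
    _ = _ := by
        rw [← ENNReal.ofReal_mul (by norm_num), ← ENNReal.ofReal_add (by positivity) (by positivity)]
        congr 1
        rw [hc]
        ring

end MeanSquare

/-! ### Integration over a fresh batch -/

section Fresh

theorem IsStochasticObjective.measurable_batch_gradient {n : ℕ} {Ξ : Type*} [MeasurableSpace Ξ]
    {P : Measure Ξ} {f : E n → Ξ → ℝ} {F : E n → ℝ} (h : IsStochasticObjective P f F)
    {α : Type*} {mα : MeasurableSpace α} {m : ℕ} {X : α → E n} {S : Fin m → α → Ξ}
    (hX : Measurable X) (hS : ∀ j, Measurable (S j)) :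
    Measurable fun a => gradient (batchFun f fun j => S j a) (X a) := by
  simp only [gradient_batchFun h.twiceDifferentiable]
  have : ∀ j, Measurable fun a => gradient (fun y => f y (S j a)) (X a) := fun j =>
    h.measurable_gradient.comp (hX.prodMk (hS j))
  fun_prop

theorem IsStochasticObjective.measurable_batch_hessian {n : ℕ} {Ξ : Type*} [MeasurableSpace Ξ]
    {P : Measure Ξ} {f : E n → Ξ → ℝ} {F : E n → ℝ} (h : IsStochasticObjective P f F)
    {α : Type*} {mα : MeasurableSpace α} {m : ℕ} {X : α → E n} {S : Fin m → α → Ξ}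
    (hX : Measurable X) (hS : ∀ j, Measurable (S j)) :
    Measurable fun a => hessian (batchFun f fun j => S j a) (X a) := by
  simp only [hessian_batchFun h.twiceDifferentiable]
  have : ∀ j, Measurable fun a => hessian (fun y => f y (S j a)) (X a) := fun j =>
    h.measurable_hessian.comp (hX.prodMk (hS j))
  fun_prop

/-- The freezing lemma: a variable known from the past and a fresh batch have a product joint law,
so the past may be held fixed while integrating over the batch. Nonnegative integrands avoid
conditional expectations and integrability conditions. -/
theorem lintegral_fresh_batch {Ω Ξ α ι : Type*} {𝒢 : MeasurableSpace Ω} [mΩ : MeasurableSpace Ω] [MeasurableSpace Ξ]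
    [MeasurableSpace α] [Fintype ι] {μ : Measure Ω} [IsProbabilityMeasure μ] {P : Measure Ξ}
    {S : ι → Ω → Ξ} (hS : ∀ i, Measurable (S i))
    (hlaw : ∀ i, μ.map (S i) = P) (hind : iIndepFun S μ) (h𝒢 : 𝒢 ≤ mΩ)
    (hpast : Indep (⨆ i, MeasurableSpace.comap (S i) inferInstance) 𝒢 μ) {m : ℕ} {e : Fin m → ι}
    (he : Function.Injective e) {Z : Ω → α} (hZ : Measurable[𝒢] Z)
    {h : α × (Fin m → Ξ) → ENNReal} (hh : Measurable h) :
    ∫⁻ ω, h (Z ω, fun j => S (e j) ω) ∂μ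
      = ∫⁻ ω, ∫⁻ y, h (Z ω, y) ∂(Measure.pi fun _ : Fin m => P) ∂μ := by
  have hZ' : Measurable Z := hZ.mono h𝒢 le_rfl
  have hY : Measurable fun ω (j : Fin m) => S (e j) ω := measurable_pi_lambda _ fun j => hS (e j)
  have hYlaw : μ.map (fun ω (j : Fin m) => S (e j) ω) = Measure.pi fun _ : Fin m => P := by
    rw [(iIndepFun_iff_map_fun_eq_pi_map fun j => (hS (e j)).aemeasurable).mp
      (hind.precomp he)]
    simp only [hlaw]
  have hindep : IndepFun Z (fun ω (j : Fin m) => S (e j) ω) μ := by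
    rw [IndepFun_iff_Indep]
    refine indep_of_indep_of_le_left (indep_of_indep_of_le_right hpast.symm ?_) hZ.comap_le
    refine Measurable.comap_le ?_
    refine @measurable_pi_lambda _ _ _ (_) _ _ fun j => ?_
    exact (comap_measurable (S (e j))).mono
      (le_iSup (fun i => MeasurableSpace.comap (S i) inferInstance) (e j)) le_rfl
  have hprod := (indepFun_iff_map_prod_eq_prod_map_map hZ'.aemeasurable hY.aemeasurable).mp hindep
  have : IsProbabilityMeasure (Measure.pi fun _ : Fin m => P) := by
    rw [← hYlaw]; exact Measure.isProbabilityMeasure_map hY.aemeasurable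
  rw [← lintegral_map (f := h) hh (hZ'.prodMk hY), hprod, hYlaw, lintegral_prod _ hh.aemeasurable,
    lintegral_map hh.lintegral_prod_right' hZ']

variable {n : ℕ} {Ξ Ω : Type*} [MeasurableSpace Ξ] [mΩ : MeasurableSpace Ω] {P : Measure Ξ}
  {f : E n → Ξ → ℝ} {F : E n → ℝ} {x₀ : E n} {p : Params} {T : ℕ} {μ : Measure Ω}

theorem Run.sample_measurable_law (R : Run P f F x₀ p T μ) {t : ℕ} (ht : t < T)
    (i : Fin (p.gradBatch t) ⊕ Fin p.S₂) :
    Measurable (Sum.elim (R.gradSample t) (R.hessSample t) i) ∧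
      μ.map (Sum.elim (R.gradSample t) (R.hessSample t) i) = P := by
  cases i with
  | inl j => exact ⟨(R.gradSample_measurable t ht j).mono (R.ℱ.le _) le_rfl,
      R.gradSample_law t ht j⟩
  | inr j => exact ⟨(R.hessSample_measurable t ht j).mono (R.ℱ.le _) le_rfl,
      R.hessSample_law t ht j⟩

theorem Run.measurable_g (R : Run P f F x₀ p T μ) (h : IsStochasticObjective P f F) {t : ℕ}
    (ht : t < T) : Measurable[R.ℱ (t + 1)] (R.g t) := by
  induction t with
  | zero =>
    have e : R.g 0 = fun ω => gradient (batchFun f fun j => R.gradSample 0 j ω) (R.x 0 ω) :=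
      funext fun ω => R.g_restart 0 ht (Nat.zero_mod _) ω
    rw [e]
    exact h.measurable_batch_gradient
      ((R.x_measurable 0 ht.le).mono (R.ℱ.mono (Nat.le_succ _)) le_rfl)
      (R.gradSample_measurable 0 ht)
  | succ t ih =>
    have hx1 := (R.x_measurable (t + 1) ht.le).mono (R.ℱ.mono (Nat.le_succ _)) le_rfl
    by_cases hq : (t + 1) % p.q = 0
    · have e : R.g (t + 1)
          = fun ω => gradient (batchFun f fun j => R.gradSample (t + 1) j ω) (R.x (t + 1) ω) :=
        funext fun ω => R.g_restart (t + 1) ht hq ω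
      rw [e]
      exact h.measurable_batch_gradient hx1 (R.gradSample_measurable (t + 1) ht)
    · have e : R.g (t + 1) = fun ω => R.g t ω
          + gradient (batchFun f (fun j => R.gradSample (t + 1) j ω)) (R.x (t + 1) ω)
          - gradient (batchFun f (fun j => R.gradSample (t + 1) j ω)) (R.x t ω) :=
        funext fun ω => R.g_spider t ht hq ω
      rw [e]
      have hg := (ih (by omega)).mono (R.ℱ.mono (Nat.le_succ _)) le_rfl
      have hx0 := (R.x_measurable t (by omega)).mono
        (R.ℱ.mono (show t ≤ t + 1 + 1 by omega)) le_rfl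
      exact (hg.add (h.measurable_batch_gradient hx1 (R.gradSample_measurable (t + 1) ht))).sub
        (h.measurable_batch_gradient hx0 (R.gradSample_measurable (t + 1) ht))

variable [IsProbabilityMeasure μ]

theorem Run.lintegral_gradBatch (R : Run P f F x₀ p T μ) {t : ℕ} (ht : t < T) {α : Type*}
    [MeasurableSpace α] {Z : Ω → α} (hZ : Measurable[R.ℱ t] Z)
    {h : α × (Fin (p.gradBatch t) → Ξ) → ENNReal} (hh : Measurable h) :
    ∫⁻ ω, h (Z ω, fun j => R.gradSample t j ω) ∂μ
      = ∫⁻ ω, ∫⁻ y, h (Z ω, y) ∂(Measure.pi fun _ => P) ∂μ :=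
  lintegral_fresh_batch (fun i => (R.sample_measurable_law ht i).1)
    (fun i => (R.sample_measurable_law ht i).2) (R.samples_iIndep t ht) (R.ℱ.le t)
    (R.samples_indep_past t ht) Sum.inl_injective hZ hh

theorem Run.lintegral_hessBatch (R : Run P f F x₀ p T μ) {t : ℕ} (ht : t < T) {α : Type*}
    [MeasurableSpace α] {Z : Ω → α} (hZ : Measurable[R.ℱ t] Z)
    {h : α × (Fin p.S₂ → Ξ) → ENNReal} (hh : Measurable h) :
    ∫⁻ ω, h (Z ω, fun j => R.hessSample t j ω) ∂μ
      = ∫⁻ ω, ∫⁻ y, h (Z ω, y) ∂(Measure.pi fun _ => P) ∂μ :=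
  lintegral_fresh_batch (fun i => (R.sample_measurable_law ht i).1)
    (fun i => (R.sample_measurable_law ht i).2) (R.samples_iIndep t ht) (R.ℱ.le t)
    (R.samples_indep_past t ht) Sum.inr_injective hZ hh

end Fresh

/-! ### Estimation errors along a run -/

section Errors

theorem average_sub {m : ℕ} (hm : 0 < m) {B : Type*} [AddCommGroup B] [Module ℝ B]
    (z : Fin m → B) (b : B) :
    (m : ℝ)⁻¹ • ∑ j, z j - b = (m : ℝ)⁻¹ • ∑ j, (z j - b) := by
  have hm' : (m : ℝ) ≠ 0 := by exact_mod_cast hm.ne'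
  rw [Finset.sum_sub_distrib, smul_sub, Finset.sum_const, Finset.card_univ, Fintype.card_fin,
    ← Nat.cast_smul_eq_nsmul ℝ, smul_smul, inv_mul_cancel₀ hm', one_smul]

/-- Bounding a first moment by a weighted second moment. -/
theorem lintegral_ofReal_le_of_sq {α : Type*} [MeasurableSpace α] {μ : Measure α} {a θ : α → ℝ}
    (hθm : Measurable θ) (hθ : ∀ x, 0 < θ x) {c : ℝ} (hc : 0 ≤ c)
    (h : ∫⁻ x, ENNReal.ofReal (a x ^ 2 / θ x) ∂μ ≤ ENNReal.ofReal c * ∫⁻ x, ENNReal.ofReal (θ x) ∂μ) :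
    ∫⁻ x, ENNReal.ofReal (a x) ∂μ
      ≤ ENNReal.ofReal ((1 + c) / 2) * ∫⁻ x, ENNReal.ofReal (θ x) ∂μ := by
  calc ∫⁻ x, ENNReal.ofReal (a x) ∂μ
      ≤ ∫⁻ x, (ENNReal.ofReal (1 / 2) * ENNReal.ofReal (θ x)
          + ENNReal.ofReal (1 / 2) * ENNReal.ofReal (a x ^ 2 / θ x)) ∂μ := by
        refine lintegral_mono fun x => ?_
        have hx := hθ x
        rw [← ENNReal.ofReal_mul (by norm_num), ← ENNReal.ofReal_mul (by norm_num),
          ← ENNReal.ofReal_add (by positivity) (by positivity)]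
        refine ENNReal.ofReal_le_ofReal ?_
        have h1 : 2 * a x ≤ θ x + a x ^ 2 / θ x := by
          rw [← sub_nonneg]
          have : θ x + a x ^ 2 / θ x - 2 * a x = (θ x - a x) ^ 2 / θ x := by
            field_simp; ring
          rw [this]; positivity
        linarith
    _ = ENNReal.ofReal (1 / 2) * ∫⁻ x, ENNReal.ofReal (θ x) ∂μ
          + ENNReal.ofReal (1 / 2) * ∫⁻ x, ENNReal.ofReal (a x ^ 2 / θ x) ∂μ := by
        rw [lintegral_add_left (by fun_prop), lintegral_const_mul' _ _ ENNReal.ofReal_ne_top,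
          lintegral_const_mul' _ _ ENNReal.ofReal_ne_top]
    _ ≤ ENNReal.ofReal (1 / 2) * ∫⁻ x, ENNReal.ofReal (θ x) ∂μ
          + ENNReal.ofReal (1 / 2) * (ENNReal.ofReal c * ∫⁻ x, ENNReal.ofReal (θ x) ∂μ) := by
        gcongr
    _ = _ := by
        rw [← mul_assoc, ← ENNReal.ofReal_mul (by norm_num), ← add_mul,
          ← ENNReal.ofReal_add (by norm_num) (by positivity)]
        congr 2
        ring

variable {n : ℕ} {Ξ Ω : Type*} [MeasurableSpace Ξ] [mΩ : MeasurableSpace Ω] {P : Measure Ξ}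
  [IsProbabilityMeasure P]
  {f : E n → Ξ → ℝ} {F : E n → ℝ} {x₀ : E n} {p : Params} {T : ℕ} {μ : Measure Ω}
  [IsProbabilityMeasure μ]

/-- Given the past, the mean square error is at most `3 θ²` for the weight `θ = Δ (1 + K₀ + K₁
‖∇F‖)`. Dividing by `θ` before integrating leaves only first moments of the gradient; the summand
`1` keeps `θ` positive. -/
theorem Run.lintegral_hessian_error_le (R : Run P f F x₀ p T μ) (hn : 2 ≤ n)
    (h : IsStochasticObjective P f F) (hF : TwiceDifferentiable F)
    (hFh : Continuous (hessian F)) {K₀ K₁ Δ : ℝ} (hK₀ : 0 ≤ K₀) (hK₁ : 0 ≤ K₁) (hΔ : 0 < Δ)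
    (hK : HessianVarianceBounded P f F K₀ K₁) (hS : 22 * Real.log n ≤ p.S₂ * Δ ^ 2)
    {t : ℕ} (ht : t < T) :
    ∫⁻ ω, ENNReal.ofReal ‖R.H t ω - hessian F (R.x t ω)‖ ∂μ
      ≤ ENNReal.ofReal (2 * Δ) *
        ∫⁻ ω, ENNReal.ofReal (1 + K₀ + K₁ * ‖gradient F (R.x t ω)‖) ∂μ := by
  have hlog : 0 < Real.log n := Real.log_pos (by exact_mod_cast hn)
  have hm : 0 < p.S₂ := by
    by_contra! h0
    have : p.S₂ = 0 := by omega
    rw [this] at hS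
    simp at hS
    linarith
  have hm' : (0 : ℝ) < p.S₂ := by exact_mod_cast hm
  have hxm : Measurable (R.x t) := (R.x_measurable t ht.le).mono (R.ℱ.le _) le_rfl
  have hgc := hF.continuous_gradient
  set θ : E n → ℝ := fun x => Δ * (1 + K₀ + K₁ * ‖gradient F x‖) with hθ
  have hθm : Measurable θ := by
    have : Continuous θ := by fun_prop
    exact this.measurable
  have hθpos : ∀ x, 0 < θ x := fun x => by positivity
  have hsq : ∫⁻ ω, ENNReal.ofReal (‖R.H t ω - hessian F (R.x t ω)‖ ^ 2 / θ (R.x t ω)) ∂μ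
      ≤ ENNReal.ofReal 3 * ∫⁻ ω, ENNReal.ofReal (θ (R.x t ω)) ∂μ := by
    set φ : E n × (Fin p.S₂ → Ξ) → ENNReal := fun z =>
      ENNReal.ofReal (‖hessian (batchFun f z.2) z.1 - hessian F z.1‖ ^ 2 / θ z.1) with hφ
    have hφm : Measurable φ := by
      have h1 : Measurable fun z : E n × (Fin p.S₂ → Ξ) => hessian (batchFun f z.2) z.1 :=
        h.measurable_batch_hessian (S := fun j (z : E n × (Fin p.S₂ → Ξ)) => z.2 j)
          measurable_fst fun j => by fun_prop
      have h2 : Measurable (hessian F) := hFh.measurable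
      fun_prop
    have := R.lintegral_hessBatch ht (R.x_measurable t ht.le) hφm
    simp only [hφ] at this
    simp only [R.H_eq t ht]
    rw [this, ← lintegral_const_mul' _ _ ENNReal.ofReal_ne_top]
    refine lintegral_mono fun ω => ?_
    set x := R.x t ω
    have hθx := hθpos x
    have hK2 := hK.variance_le x
    have havg := lintegral_norm_sq_average_operator_le (P := P) hn
      (A := fun s => hessian (fun y => f y s) x - hessian F x)
      ((h.measurable_hessian.comp (measurable_prodMk_left (x := x))).sub_const _)
      ((hK.integrable x).sub (integrable_const _))
      (by rw [integral_sub (hK.integrable x) (integrable_const _), hK.unbiased]; simp)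
      (fun s => by
        have := ((h.twiceDifferentiable s).hessian_isSymmetric x).sub (hF.hessian_isSymmetric x)
        simpa using this)
      (v := K₀ ^ 2 + K₁ ^ 2 * ‖gradient F x‖ ^ 2)
      (by
        rw [← ofReal_integral_eq_lintegral_ofReal (hK.integrable_sq x)
          (Filter.Eventually.of_forall fun s => by positivity)]
        exact ENNReal.ofReal_le_ofReal hK2) hm
    calc ∫⁻ y, ENNReal.ofReal (‖hessian (batchFun f y) x - hessian F x‖ ^ 2 / θ x)
          ∂(Measure.pi fun _ => P)
        = ENNReal.ofReal ((θ x)⁻¹) * ∫⁻ y, ENNReal.ofReal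
            (‖(p.S₂ : ℝ)⁻¹ • ∑ j, (hessian (fun z => f z (y j)) x - hessian F x)‖ ^ 2)
          ∂(Measure.pi fun _ => P) := by
          rw [← lintegral_const_mul' _ _ ENNReal.ofReal_ne_top]
          refine lintegral_congr fun y => ?_
          rw [hessian_batchFun h.twiceDifferentiable, average_sub hm,
            ← ENNReal.ofReal_mul (by positivity), div_eq_inv_mul]
      _ ≤ ENNReal.ofReal ((θ x)⁻¹) * ENNReal.ofReal (56 * Real.log n / p.S₂ *
            (K₀ ^ 2 + K₁ ^ 2 * ‖gradient F x‖ ^ 2)) := by gcongr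
      _ ≤ ENNReal.ofReal 3 * ENNReal.ofReal (θ x) := by
          rw [← ENNReal.ofReal_mul (by positivity), ← ENNReal.ofReal_mul (by norm_num)]
          refine ENNReal.ofReal_le_ofReal ?_
          rw [inv_mul_le_iff₀ hθx]
          -- The batch constant enters here: `56 / 22 < 3`.
          have h1 : 56 * Real.log n / p.S₂ ≤ 3 * Δ ^ 2 := by
            rw [div_le_iff₀ hm']; nlinarith
          have hG := norm_nonneg (gradient F x)
          have h2 : K₀ ^ 2 + K₁ ^ 2 * ‖gradient F x‖ ^ 2
              ≤ (1 + K₀ + K₁ * ‖gradient F x‖) ^ 2 := by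
            nlinarith [mul_nonneg hK₁ hG, mul_nonneg hK₀ (mul_nonneg hK₁ hG)]
          calc _ ≤ 3 * Δ ^ 2 * (1 + K₀ + K₁ * ‖gradient F x‖) ^ 2 := by gcongr
            _ = θ x * (3 * θ x) := by rw [hθ]; ring
  have := lintegral_ofReal_le_of_sq (a := fun ω => ‖R.H t ω - hessian F (R.x t ω)‖)
    (θ := fun ω => θ (R.x t ω)) (hθm.comp hxm) (fun ω => hθpos _) (by norm_num) hsq
  refine this.trans (le_of_eq ?_)
  rw [← lintegral_const_mul' _ _ ENNReal.ofReal_ne_top,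
    ← lintegral_const_mul' _ _ ENNReal.ofReal_ne_top]
  refine lintegral_congr fun ω => ?_
  rw [← ENNReal.ofReal_mul (by norm_num), ← ENNReal.ofReal_mul (by positivity)]
  congr 1
  simp only [hθ]
  ring

/-- The weight is known before the batch is drawn, so it is a constant in the inner integral, where
the variance is at most `W² / |S₁| ≤ Δ⁴ W²`. -/
theorem Run.lintegral_restart_error_le (R : Run P f F x₀ p T μ)
    (h : IsStochasticObjective P f F) (hF : TwiceDifferentiable F) {G₀ G₁ Δ : ℝ} (hG₀ : 0 ≤ G₀)
    (hG₁ : 0 ≤ G₁) (hG : GradientVarianceBounded P f F G₀ G₁)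
    (hS : 1 ≤ p.S₁ * Δ ^ 4) {t : ℕ} (ht : t < T) (hq : t % p.q = 0) {W : Ω → ℝ}
    (hWm : Measurable[R.ℱ t] W) (hW : ∀ ω, 0 < W ω)
    (hWG : ∀ ω, G₀ + G₁ * ‖gradient F (R.x t ω)‖ ≤ W ω) :
    ∫⁻ ω, ENNReal.ofReal (‖R.g t ω - gradient F (R.x t ω)‖ ^ 2 / W ω) ∂μ
      ≤ ENNReal.ofReal (Δ ^ 4) * ∫⁻ ω, ENNReal.ofReal (W ω) ∂μ := by
  have hmeq : p.gradBatch t = p.S₁ := by simp [Params.gradBatch, hq]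
  have hm : 0 < p.gradBatch t := by
    rw [hmeq]
    by_contra! h0
    have : p.S₁ = 0 := by omega
    rw [this] at hS
    norm_num at hS
  have hm' : (0 : ℝ) < p.gradBatch t := by exact_mod_cast hm
  have hS' : 1 ≤ p.gradBatch t * Δ ^ 4 := by rw [hmeq]; exact hS
  set φ : (E n × ℝ) × (Fin (p.gradBatch t) → Ξ) → ENNReal := fun z =>
    ENNReal.ofReal (‖gradient (batchFun f z.2) z.1.1 - gradient F z.1.1‖ ^ 2 / z.1.2) with hφ
  have hφm : Measurable φ := by
    have h1 : Measurable fun z : (E n × ℝ) × (Fin (p.gradBatch t) → Ξ) =>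
        gradient (batchFun f z.2) z.1.1 :=
      h.measurable_batch_gradient
        (S := fun j (z : (E n × ℝ) × (Fin (p.gradBatch t) → Ξ)) => z.2 j)
        (by fun_prop) fun j => by fun_prop
    have h2 : Measurable (gradient F) := hF.continuous_gradient.measurable
    fun_prop
  have := R.lintegral_gradBatch ht ((R.x_measurable t ht.le).prodMk hWm) hφm
  simp only [hφ] at this
  simp only [R.g_restart t ht hq]
  rw [this, ← lintegral_const_mul' _ _ ENNReal.ofReal_ne_top]
  refine lintegral_mono fun ω => ?_
  set x := R.x t ω
  have hWω := hW ω
  have hG2 := hG.variance_le x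
  have havg := lintegral_norm_sq_add_average_le (P := P)
    (Z := fun s => gradient (fun y => f y s) x - gradient F x)
    ((h.measurable_gradient.comp (measurable_prodMk_left (x := x))).sub_const _)
    (by rw [integral_sub (hG.integrable x) (integrable_const _), hG.unbiased]; simp)
    (v := G₀ ^ 2 + G₁ ^ 2 * ‖gradient F x‖ ^ 2)
    (by
      rw [← ofReal_integral_eq_lintegral_ofReal (hG.integrable_sq x)
        (Filter.Eventually.of_forall fun s => by positivity)]
      exact ENNReal.ofReal_le_ofReal hG2) (by positivity) hm 0
  calc ∫⁻ y, ENNReal.ofReal (‖gradient (batchFun f y) x - gradient F x‖ ^ 2 / W ω)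
        ∂(Measure.pi fun _ => P)
      = ENNReal.ofReal ((W ω)⁻¹) * ∫⁻ y, ENNReal.ofReal (‖0 + (p.gradBatch t : ℝ)⁻¹ •
          ∑ j, (gradient (fun z => f z (y j)) x - gradient F x)‖ ^ 2)
        ∂(Measure.pi fun _ => P) := by
        rw [← lintegral_const_mul' _ _ ENNReal.ofReal_ne_top]
        refine lintegral_congr fun y => ?_
        rw [gradient_batchFun h.twiceDifferentiable, average_sub hm, zero_add,
          ← ENNReal.ofReal_mul (by positivity), div_eq_inv_mul]
    _ ≤ ENNReal.ofReal ((W ω)⁻¹) * ENNReal.ofReal (‖(0 : E n)‖ ^ 2 +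
          (G₀ ^ 2 + G₁ ^ 2 * ‖gradient F x‖ ^ 2) / p.gradBatch t) := by gcongr
    _ ≤ ENNReal.ofReal (Δ ^ 4) * ENNReal.ofReal (W ω) := by
        rw [← ENNReal.ofReal_mul (by positivity), ← ENNReal.ofReal_mul (by positivity)]
        refine ENNReal.ofReal_le_ofReal ?_
        rw [inv_mul_le_iff₀ hWω, norm_zero, zero_pow two_ne_zero, zero_add, div_le_iff₀ hm']
        have hGx := norm_nonneg (gradient F x)
        have h1 : G₀ ^ 2 + G₁ ^ 2 * ‖gradient F x‖ ^ 2 ≤ (W ω) ^ 2 := by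
          refine le_trans ?_ (pow_le_pow_left₀ (by positivity) (hWG ω) 2)
          nlinarith [mul_nonneg hG₀ (mul_nonneg hG₁ hGx)]
        nlinarith [mul_le_mul_of_nonneg_left hS' (sq_nonneg (W ω))]

/-- The new error is the old one plus a batch average that is centred given the past, so the cross
term vanishes. The average has variance at most `(Δ W)² / |S₃| ≤ Δ⁵ W²`. -/
theorem Run.lintegral_spider_error_le (R : Run P f F x₀ p T μ)
    (h : IsStochasticObjective P f F) (hF : TwiceDifferentiable F)
    {L₀ L₁ G₀ G₁ K₀ K₁ Δ : ℝ} (hL₀ : 0 ≤ L₀) (hL₁ : 0 ≤ L₁) (hK₀ : 0 ≤ K₀) (hK₁ : 0 ≤ K₁)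
    (hΔ : 0 < Δ) (hΔ1 : Δ ≤ 1) (hLΔ : L₁ * Δ ≤ 1) (hrad : p.radius = Δ)
    (hsm : GeneralizedSmooth F L₀ L₁) (hG : GradientVarianceBounded P f F G₀ G₁)
    (hK : HessianVarianceBounded P f F K₀ K₁) (hS : 1 ≤ p.S₃ * Δ ^ 3) {t : ℕ} (ht : t + 1 < T)
    (hq : (t + 1) % p.q ≠ 0) {W : Ω → ℝ} (hWm : Measurable[R.ℱ (t + 1)] W) (hW : ∀ ω, 0 < W ω)
    (hWA : ∀ ω, 4 * (K₀ + L₀ + (K₁ + L₁) * (2 * ‖gradient F (R.x t ω)‖ + L₀)) ≤ W ω) :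
    ∫⁻ ω, ENNReal.ofReal (‖R.g (t + 1) ω - gradient F (R.x (t + 1) ω)‖ ^ 2 / W ω) ∂μ
      ≤ ∫⁻ ω, ENNReal.ofReal (‖R.g t ω - gradient F (R.x t ω)‖ ^ 2 / W ω) ∂μ
        + ENNReal.ofReal (Δ ^ 5) * ∫⁻ ω, ENNReal.ofReal (W ω) ∂μ := by
  have hmeq : p.gradBatch (t + 1) = p.S₃ := by simp [Params.gradBatch, hq]
  have hm : 0 < p.gradBatch (t + 1) := by
    rw [hmeq]
    by_contra! h0
    have : p.S₃ = 0 := by omega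
    rw [this] at hS
    norm_num at hS
  have hm' : (0 : ℝ) < p.gradBatch (t + 1) := by exact_mod_cast hm
  have hS' : 1 ≤ p.gradBatch (t + 1) * Δ ^ 3 := by rw [hmeq]; exact hS
  have hgF : Measurable (gradient F) := hF.continuous_gradient.measurable
  have hx0 : Measurable[R.ℱ (t + 1)] (R.x t) :=
    (R.x_measurable t (by omega)).mono (R.ℱ.mono (Nat.le_succ _)) le_rfl
  have hx1 : Measurable[R.ℱ (t + 1)] (R.x (t + 1)) := R.x_measurable (t + 1) ht.le
  have he : Measurable[R.ℱ (t + 1)] fun ω => R.g t ω - gradient F (R.x t ω) :=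
    (R.measurable_g h (by omega)).sub (hgF.comp hx0)
  set φ : (E n × E n × E n × ℝ) × (Fin (p.gradBatch (t + 1)) → Ξ) → ENNReal := fun z =>
    ENNReal.ofReal (‖z.1.1 + ((gradient (batchFun f z.2) z.1.2.1 - gradient F z.1.2.1)
      - (gradient (batchFun f z.2) z.1.2.2.1 - gradient F z.1.2.2.1))‖ ^ 2 / z.1.2.2.2) with hφ
  have hφm : Measurable φ := by
    have h1 : Measurable fun z : (E n × E n × E n × ℝ) × (Fin (p.gradBatch (t + 1)) → Ξ) =>
        gradient (batchFun f z.2) z.1.2.1 :=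
      h.measurable_batch_gradient
        (S := fun j (z : (E n × E n × E n × ℝ) × (Fin (p.gradBatch (t + 1)) → Ξ)) => z.2 j)
        (by fun_prop) fun j => by fun_prop
    have h2 : Measurable fun z : (E n × E n × E n × ℝ) × (Fin (p.gradBatch (t + 1)) → Ξ) =>
        gradient (batchFun f z.2) z.1.2.2.1 :=
      h.measurable_batch_gradient
        (S := fun j (z : (E n × E n × E n × ℝ) × (Fin (p.gradBatch (t + 1)) → Ξ)) => z.2 j)
        (by fun_prop) fun j => by fun_prop
    fun_prop
  have := R.lintegral_gradBatch ht (he.prodMk (hx1.prodMk (hx0.prodMk hWm))) hφm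
  simp only [hφ] at this
  have e1 : ∀ ω, R.g (t + 1) ω - gradient F (R.x (t + 1) ω)
      = (R.g t ω - gradient F (R.x t ω))
        + ((gradient (batchFun f fun j => R.gradSample (t + 1) j ω) (R.x (t + 1) ω)
            - gradient F (R.x (t + 1) ω))
          - (gradient (batchFun f fun j => R.gradSample (t + 1) j ω) (R.x t ω)
            - gradient F (R.x t ω))) := by
    intro ω
    rw [R.g_spider t ht hq ω]
    abel
  simp only [e1]
  have hWm' : Measurable W := hWm.mono (R.ℱ.le _) le_rfl
  rw [this, ← lintegral_const_mul' _ _ ENNReal.ofReal_ne_top,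
    ← lintegral_add_right _ (by fun_prop)]
  refine lintegral_mono fun ω => ?_
  set x := R.x t ω with hx
  set y := R.x (t + 1) ω with hy
  set e := R.g t ω - gradient F x with hedef
  have hWω := hW ω
  have hxy : ‖x - y‖ ≤ Δ := by
    have := (R.step t (by omega) ω).1
    rwa [hrad, norm_sub_rev] at this
  set a := 4 * (K₀ + L₀ + (K₁ + L₁) * (2 * ‖gradient F x‖ + L₀)) with ha
  have ha0 : 0 ≤ a := by positivity
  have havg := lintegral_norm_sq_add_average_le (P := P)
    (Z := fun s => (gradient (fun y => f y s) y - gradient F y)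
        - (gradient (fun y => f y s) x - gradient F x))
    (((h.measurable_gradient.comp (measurable_prodMk_left (x := y))).sub_const _).sub
      ((h.measurable_gradient.comp (measurable_prodMk_left (x := x))).sub_const _))
    (by
      have hI : ∀ z, Integrable (fun s => gradient (fun y => f y s) z - gradient F z) P :=
        fun z => (hG.integrable z).sub (integrable_const _)
      rw [integral_sub (hI y) (hI x),
        integral_sub (hG.integrable y) (integrable_const _),
        integral_sub (hG.integrable x) (integrable_const _), hG.unbiased, hG.unbiased]
      simp)
    (lintegral_centred_gradient_difference_le hL₀ hL₁ hK₀ hK₁ hΔ1 hLΔ h hF hsm hK hxy)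
    (by positivity) hm e
  calc ∫⁻ s, ENNReal.ofReal (‖e + ((gradient (batchFun f s) y - gradient F y)
          - (gradient (batchFun f s) x - gradient F x))‖ ^ 2 / W ω) ∂(Measure.pi fun _ => P)
      = ENNReal.ofReal ((W ω)⁻¹) * ∫⁻ s, ENNReal.ofReal (‖e + (p.gradBatch (t + 1) : ℝ)⁻¹ •
          ∑ j, ((gradient (fun z => f z (s j)) y - gradient F y)
            - (gradient (fun z => f z (s j)) x - gradient F x))‖ ^ 2)
        ∂(Measure.pi fun _ => P) := by
        rw [← lintegral_const_mul' _ _ ENNReal.ofReal_ne_top]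
        refine lintegral_congr fun s => ?_
        rw [gradient_batchFun h.twiceDifferentiable, gradient_batchFun h.twiceDifferentiable,
          average_sub hm _ (gradient F x), average_sub hm _ (gradient F y), ← smul_sub, ← Finset.sum_sub_distrib,
          ← ENNReal.ofReal_mul (by positivity), div_eq_inv_mul]
    _ ≤ ENNReal.ofReal ((W ω)⁻¹) * ENNReal.ofReal (‖e‖ ^ 2 + (Δ * a) ^ 2 / p.gradBatch (t + 1)) := by gcongr
    _ ≤ ENNReal.ofReal (‖e‖ ^ 2 / W ω) + ENNReal.ofReal (Δ ^ 5) * ENNReal.ofReal (W ω) := by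
        rw [← ENNReal.ofReal_mul (by positivity), ← ENNReal.ofReal_mul (by positivity),
          ← ENNReal.ofReal_add (by positivity) (by positivity)]
        refine ENNReal.ofReal_le_ofReal ?_
        rw [inv_mul_le_iff₀ hWω, mul_add, mul_div_cancel₀ _ hWω.ne']
        have h1 : (Δ * a) ^ 2 / p.gradBatch (t + 1) ≤ W ω * (Δ ^ 5 * W ω) := by
          rw [div_le_iff₀ hm']
          have h2 : (Δ * a) ^ 2 ≤ (Δ * W ω) ^ 2 :=
            pow_le_pow_left₀ (by positivity) (mul_le_mul_of_nonneg_left (hWA ω) hΔ.le) 2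
          nlinarith [mul_le_mul_of_nonneg_left hS' (sq_nonneg (Δ * W ω))]
        linarith

/-- The first moment of the gradient error within an epoch. -/
theorem Run.lintegral_gradient_error_le (R : Run P f F x₀ p T μ)
    (h : IsStochasticObjective P f F) (hF : TwiceDifferentiable F)
    {L₀ L₁ G₀ G₁ K₀ K₁ Δ : ℝ} (hL₀ : 0 ≤ L₀) (hL₁ : 0 ≤ L₁) (hG₀ : 0 ≤ G₀) (hG₁ : 0 ≤ G₁)
    (hK₀ : 0 ≤ K₀) (hK₁ : 0 ≤ K₁)
    (hΔ : 0 < Δ) (hΔ1 : Δ ≤ 1) (hLΔ : L₁ * Δ ≤ 1) (hrad : p.radius = Δ)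
    (hsm : GeneralizedSmooth F L₀ L₁) (hG : GradientVarianceBounded P f F G₀ G₁)
    (hK : HessianVarianceBounded P f F K₀ K₁) (hS₁ : 1 ≤ p.S₁ * Δ ^ 4)
    (hS₃ : 1 ≤ p.S₃ * Δ ^ 3) {t k : ℕ} (hq : t % p.q = 0) (hk : k < p.q) (hkΔ : k * Δ ≤ 2)
    (ht : t + k < T) {W : Ω → ℝ} (hWm : Measurable[R.ℱ t] W) (hW : ∀ ω, 0 < W ω)
    (hWG : ∀ ω, G₀ + G₁ * ‖gradient F (R.x t ω)‖ ≤ W ω)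
    (hWA : ∀ j < k, ∀ ω,
      4 * (K₀ + L₀ + (K₁ + L₁) * (2 * ‖gradient F (R.x (t + j) ω)‖ + L₀)) ≤ W ω) :
    ∫⁻ ω, ENNReal.ofReal ‖R.g (t + k) ω - gradient F (R.x (t + k) ω)‖ ∂μ
      ≤ ENNReal.ofReal (2 * Δ ^ 2) * ∫⁻ ω, ENNReal.ofReal (W ω) ∂μ := by
  have hWm' : Measurable W := hWm.mono (R.ℱ.le _) le_rfl
  -- The restart contributes `Δ⁴` and every later iteration `Δ⁵`. As `k Δ ≤ 2`, the total stays
  -- below `3 Δ⁴`.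
  have hrec : ∀ j ≤ k,
      ∫⁻ ω, ENNReal.ofReal (‖R.g (t + j) ω - gradient F (R.x (t + j) ω)‖ ^ 2 / W ω) ∂μ
        ≤ ENNReal.ofReal (Δ ^ 4 + j * Δ ^ 5) * ∫⁻ ω, ENNReal.ofReal (W ω) ∂μ := by
    intro j
    induction j with
    | zero =>
      intro _
      simpa using R.lintegral_restart_error_le h hF hG₀ hG₁ hG hS₁ (by omega) hq hWm hW hWG
    | succ j ih =>
      intro hj
      have hq' : (t + j + 1) % p.q ≠ 0 := by
        rw [add_assoc, Nat.add_mod, hq, zero_add, Nat.mod_mod, Nat.mod_eq_of_lt (by omega)]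
        omega
      have h1 := R.lintegral_spider_error_le h hF hL₀ hL₁ hK₀ hK₁ hΔ hΔ1 hLΔ hrad hsm hG hK hS₃
        (t := t + j) (by omega) hq' (hWm.mono (R.ℱ.mono (by omega)) le_rfl) hW (hWA j (by omega))
      refine h1.trans ((add_le_add (ih (by omega)) le_rfl).trans (le_of_eq ?_))
      rw [← add_mul, ← ENNReal.ofReal_add (by positivity) (by positivity)]
      congr 2
      push_cast
      ring
  -- Rescaling the weight to `Δ² W`, the size of the typical error, balances the two terms of
  -- `lintegral_ofReal_le_of_sq`.
  have hsq : ∫⁻ ω, ENNReal.ofReal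
      (‖R.g (t + k) ω - gradient F (R.x (t + k) ω)‖ ^ 2 / (Δ ^ 2 * W ω)) ∂μ
      ≤ ENNReal.ofReal 3 * ∫⁻ ω, ENNReal.ofReal (Δ ^ 2 * W ω) ∂μ := by
    calc ∫⁻ ω, ENNReal.ofReal (‖R.g (t + k) ω - gradient F (R.x (t + k) ω)‖ ^ 2
            / (Δ ^ 2 * W ω)) ∂μ
        = ENNReal.ofReal ((Δ ^ 2)⁻¹) *
          ∫⁻ ω, ENNReal.ofReal (‖R.g (t + k) ω - gradient F (R.x (t + k) ω)‖ ^ 2 / W ω) ∂μ := by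
          rw [← lintegral_const_mul' _ _ ENNReal.ofReal_ne_top]
          refine lintegral_congr fun ω => ?_
          rw [← ENNReal.ofReal_mul (by positivity)]
          congr 1
          have := (hW ω).ne'
          field_simp
      _ ≤ ENNReal.ofReal ((Δ ^ 2)⁻¹) *
          (ENNReal.ofReal (Δ ^ 4 + k * Δ ^ 5) * ∫⁻ ω, ENNReal.ofReal (W ω) ∂μ) := by
          gcongr; exact hrec k le_rfl
      _ ≤ ENNReal.ofReal (3 * Δ ^ 2) * ∫⁻ ω, ENNReal.ofReal (W ω) ∂μ := by
          rw [← mul_assoc, ← ENNReal.ofReal_mul (by positivity)]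
          refine mul_le_mul' (ENNReal.ofReal_le_ofReal ?_) le_rfl
          rw [inv_mul_le_iff₀ (by positivity)]
          nlinarith [mul_le_mul_of_nonneg_right hkΔ (by positivity : 0 ≤ Δ ^ 4)]
      _ = _ := by
          rw [← lintegral_const_mul' _ _ ENNReal.ofReal_ne_top,
            ← lintegral_const_mul' _ _ ENNReal.ofReal_ne_top]
          refine lintegral_congr fun ω => ?_
          rw [← ENNReal.ofReal_mul (by positivity), ← ENNReal.ofReal_mul (by norm_num)]
          congr 1
          ring
  have hfin := lintegral_ofReal_le_of_sq
    (a := fun ω => ‖R.g (t + k) ω - gradient F (R.x (t + k) ω)‖)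
    (θ := fun ω => Δ ^ 2 * W ω) (by fun_prop)
    (fun ω => mul_pos (by positivity) (hW ω)) (by norm_num) hsq
  refine hfin.trans (le_of_eq ?_)
  rw [← lintegral_const_mul' _ _ ENNReal.ofReal_ne_top,
    ← lintegral_const_mul' _ _ ENNReal.ofReal_ne_top]
  refine lintegral_congr fun ω => ?_
  rw [← ENNReal.ofReal_mul (by norm_num), ← ENNReal.ofReal_mul (by positivity)]
  congr 1
  ring

end Errors

/-! ### Expected progress of a run -/

/-- A discrete Grönwall inequality. -/
theorem le_exp_mul_of_affine_growth {a : ℕ → ℝ} {u v : ℝ} (hu : 0 ≤ u) (hv : 0 ≤ v) {k : ℕ}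
    (h : ∀ j < k, a (j + 1) ≤ (1 + u) * a j + v) (h0 : 0 ≤ a 0) :
    a k ≤ Real.exp (u * k) * (a 0 + v * k) := by
  induction k with
  | zero => simp
  | succ k ih =>
    have h1 := ih fun j hj => h j (by omega)
    have h2 := h k (by omega)
    have h3 : 1 + u ≤ Real.exp u := by linarith [Real.add_one_le_exp u]
    have h4 : Real.exp (u * ((k + 1 : ℕ) : ℝ)) = Real.exp u * Real.exp (u * k) := by
      rw [← Real.exp_add]; congr 1; push_cast; ring
    have h5 : 1 ≤ Real.exp (u * ((k + 1 : ℕ) : ℝ)) := Real.one_le_exp (by positivity)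
    have h6 : (1 + u) * a k ≤ Real.exp u * (Real.exp (u * k) * (a 0 + v * k)) := by
      refine (mul_le_mul_of_nonneg_left h1 (by positivity)).trans ?_
      exact mul_le_mul_of_nonneg_right h3 (by positivity)
    rw [h4] at h5 ⊢
    push_cast
    nlinarith [mul_le_mul_of_nonneg_right h5 hv]

theorem integral_le_of_lintegral_le {Ω : Type*} [MeasurableSpace Ω] {μ : Measure Ω} {a w : Ω → ℝ}
    (ha : AEStronglyMeasurable a μ) (ha0 : ∀ ω, 0 ≤ a ω) (hw : Integrable w μ)
    (hw0 : ∀ ω, 0 ≤ w ω) {c : ℝ} (hc : 0 ≤ c)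
    (h : ∫⁻ ω, ENNReal.ofReal (a ω) ∂μ
      ≤ ENNReal.ofReal c * ∫⁻ ω, ENNReal.ofReal (w ω) ∂μ) :
    Integrable a μ ∧ ∫ ω, a ω ∂μ ≤ c * ∫ ω, w ω ∂μ := by
  have hwi : 0 ≤ ∫ ω, w ω ∂μ := integral_nonneg hw0
  rw [← ofReal_integral_eq_lintegral_ofReal hw (Filter.Eventually.of_forall hw0),
    ← ENNReal.ofReal_mul hc] at h
  refine ⟨⟨ha, ?_⟩, ?_⟩
  · rw [hasFiniteIntegral_iff_ofReal (Filter.Eventually.of_forall ha0)]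
    exact h.trans_lt ENNReal.ofReal_lt_top
  · rw [integral_eq_lintegral_of_nonneg_ae (Filter.Eventually.of_forall ha0) ha]
    exact ENNReal.toReal_le_of_le_ofReal (by positivity) h

/-- The assumptions on the objective and its components that the analysis uses. -/
structure Assumptions {n : ℕ} {Ξ : Type*} [MeasurableSpace Ξ] (P : Measure Ξ)
    (f : E n → Ξ → ℝ) (F : E n → ℝ) (L₀ L₁ G₀ G₁ M₀ M₁ K₀ K₁ δ : ℝ) : Prop where
  L₀_nonneg : 0 ≤ L₀
  L₁_nonneg : 0 ≤ L₁
  G₀_nonneg : 0 ≤ G₀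
  G₁_nonneg : 0 ≤ G₁
  M₀_nonneg : 0 ≤ M₀
  M₁_nonneg : 0 ≤ M₁
  K₀_nonneg : 0 ≤ K₀
  K₁_nonneg : 0 ≤ K₁
  δ_pos : 0 < δ
  objective : IsStochasticObjective P f F
  smooth : GeneralizedSmooth F L₀ L₁
  gradient_variance : GradientVarianceBounded P f F G₀ G₁
  second_order : SecondOrderGeneralizedSmooth F δ M₀ M₁
  hessian_variance : HessianVarianceBounded P f F K₀ K₁

/-- The relations between trust radius, batch sizes and epoch length that the analysis uses. -/
structure Params.Balanced (p : Params) (n : ℕ) (Δ L₁ δ : ℝ) : Prop where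
  pos : 0 < Δ
  le_one : Δ ≤ 1
  mul_le_one : L₁ * Δ ≤ 1
  le_δ : Δ ≤ δ
  radius_eq : p.radius = Δ
  S₁_le : 1 ≤ p.S₁ * Δ ^ 4
  S₂_le : 22 * Real.log n ≤ p.S₂ * Δ ^ 2
  S₃_le : 1 ≤ p.S₃ * Δ ^ 3
  q_pos : 0 < p.q
  q_mul_le : p.q * Δ ≤ 2

/-- The coefficient of the gradient norm in the error weight of an epoch. -/
noncomputable def epochSlope (L₁ G₁ K₁ : ℝ) : ℝ :=
  G₁ + 8 * Real.exp (2 * L₁) * (K₁ + L₁)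

/-- The constant term in the error weight of an epoch. -/
noncomputable def epochOffset (L₀ L₁ G₀ K₀ K₁ : ℝ) : ℝ :=
  1 + G₀ + 4 * (K₀ + L₀ + (K₁ + L₁) * (4 * Real.exp (2 * L₁) * L₀ + L₀))

/-- The coefficient of the expected gradient norm in the error of one step. -/
noncomputable def stepSlope (L₁ G₁ M₁ K₁ : ℝ) : ℝ :=
  6 * epochSlope L₁ G₁ K₁ * Real.exp (2 * L₁) + 8 * K₁ + 6 * M₁

/-- The constant term in the error of one step. -/
noncomputable def stepOffset (L₀ L₁ G₀ G₁ M₀ M₁ K₀ K₁ : ℝ) : ℝ :=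
  6 * (epochOffset L₀ L₁ G₀ K₀ K₁ + 2 * epochSlope L₁ G₁ K₁ * Real.exp (2 * L₁) * L₀)
    + 4 * (1 + K₀ + K₁ * L₀) + 3 * (M₀ + M₁ * L₀)

theorem stepSlope_nonneg {L₁ G₁ M₁ K₁ : ℝ} (hL₁ : 0 ≤ L₁) (hG₁ : 0 ≤ G₁) (hM₁ : 0 ≤ M₁)
    (hK₁ : 0 ≤ K₁) : 0 ≤ stepSlope L₁ G₁ M₁ K₁ := by
  unfold stepSlope epochSlope; positivity

theorem stepOffset_nonneg {L₀ L₁ G₀ G₁ M₀ M₁ K₀ K₁ : ℝ} (hL₀ : 0 ≤ L₀) (hL₁ : 0 ≤ L₁)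
    (hG₀ : 0 ≤ G₀) (hG₁ : 0 ≤ G₁) (hM₀ : 0 ≤ M₀) (hM₁ : 0 ≤ M₁) (hK₀ : 0 ≤ K₀) (hK₁ : 0 ≤ K₁) :
    0 ≤ stepOffset L₀ L₁ G₀ G₁ M₀ M₁ K₀ K₁ := by
  unfold stepOffset epochOffset epochSlope; positivity

section Progress

variable {n : ℕ} {Ξ Ω : Type*} [MeasurableSpace Ξ] [mΩ : MeasurableSpace Ω] {P : Measure Ξ}
  {f : E n → Ξ → ℝ} {F : E n → ℝ} {x₀ : E n} {p : Params} {T : ℕ} {μ : Measure Ω}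
  {L₀ L₁ G₀ G₁ M₀ M₁ K₀ K₁ δ Δ : ℝ}

theorem Run.norm_sub_le (R : Run P f F x₀ p T μ) {t : ℕ} (ht : t ≤ T) (ω : Ω) :
    ‖R.x t ω - x₀‖ ≤ t * p.radius := by
  induction t with
  | zero => simp [R.x_zero]
  | succ t ih =>
    have h1 := ih (by omega)
    have h2 := (R.step t (by omega) ω).1
    have h3 := norm_add_le (R.x (t + 1) ω - R.x t ω) (R.x t ω - x₀)
    rw [sub_add_sub_cancel] at h3
    push_cast
    linarith

/-- Steps are no longer than the trust radius, so `x t` stays in a fixed compact ball, on which `φ`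
is bounded. -/
theorem Run.integrable_comp [IsProbabilityMeasure μ] (R : Run P f F x₀ p T μ) {t : ℕ}
    (ht : t ≤ T) {φ : E n → ℝ} (hφ : Continuous φ) :
    Integrable (fun ω => φ (R.x t ω)) μ := by
  obtain ⟨C, hC⟩ := (isCompact_closedBall x₀ (t * p.radius)).exists_bound_of_continuousOn
    hφ.continuousOn
  refine Integrable.of_bound (C := C)
    (hφ.measurable.comp ((R.x_measurable t ht).mono (R.ℱ.le t) le_rfl)).aestronglyMeasurable
    (Filter.Eventually.of_forall fun ω => hC _ ?_)
  rw [mem_closedBall_iff_norm]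
  exact R.norm_sub_le ht ω

theorem Assumptions.gradient_step_le (h : Assumptions P f F L₀ L₁ G₀ G₁ M₀ M₁ K₀ K₁ δ)
    (hp : p.Balanced n Δ L₁ δ) (R : Run P f F x₀ p T μ) {t : ℕ} (ht : t < T) (ω : Ω) :
    ‖gradient F (R.x t ω)‖ ≤ (1 + L₁ * Δ) * ‖gradient F (R.x (t + 1) ω)‖ + L₀ * Δ ∧
    ‖gradient F (R.x (t + 1) ω)‖ ≤ (1 + L₁ * Δ) * ‖gradient F (R.x t ω)‖ + L₀ * Δ := by
  have hs : ‖R.x (t + 1) ω - R.x t ω‖ ≤ Δ := by rw [← hp.radius_eq]; exact (R.step t ht ω).1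
  exact ⟨h.smooth.norm_gradient_le h.L₀_nonneg h.L₁_nonneg hp.mul_le_one hs,
    h.smooth.norm_gradient_le h.L₀_nonneg h.L₁_nonneg hp.mul_le_one
      (by rwa [norm_sub_rev])⟩

theorem exp_growth_le {L₀ L₁ Δ a b : ℝ} {k : ℕ} (hL₀ : 0 ≤ L₀) (hL₁ : 0 ≤ L₁)
    (hk : k * Δ ≤ 2) (ha : 0 ≤ a)
    (h : b ≤ Real.exp (L₁ * Δ * k) * (a + L₀ * Δ * k)) :
    b ≤ Real.exp (2 * L₁) * (a + 2 * L₀) := by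
  have h1 : L₁ * Δ * k ≤ 2 * L₁ := by nlinarith
  have h2 : L₀ * Δ * k ≤ 2 * L₀ := by nlinarith
  calc b ≤ Real.exp (L₁ * Δ * k) * (a + L₀ * Δ * k) := h
    _ ≤ Real.exp (L₁ * Δ * k) * (a + 2 * L₀) := by gcongr
    _ ≤ _ := by gcongr

/-- Grönwall run backwards and forwards in time. The forward bound lets a weight frozen at the start
dominate the epoch; the backward bound charges that weight to a later gradient. The case `k = p.q`
is included because the iterate after the last step of an epoch is needed. -/
theorem Assumptions.gradient_epoch_le (h : Assumptions P f F L₀ L₁ G₀ G₁ M₀ M₁ K₀ K₁ δ)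
    (hp : p.Balanced n Δ L₁ δ) (R : Run P f F x₀ p T μ) {t k : ℕ} (ht : t + k ≤ T)
    (hk : k ≤ p.q) (ω : Ω) :
    ‖gradient F (R.x t ω)‖ ≤ Real.exp (2 * L₁) * (‖gradient F (R.x (t + k) ω)‖ + 2 * L₀) ∧
    ‖gradient F (R.x (t + k) ω)‖ ≤ Real.exp (2 * L₁) * (‖gradient F (R.x t ω)‖ + 2 * L₀) := by
  have hΔ := hp.pos
  have hL₀ := h.L₀_nonneg
  have hL₁ := h.L₁_nonneg
  have hkΔ : k * Δ ≤ 2 := by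
    refine le_trans ?_ hp.q_mul_le
    gcongr
  constructor
  · have h1 := le_exp_mul_of_affine_growth (a := fun j => ‖gradient F (R.x (t + (k - j)) ω)‖)
      (u := L₁ * Δ) (v := L₀ * Δ) (by positivity) (by positivity) (k := k)
      (fun j hj => by
        have := (h.gradient_step_le hp R (t := t + (k - (j + 1))) (by omega) ω).1
        rwa [show t + (k - (j + 1)) + 1 = t + (k - j) by omega] at this)
      (norm_nonneg _)
    simp only [Nat.sub_self, add_zero, Nat.sub_zero] at h1
    exact exp_growth_le hL₀ hL₁ hkΔ (norm_nonneg _) h1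
  · have h1 := le_exp_mul_of_affine_growth (a := fun j => ‖gradient F (R.x (t + j) ω)‖)
      (u := L₁ * Δ) (v := L₀ * Δ) (by positivity) (by positivity) (k := k)
      (fun j hj => (h.gradient_step_le hp R (t := t + j) (by omega) ω).2)
      (norm_nonneg _)
    simp only [add_zero] at h1
    exact exp_growth_le hL₀ hL₁ hkΔ (norm_nonneg _) h1

variable [IsProbabilityMeasure P] [IsProbabilityMeasure μ]

theorem Run.integral_gradient_error_le (R : Run P f F x₀ p T μ)
    (h : Assumptions P f F L₀ L₁ G₀ G₁ M₀ M₁ K₀ K₁ δ) (hp : p.Balanced n Δ L₁ δ)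
    {t : ℕ} (ht : t < T) :
    Integrable (fun ω => ‖R.g t ω - gradient F (R.x t ω)‖) μ ∧
    ∫ ω, ‖R.g t ω - gradient F (R.x t ω)‖ ∂μ
      ≤ 2 * Δ ^ 2 * (epochOffset L₀ L₁ G₀ K₀ K₁ + epochSlope L₁ G₁ K₁ * (Real.exp (2 * L₁) *
        (∫ ω, ‖gradient F (R.x (t + 1) ω)‖ ∂μ + 2 * L₀))) := by
  have hL₀ := h.L₀_nonneg
  have hL₁ := h.L₁_nonneg
  have hG₀ := h.G₀_nonneg
  have hG₁ := h.G₁_nonneg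
  have hK₀ := h.K₀_nonneg
  have hK₁ := h.K₁_nonneg
  have hΔ := hp.pos
  have hgc : Continuous fun x => ‖gradient F x‖ := h.second_order.1.continuous_gradient.norm
  have hgF : Measurable (gradient F) := h.second_order.1.continuous_gradient.measurable
  set B₀ := epochOffset L₀ L₁ G₀ K₀ K₁ with hB₀
  set B₁ := epochSlope L₁ G₁ K₁ with hB₁
  have hB₀0 : 0 < B₀ := by rw [hB₀, epochOffset]; positivity
  have hB₁0 : 0 ≤ B₁ := by rw [hB₁, epochSlope]; positivity
  set s := p.q * (t / p.q) with hs
  set k := t % p.q with hk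
  have hsk : s + k = t := Nat.div_add_mod t p.q
  have hkq : k < p.q := Nat.mod_lt _ hp.q_pos
  have hsq : s % p.q = 0 := Nat.mul_mod_right _ _
  have hkΔ : k * Δ ≤ 2 := by
    refine le_trans ?_ hp.q_mul_le
    gcongr
  -- `s` is the last restart before or at `t`. The weight must be measurable at time `s` to remain a
  -- constant for every batch of the epoch.
  set W : Ω → ℝ := fun ω => B₀ + B₁ * ‖gradient F (R.x s ω)‖ with hW
  have hWpos : ∀ ω, 0 < W ω := fun ω => by positivity
  have hwm : Measurable fun x => B₀ + B₁ * ‖gradient F x‖ := by fun_prop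
  have hWm : Measurable[R.ℱ s] W := hwm.comp (R.x_measurable s (by omega))
  have key := R.lintegral_gradient_error_le h.objective h.second_order.1 hL₀ hL₁ hG₀ hG₁ hK₀ hK₁
    hΔ hp.le_one hp.mul_le_one hp.radius_eq h.smooth h.gradient_variance h.hessian_variance
    hp.S₁_le hp.S₃_le hsq hkq hkΔ (by omega) hWm hWpos
    (fun ω => by
      have hg := norm_nonneg (gradient F (R.x s ω))
      have : 0 ≤ 8 * Real.exp (2 * L₁) * (K₁ + L₁) * ‖gradient F (R.x s ω)‖ := by positivity
      have : 0 ≤ 4 * (K₀ + L₀ + (K₁ + L₁) * (4 * Real.exp (2 * L₁) * L₀ + L₀)) := by positivity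
      simp only [hW, hB₀, hB₁, epochOffset, epochSlope]
      linarith)
    (fun j hj ω => by
      have h1 := (h.gradient_epoch_le hp R (t := s) (k := j) (by omega) (by omega) ω).2
      have h2 := mul_le_mul_of_nonneg_left h1 (by positivity : 0 ≤ 8 * (K₁ + L₁))
      have : 0 ≤ G₁ * ‖gradient F (R.x s ω)‖ := by positivity
      simp only [hW, hB₀, hB₁, epochOffset, epochSlope]
      linarith)
  rw [hsk] at key
  have hWi : Integrable W μ :=
    R.integrable_comp (by omega) (φ := fun x => B₀ + B₁ * ‖gradient F x‖) (by fun_prop)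
  have hmeas : Measurable fun ω => ‖R.g t ω - gradient F (R.x t ω)‖ :=
    (((R.measurable_g h.objective ht).mono (R.ℱ.le _) le_rfl).sub
      (hgF.comp ((R.x_measurable t ht.le).mono (R.ℱ.le _) le_rfl))).norm
  obtain ⟨hI, hle⟩ := integral_le_of_lintegral_le hmeas.aestronglyMeasurable
    (fun ω => norm_nonneg _) hWi (fun ω => (hWpos ω).le) (by positivity) key
  refine ⟨hI, hle.trans ?_⟩
  refine mul_le_mul_of_nonneg_left ?_ (by positivity)
  have hI1 : Integrable (fun ω => ‖gradient F (R.x (t + 1) ω)‖) μ := R.integrable_comp ht hgc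
  have hI2 : Integrable (fun ω => ‖gradient F (R.x (t + 1) ω)‖ + 2 * L₀) μ :=
    hI1.add (integrable_const _)
  calc ∫ ω, W ω ∂μ ≤ ∫ ω, (B₀ + B₁ * (Real.exp (2 * L₁) *
        (‖gradient F (R.x (t + 1) ω)‖ + 2 * L₀))) ∂μ := by
        refine integral_mono hWi ((integrable_const _).add ((hI2.const_mul _).const_mul _)) ?_
        intro ω
        have h1 := (h.gradient_epoch_le hp R (t := s) (k := k + 1) (by omega) (by omega) ω).1
        rw [show s + (k + 1) = t + 1 by omega] at h1
        simp only [hW]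
        gcongr
    _ = _ := by
        rw [integral_add (integrable_const _) ((hI2.const_mul _).const_mul _), integral_const_mul,
          integral_const_mul, integral_add hI1 (integrable_const _)]
        simp

theorem Run.integral_hessian_error_le (R : Run P f F x₀ p T μ) (hn : 2 ≤ n)
    (h : Assumptions P f F L₀ L₁ G₀ G₁ M₀ M₁ K₀ K₁ δ) (hp : p.Balanced n Δ L₁ δ)
    {t : ℕ} (ht : t < T) :
    Integrable (fun ω => ‖R.H t ω - hessian F (R.x t ω)‖) μ ∧
    ∫ ω, ‖R.H t ω - hessian F (R.x t ω)‖ ∂μ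
      ≤ 2 * Δ * (1 + K₀ + K₁ * ∫ ω, ‖gradient F (R.x t ω)‖ ∂μ) := by
  have hK₀ := h.K₀_nonneg
  have hK₁ := h.K₁_nonneg
  have hΔ := hp.pos
  have hgc : Continuous fun x => ‖gradient F x‖ := h.second_order.1.continuous_gradient.norm
  have hhc := h.second_order.continuous_hessian h.δ_pos
  have hxm : Measurable (R.x t) := (R.x_measurable t ht.le).mono (R.ℱ.le _) le_rfl
  have key := R.lintegral_hessian_error_le hn h.objective h.second_order.1 hhc hK₀ hK₁ hΔ
    h.hessian_variance hp.S₂_le ht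
  have hHm : Measurable (R.H t) := by
    rw [show R.H t = fun ω => hessian (batchFun f fun j => R.hessSample t j ω) (R.x t ω) from
      funext (R.H_eq t ht)]
    exact h.objective.measurable_batch_hessian hxm
      fun j => (R.hessSample_measurable t ht j).mono (R.ℱ.le _) le_rfl
  have hmeas : Measurable fun ω => ‖R.H t ω - hessian F (R.x t ω)‖ :=
    (hHm.sub (hhc.measurable.comp hxm)).norm
  have hI1 : Integrable (fun ω => ‖gradient F (R.x t ω)‖) μ := R.integrable_comp ht.le hgc
  have hWi : Integrable (fun ω => 1 + K₀ + K₁ * ‖gradient F (R.x t ω)‖) μ :=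
    (integrable_const _).add (hI1.const_mul _)
  obtain ⟨hI, hle⟩ := integral_le_of_lintegral_le hmeas.aestronglyMeasurable
    (fun ω => norm_nonneg _) hWi (fun ω => by positivity) (by positivity) key
  refine ⟨hI, hle.trans (le_of_eq ?_)⟩
  rw [integral_add (integrable_const _) (hI1.const_mul _), integral_const_mul]
  simp

/-- Expected progress of one iteration. -/
theorem Run.integral_step_progress (R : Run P f F x₀ p T μ) (hn : 2 ≤ n)
    (h : Assumptions P f F L₀ L₁ G₀ G₁ M₀ M₁ K₀ K₁ δ) (hp : p.Balanced n Δ L₁ δ)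
    {t : ℕ} (ht : t < T) {φ : E n → ℝ} (hφ : Continuous φ)
    (hstep : ∀ ω, φ (R.x (t + 1) ω) ≤ 2 * (F (R.x t ω) - F (R.x (t + 1) ω))
      + 3 * Δ * ‖R.g t ω - gradient F (R.x t ω)‖ + 2 * Δ ^ 2 * ‖R.H t ω - hessian F (R.x t ω)‖
      + 3 * Δ ^ 3 * (M₀ + M₁ * ‖gradient F (R.x t ω)‖)) :
    ∫ ω, φ (R.x (t + 1) ω) ∂μ
      ≤ 2 * (∫ ω, F (R.x t ω) ∂μ - ∫ ω, F (R.x (t + 1) ω) ∂μ)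
        + Δ ^ 3 * (stepOffset L₀ L₁ G₀ G₁ M₀ M₁ K₀ K₁
          + stepSlope L₁ G₁ M₁ K₁ * ∫ ω, ‖gradient F (R.x (t + 1) ω)‖ ∂μ) := by
  have hM₁ := h.M₁_nonneg
  have hK₁ := h.K₁_nonneg
  have hL₀ := h.L₀_nonneg
  have hΔ := hp.pos
  have hgc : Continuous fun x => ‖gradient F x‖ := h.second_order.1.continuous_gradient.norm
  have hFc : Continuous F := h.second_order.1.1.continuous
  obtain ⟨he, hele⟩ := R.integral_gradient_error_le h hp ht
  obtain ⟨hH, hHle⟩ := R.integral_hessian_error_le hn h hp ht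
  have hF0 : Integrable (fun ω => F (R.x t ω)) μ := R.integrable_comp ht.le hFc
  have hF1 : Integrable (fun ω => F (R.x (t + 1) ω)) μ := R.integrable_comp ht hFc
  have hg0 : Integrable (fun ω => ‖gradient F (R.x t ω)‖) μ := R.integrable_comp ht.le hgc
  have hg1 : Integrable (fun ω => ‖gradient F (R.x (t + 1) ω)‖) μ := R.integrable_comp ht hgc
  have hi1 : Integrable (fun ω => 2 * (F (R.x t ω) - F (R.x (t + 1) ω))) μ :=
    (hF0.sub hF1).const_mul 2
  have hi2 : Integrable (fun ω => 2 * (F (R.x t ω) - F (R.x (t + 1) ω))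
      + 3 * Δ * ‖R.g t ω - gradient F (R.x t ω)‖) μ := hi1.add (he.const_mul _)
  have hi3 : Integrable (fun ω => 2 * (F (R.x t ω) - F (R.x (t + 1) ω))
      + 3 * Δ * ‖R.g t ω - gradient F (R.x t ω)‖
      + 2 * Δ ^ 2 * ‖R.H t ω - hessian F (R.x t ω)‖) μ := hi2.add (hH.const_mul _)
  have hi4 : Integrable (fun ω => M₀ + M₁ * ‖gradient F (R.x t ω)‖) μ :=
    (integrable_const _).add (hg0.const_mul _)
  have hmono := integral_mono (R.integrable_comp ht hφ) (hi3.add (hi4.const_mul (3 * Δ ^ 3))) hstep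
  simp only [Pi.add_apply] at hmono
  rw [integral_add hi3 (hi4.const_mul _), integral_add hi2 (hH.const_mul _),
    integral_add hi1 (he.const_mul _), integral_const_mul, integral_const_mul, integral_const_mul,
    integral_const_mul, integral_sub hF0 hF1, integral_add (integrable_const _) (hg0.const_mul _),
    integral_const_mul, integral_const] at hmono
  simp only [probReal_univ, one_smul] at hmono
  -- Progress is measured at `x_{t+1}`, so gradient terms at `x_t` are converted to that point in
  -- order to be absorbed.
  have hgle : ∫ ω, ‖gradient F (R.x t ω)‖ ∂μ
      ≤ 2 * ∫ ω, ‖gradient F (R.x (t + 1) ω)‖ ∂μ + L₀ := by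
    have : ∫ ω, ‖gradient F (R.x t ω)‖ ∂μ
        ≤ ∫ ω, (2 * ‖gradient F (R.x (t + 1) ω)‖ + L₀) ∂μ := by
      refine integral_mono hg0 ((hg1.const_mul _).add (integrable_const _)) fun ω => ?_
      have h1 := (h.gradient_step_le hp R ht ω).1
      have h2 := norm_nonneg (gradient F (R.x (t + 1) ω))
      have h3 := mul_le_mul_of_nonneg_right hp.mul_le_one h2
      have h4 := mul_le_mul_of_nonneg_left hp.le_one hL₀
      simp only
      linarith
    rw [integral_add (hg1.const_mul _) (integrable_const _), integral_const_mul] at this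
    simpa using this
  set g' := ∫ ω, ‖gradient F (R.x (t + 1) ω)‖ ∂μ
  set g := ∫ ω, ‖gradient F (R.x t ω)‖ ∂μ
  set B₀ := epochOffset L₀ L₁ G₀ K₀ K₁ with hB₀
  set B₁ := epochSlope L₁ G₁ K₁ with hB₁
  have b1 := mul_le_mul_of_nonneg_left hele (by positivity : 0 ≤ 3 * Δ)
  have b2 := mul_le_mul_of_nonneg_left hHle (by positivity : 0 ≤ 2 * Δ ^ 2)
  have b3 := mul_le_mul_of_nonneg_left (mul_le_mul_of_nonneg_left hgle hK₁)
    (by positivity : 0 ≤ 4 * Δ ^ 3)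
  have b4 := mul_le_mul_of_nonneg_left (mul_le_mul_of_nonneg_left hgle hM₁)
    (by positivity : 0 ≤ 3 * Δ ^ 3)
  rw [stepOffset, stepSlope, ← hB₀, ← hB₁]
  linarith

/-- The averaged stationarity guarantees of a run. -/
theorem Run.sum_integral_le (R : Run P f F x₀ p T μ) (hn : 2 ≤ n)
    (h : Assumptions P f F L₀ L₁ G₀ G₁ M₀ M₁ K₀ K₁ δ) (hp : p.Balanced n Δ L₁ δ)
    (hQ : stepSlope L₁ G₁ M₁ K₁ * Δ ^ 2 ≤ 1 / 2) {a : ℝ} (ha : 0 < a)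
    (hT : a * (F x₀ - ⨅ x, F x) ≤ T * Δ ^ 3) :
    ∑ t ∈ Finset.range T, ∫ ω, ‖gradient F (R.x (t + 1) ω)‖ ∂μ
      ≤ T * ((4 / a + 2 * stepOffset L₀ L₁ G₀ G₁ M₀ M₁ K₀ K₁) * Δ ^ 2) ∧
    -∑ t ∈ Finset.range T, ∫ ω, lambdaMin (hessian F (R.x (t + 1) ω)) ∂μ
      ≤ T * ((4 / a + 2 * stepOffset L₀ L₁ G₀ G₁ M₀ M₁ K₀ K₁) * Δ) := by
  have hΔ := hp.pos
  set Q₁ := stepSlope L₁ G₁ M₁ K₁ with hQ₁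
  set Q₀ := stepOffset L₀ L₁ G₀ G₁ M₀ M₁ K₀ K₁ with hQ₀
  have hQ₁0 : 0 ≤ Q₁ :=
    stepSlope_nonneg h.L₁_nonneg h.G₁_nonneg h.M₁_nonneg h.K₁_nonneg
  have hQ₀0 : 0 ≤ Q₀ := stepOffset_nonneg h.L₀_nonneg h.L₁_nonneg h.G₀_nonneg h.G₁_nonneg
    h.M₀_nonneg h.M₁_nonneg h.K₀_nonneg h.K₁_nonneg
  have hgc : Continuous fun x => ‖gradient F x‖ := h.second_order.1.continuous_gradient.norm
  have hFc : Continuous F := h.second_order.1.1.continuous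
  have hlc := h.second_order.continuous_lambdaMin_hessian (by omega : 0 < n) h.δ_pos
  have hpt : ∀ t < T, ∀ ω, _ := fun t ht ω =>
    step_progress (by omega : 0 < n) h.M₀_nonneg h.M₁_nonneg hΔ hp.le_δ h.second_order
      (x := R.x t ω) (y := R.x (t + 1) ω) (g := R.g t ω) (H := R.H t ω)
      (by rw [R.H_eq t ht]; exact hessian_batchFun_isSymmetric h.objective.twiceDifferentiable _ _)
      (by have := R.step t ht ω; rwa [hp.radius_eq] at this)
  set γ : ℕ → ℝ := fun t => ∫ ω, ‖gradient F (R.x (t + 1) ω)‖ ∂μ with hγ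
  set Φ : ℕ → ℝ := fun t => ∫ ω, F (R.x t ω) ∂μ with hΦ
  set Λ : ℕ → ℝ := fun t => ∫ ω, lambdaMin (hessian F (R.x (t + 1) ω)) ∂μ with hΛ
  have hγ0 : ∀ t, 0 ≤ γ t := fun t => integral_nonneg fun ω => norm_nonneg _
  have hstep1 : ∀ t ∈ Finset.range T,
      Δ * γ t ≤ 4 * (Φ t - Φ (t + 1)) + 2 * (Δ ^ 3 * Q₀) := by
    intro t ht
    rw [Finset.mem_range] at ht
    have h1 := R.integral_step_progress hn h hp ht (φ := fun x => Δ * ‖gradient F x‖)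
      (by fun_prop) (fun ω => (hpt t ht ω).1)
    rw [integral_const_mul] at h1
    -- Half of the left side absorbs the error proportional to the gradient; this is the purpose of
    -- `hQ`.
    have h2 : Δ ^ 3 * (Q₁ * γ t) ≤ 1 / 2 * (Δ * γ t) := by
      have := mul_le_mul_of_nonneg_right hQ (mul_nonneg hΔ.le (hγ0 t))
      linarith
    simp only [hγ, hΦ] at h2 ⊢
    linarith
  have hstep2 : ∀ t ∈ Finset.range T,
      -(Δ ^ 2 * Λ t) ≤ 2 * (Φ t - Φ (t + 1)) + Δ ^ 3 * Q₀ + Δ ^ 3 * Q₁ * γ t := by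
    intro t ht
    rw [Finset.mem_range] at ht
    have h1 := R.integral_step_progress hn h hp ht
      (φ := fun x => -(Δ ^ 2 * lambdaMin (hessian F x)))
      (by fun_prop) (fun ω => (hpt t ht ω).2)
    rw [integral_neg, integral_const_mul] at h1
    simp only [hγ, hΦ, hΛ]
    linarith
  -- The lower bound on `T` converts the total decrease of `F` into `T Δ³ / a`.
  have htel : ∑ t ∈ Finset.range T, (Φ t - Φ (t + 1)) ≤ T * Δ ^ 3 / a := by
    rw [Finset.sum_range_sub', le_div_iff₀ ha]
    have h0 : Φ 0 = F x₀ := by simp [hΦ, R.x_zero]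
    have hT' : (⨅ x, F x) ≤ Φ T := by
      have := integral_mono (integrable_const (⨅ x, F x)) (R.integrable_comp le_rfl hFc)
        (μ := μ) fun ω => ciInf_le h.objective.bddBelow (R.x T ω)
      simpa using this
    rw [h0]
    nlinarith
  have hsum1 := Finset.sum_le_sum hstep1
  have hsum2 := Finset.sum_le_sum hstep2
  rw [Finset.sum_add_distrib, ← Finset.mul_sum, ← Finset.mul_sum, Finset.sum_const,
    Finset.card_range, nsmul_eq_mul] at hsum1
  rw [Finset.sum_add_distrib, Finset.sum_add_distrib, Finset.sum_neg_distrib, ← Finset.mul_sum,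
    ← Finset.mul_sum, ← Finset.mul_sum, Finset.sum_const, Finset.card_range, nsmul_eq_mul,
    ← Finset.mul_sum] at hsum2
  set S := ∑ t ∈ Finset.range T, γ t with hS
  set D := ∑ t ∈ Finset.range T, (Φ t - Φ (t + 1)) with hD
  set Z := ∑ t ∈ Finset.range T, Λ t with hZ
  have hres1 : Δ * S ≤ Δ * (T * ((4 / a + 2 * Q₀) * Δ ^ 2)) := by
    have : Δ * (T * ((4 / a + 2 * Q₀) * Δ ^ 2))
        = 4 * (T * Δ ^ 3 / a) + T * (2 * (Δ ^ 3 * Q₀)) := by field_simp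
    rw [this]
    linarith
  have hres1' := le_of_mul_le_mul_left hres1 hΔ
  refine ⟨hres1', ?_⟩
  have hres2 : Δ ^ 2 * (-Z) ≤ Δ ^ 2 * (T * ((4 / a + 2 * Q₀) * Δ)) := by
    have e1 : Δ ^ 2 * (T * ((4 / a + 2 * Q₀) * Δ))
        = 4 * (T * Δ ^ 3 / a) + 2 * (T * (Δ ^ 3 * Q₀)) := by field_simp
    -- Here the gradient error is not absorbed but estimated by the first conclusion; the two
    -- contributions add up to the same constant.
    have h3 : Δ ^ 3 * Q₁ * S ≤ 1 / 2 * (Δ * S) := by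
      have hS0 : 0 ≤ S := Finset.sum_nonneg fun t _ => hγ0 t
      have := mul_le_mul_of_nonneg_right hQ (mul_nonneg hΔ.le hS0)
      linarith
    have e2 : Δ * (T * ((4 / a + 2 * Q₀) * Δ ^ 2))
        = 4 * (T * Δ ^ 3 / a) + 2 * (T * (Δ ^ 3 * Q₀)) := by field_simp
    rw [e1]
    rw [e2] at hres1
    linarith
  exact le_of_mul_le_mul_left hres2 (by positivity)

end Progress

/-! ### The random output index -/

theorem uniformOn_range_singleton {T t : ℕ} (ht : t < T) :
    uniformOn (Finset.range T : Set ℕ) {t} = (T : ENNReal)⁻¹ := by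
  rw [uniformOn, cond_apply (Finset.measurableSet _), Measure.count_apply_finset,
    Set.inter_eq_self_of_subset_right (by simpa using ht), Measure.count_singleton,
    Finset.card_range, mul_one]

/-- Decompose over the events `tbar = t`; independence factors each term, and each event has
probability `1 / T`. -/
theorem integral_random_index {α Ω : Type*} [MeasurableSpace α] [MeasurableSpace Ω]
    {μ : Measure Ω} [IsProbabilityMeasure μ] {T : ℕ} {x : ℕ → Ω → α}
    {tbar : Ω → ℕ} (htm : Measurable tbar)
    (hlaw : μ.map tbar = uniformOn (Finset.range T : Set ℕ))
    (hind : IndepFun tbar (fun ω (t : Fin (T + 1)) => x t ω) μ)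
    {φ : α → ℝ} (hφ : Measurable φ) (hI : ∀ t ≤ T, Integrable (fun ω => φ (x t ω)) μ) :
    Integrable (fun ω => φ (x (tbar ω + 1) ω)) μ ∧
    ∫ ω, φ (x (tbar ω + 1) ω) ∂μ
      = (T : ℝ)⁻¹ * ∑ t ∈ Finset.range T, ∫ ω, φ (x (t + 1) ω) ∂μ := by
  set χ : ℕ → ℕ → ℝ := fun t s => Set.indicator {t} (fun _ => 1) s with hχ
  have hlt : ∀ᵐ ω ∂μ, tbar ω < T := by
    have h1 : ∀ᵐ s ∂(μ.map tbar), s ∈ (Finset.range T : Set ℕ) := by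
      rw [hlaw, uniformOn]
      exact ae_cond_mem (Finset.measurableSet _)
    have h2 := ae_of_ae_map htm.aemeasurable h1
    filter_upwards [h2] with ω hω
    simpa using hω
  have hprob : ∀ t < T, ∫ ω, χ t (tbar ω) ∂μ = (T : ℝ)⁻¹ := by
    intro t ht
    rw [← integral_map (f := χ t) htm.aemeasurable (by fun_prop), hlaw]
    change ∫ y, Set.indicator {t} (1 : ℕ → ℝ) y ∂_ = _
    rw [integral_indicator_one (measurableSet_singleton t), Measure.real,
      uniformOn_range_singleton ht]
    simp
  have hχI : ∀ t, Integrable (fun ω => χ t (tbar ω)) μ := by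
    intro t
    refine Integrable.of_bound (C := 1) (by fun_prop) (Filter.Eventually.of_forall fun ω => ?_)
    simp only [hχ, Set.indicator]
    split_ifs <;> simp
  have hindt : ∀ t < T, IndepFun (fun ω => χ t (tbar ω)) (fun ω => φ (x (t + 1) ω)) μ := by
    intro t ht
    have hm : Measurable fun v : Fin (T + 1) → α => φ (v ⟨t + 1, by omega⟩) := by fun_prop
    exact hind.comp (φ := χ t) (by fun_prop) hm
  have hprodI : ∀ t ∈ Finset.range T,
      Integrable (fun ω => χ t (tbar ω) * φ (x (t + 1) ω)) μ := by
    intro t ht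
    have ht' := Finset.mem_range.mp ht
    exact (hindt t ht').integrable_mul (hχI t) (hI (t + 1) ht')
  have hae : (fun ω => φ (x (tbar ω + 1) ω))
      =ᵐ[μ] fun ω => ∑ t ∈ Finset.range T, χ t (tbar ω) * φ (x (t + 1) ω) := by
    filter_upwards [hlt] with ω hω
    rw [Finset.sum_eq_single (tbar ω)]
    · simp [hχ]
    · intro t _ hne
      simp [hχ, Set.indicator, hne.symm]
    · intro hn
      exact absurd (Finset.mem_range.mpr hω) hn
  refine ⟨(integrable_finsetSum _ hprodI).congr hae.symm, ?_⟩
  rw [integral_congr_ae hae, integral_finsetSum _ hprodI, Finset.mul_sum]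
  refine Finset.sum_congr rfl fun t ht => ?_
  have ht' := Finset.mem_range.mp ht
  rw [(hindt t ht').integral_fun_mul_eq_mul_integral (hχI t).aestronglyMeasurable
    (hI (t + 1) ht').aestronglyMeasurable, hprob t ht']

/-! ### The parameters of the method -/

theorem sq_rpow_neg {Δ : ℝ} (hΔ : 0 < Δ) (k : ℕ) : (Δ ^ 2) ^ (-(k : ℝ) / 2) = (Δ ^ k)⁻¹ := by
  rw [← Real.rpow_natCast Δ 2, ← Real.rpow_mul hΔ.le, ← Real.rpow_natCast Δ k,
    ← Real.rpow_neg hΔ.le]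
  congr 1
  push_cast
  ring

theorem rpow_eq_sqrt_pow {ε : ℝ} (hε : 0 < ε) :
    ε ^ (-1 / 2 : ℝ) = (√ε)⁻¹ ∧ ε ^ (-3 / 2 : ℝ) = (√ε ^ 3)⁻¹ ∧ ε ^ (-2 : ℝ) = (√ε ^ 4)⁻¹ ∧
      ε ^ (-5 / 2 : ℝ) = (√ε ^ 5)⁻¹ ∧ ε ^ (-3 : ℝ) = (√ε ^ 6)⁻¹ := by
  have hΔ : 0 < √ε := Real.sqrt_pos.mpr hε
  have key : ∀ k : ℕ, ε ^ (-(k : ℝ) / 2) = (√ε ^ k)⁻¹ := by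
    intro k
    have := sq_rpow_neg hΔ k
    rwa [Real.sq_sqrt hε.le] at this
  refine ⟨?_, ?_, ?_, ?_, ?_⟩
  · simpa using key 1
  · simpa using key 3
  · have := key 4
    norm_num at this ⊢
    exact this
  · simpa using key 5
  · have := key 6
    norm_num at this ⊢
    exact this

theorem balanced_soParams {n : ℕ} {ε L₁ δ : ℝ} (hε : 0 < ε)
    (h1 : √ε ≤ 1) (hL : L₁ * √ε ≤ 1) (hδ : √ε ≤ δ) :
    (soParams n ε).Balanced n (√ε) L₁ δ := by
  have hΔ : 0 < √ε := Real.sqrt_pos.mpr hε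
  obtain ⟨e1, e3, e4, -, -⟩ := rpow_eq_sqrt_pow hε
  refine ⟨hΔ, h1, hL, hδ, rfl, ?_, ?_, ?_, ?_, ?_⟩
  · have : (√ε ^ 4)⁻¹ ≤ ((soParams n ε).S₁ : ℝ) := by rw [← e4]; exact Nat.le_ceil _
    rwa [inv_le_iff_one_le_mul₀ (by positivity)] at this
  · have : 22 * Real.log n * ε⁻¹ ≤ ((soParams n ε).S₂ : ℝ) := Nat.le_ceil _
    rw [Real.sq_sqrt hε.le]
    rwa [← div_eq_mul_inv, div_le_iff₀ hε] at this
  · have : (√ε ^ 3)⁻¹ ≤ ((soParams n ε).S₃ : ℝ) := by rw [← e3]; exact Nat.le_ceil _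
    rwa [inv_le_iff_one_le_mul₀ (by positivity)] at this
  · refine Nat.ceil_pos.mpr ?_
    rw [e1]; positivity
  · have : ((soParams n ε).q : ℝ) < (√ε)⁻¹ + 1 := by
      rw [← e1]
      exact Nat.ceil_lt_add_one (by positivity)
    calc ((soParams n ε).q : ℝ) * √ε ≤ ((√ε)⁻¹ + 1) * √ε := by gcongr
      _ = 1 + √ε := by field_simp
      _ ≤ 2 := by linarith

/-- At most `T / q + 1` iterations are restarts; charging `S₃` to every iteration as well only
overcounts. -/
theorem totalSamples_le (p : Params) (hq : 0 < p.q) (T : ℕ) :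
    p.totalSamples T ≤ (T / p.q + 1) * p.S₁ + T * p.S₃ + T * p.S₂ := by
  have hgrad : ∑ t ∈ Finset.range T, p.gradBatch t ≤ (T / p.q + 1) * p.S₁ + T * p.S₃ := by
    calc ∑ t ∈ Finset.range T, p.gradBatch t
        ≤ ∑ t ∈ Finset.range T, ((if t % p.q = 0 then p.S₁ else 0) + p.S₃) := by
          refine Finset.sum_le_sum fun t _ => ?_
          unfold Params.gradBatch
          split_ifs <;> omega
      _ = (Nat.count (fun t => t % p.q = 0) T) * p.S₁ + T * p.S₃ := by
          rw [Finset.sum_add_distrib, ← Finset.sum_filter, Finset.sum_const, Finset.sum_const,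
            Finset.card_range, Nat.count_eq_card_filter_range, smul_eq_mul, smul_eq_mul]
      _ ≤ _ := by
          gcongr
          have : Nat.count (fun t => t ≡ 0 [MOD p.q]) T ≤ T / p.q + 1 := by
            rw [Nat.count_modEq_card T hq]
            split_ifs <;> omega
          exact this
  unfold Params.totalSamples
  rw [Finset.sum_add_distrib, Finset.sum_const, Finset.card_range, smul_eq_mul]
  omega

theorem totalSamples_soParams_le {n : ℕ} (hn : 2 ≤ n) {ε b ΔF : ℝ} (hε : 0 < ε) (hb : 0 < b)
    (h1 : √ε ≤ 1) {T : ℕ} (hT : (T : ℝ) ≤ b * ΔF * ε ^ (-3 / 2 : ℝ)) (hΔF : ε ≤ ΔF) :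
    ((soParams n ε).totalSamples T : ℝ)
      ≤ (4 * b + 2 + 24 * b) * (ΔF * ε ^ (-3 : ℝ) + Real.log n * ΔF * ε ^ (-5 / 2 : ℝ)) := by
  have hΔ : 0 < √ε := Real.sqrt_pos.mpr hε
  set Δ := √ε with hΔdef
  have hεΔ : ε = Δ ^ 2 := (Real.sq_sqrt hε.le).symm
  obtain ⟨e1, e3, e4, e5, e6⟩ := rpow_eq_sqrt_pow hε
  rw [← hΔdef] at e1 e3 e4 e5 e6
  have hF0 : 0 < ΔF := hε.trans_le hΔF
  have hlog2 : (0.69 : ℝ) ≤ Real.log n :=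
    (by linarith [Real.log_two_gt_d9] : (0.69 : ℝ) ≤ Real.log 2).trans
      (Real.log_le_log (by norm_num) (by exact_mod_cast hn))
  set u := Δ⁻¹ with hu
  have hu1 : 1 ≤ u := (one_le_inv₀ hΔ).mpr h1
  rw [e3] at hT
  rw [e5, e6]
  simp only [← inv_pow, ← hu] at hT ⊢
  have hS₁ : ((soParams n ε).S₁ : ℝ) ≤ 2 * u ^ 4 := by
    have h0 : ((soParams n ε).S₁ : ℝ) < ε ^ (-2 : ℝ) + 1 := Nat.ceil_lt_add_one (by positivity)
    rw [e4, ← inv_pow, ← hu] at h0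
    linarith [one_le_pow₀ hu1 (n := 4)]
  have hS₃ : ((soParams n ε).S₃ : ℝ) ≤ 2 * u ^ 3 := by
    have h0 : ((soParams n ε).S₃ : ℝ) < ε ^ (-3 / 2 : ℝ) + 1 :=
      Nat.ceil_lt_add_one (by positivity)
    rw [e3, ← inv_pow, ← hu] at h0
    linarith [one_le_pow₀ hu1 (n := 3)]
  -- Rounding up costs at most `1 ≤ 2 log n * u ^ 2`, because `log n ≥ 0.69` and `u ≥ 1`.
  have hS₂ : ((soParams n ε).S₂ : ℝ) ≤ 24 * Real.log n * u ^ 2 := by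
    have h0 : ((soParams n ε).S₂ : ℝ) < 22 * Real.log n * ε⁻¹ + 1 :=
      Nat.ceil_lt_add_one (by positivity)
    have he : ε⁻¹ = u ^ 2 := by rw [hu, inv_pow, ← hεΔ]
    rw [he] at h0
    nlinarith [one_le_pow₀ hu1 (n := 2)]
  have hq : u ≤ ((soParams n ε).q : ℝ) := by
    rw [← e1]; exact Nat.le_ceil _
  have hqpos : 0 < (soParams n ε).q := by
    have : (0 : ℝ) < (soParams n ε).q := by linarith
    exact_mod_cast this
  have hdiv : ((T / (soParams n ε).q : ℕ) : ℝ) ≤ b * ΔF * u ^ 2 := by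
    refine Nat.cast_div_le.trans ?_
    rw [div_le_iff₀ (by linarith)]
    calc (T : ℝ) ≤ b * ΔF * u ^ 3 := hT
      _ = b * ΔF * u ^ 2 * u := by ring
      _ ≤ _ := by gcongr
  -- The condition `ε ≤ ΔF` pays for the possibly incomplete last epoch.
  have hΔFu : 1 ≤ ΔF * u ^ 2 := by
    have : ε * u ^ 2 = 1 := by rw [hεΔ, hu]; field_simp
    rw [← this]
    gcongr
  have hcast : ((soParams n ε).totalSamples T : ℝ)
      ≤ ((T / (soParams n ε).q : ℕ) + 1) * (soParams n ε).S₁ + T * (soParams n ε).S₃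
        + T * (soParams n ε).S₂ := by
    exact_mod_cast totalSamples_le _ hqpos T
  refine hcast.trans ?_
  have b1 : (((T / (soParams n ε).q : ℕ) : ℝ) + 1) * (soParams n ε).S₁
      ≤ (b * ΔF * u ^ 2 + ΔF * u ^ 2) * (2 * u ^ 4) := by gcongr
  have b2 : (T : ℝ) * (soParams n ε).S₃ ≤ b * ΔF * u ^ 3 * (2 * u ^ 3) := by gcongr
  have b3 : (T : ℝ) * (soParams n ε).S₂ ≤ b * ΔF * u ^ 3 * (24 * Real.log n * u ^ 2) := by gcongr
  have p1 : 0 ≤ b * (ΔF * u ^ 6) := by positivity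
  have p2 : 0 ≤ b * (Real.log n * ΔF * u ^ 5) := by positivity
  have p3 : 0 ≤ Real.log n * ΔF * u ^ 5 := by positivity
  linarith

end TrustRegion

/-! ### The main theorem -/

open TrustRegion in
theorem mainTheorem1 (L₁ G₁ M₁ K₁ δ : ℝ) (hL₁ : 0 ≤ L₁) (hG₁ : 0 ≤ G₁) (hM₁ : 0 ≤ M₁)
    (hK₁ : 0 ≤ K₁) (hδ : 0 < δ) :
    ∃ ε₀ > (0 : ℝ), ∀ L₀ G₀ M₀ K₀ a b : ℝ, 0 < L₀ → 0 ≤ G₀ → 0 < M₀ → 0 ≤ K₀ → 0 < a → 0 < b →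
    ∃ C > (0 : ℝ), ∀ (n : ℕ), 2 ≤ n →
    ∀ (Ξ : Type*) [MeasurableSpace Ξ] (P : Measure Ξ) [IsProbabilityMeasure P]
      (f : E n → Ξ → ℝ) (F : E n → ℝ),
      IsStochasticObjective P f F →
      GeneralizedSmooth F L₀ L₁ →
      GradientVarianceBounded P f F G₀ G₁ →
      SecondOrderGeneralizedSmooth F δ M₀ M₁ →
      HessianVarianceBounded P f F K₀ K₁ →
      AveragedSmooth P f F L₀ L₁ →
    ∀ (x₀ : E n) (ΔF : ℝ), ΔF = F x₀ - ⨅ x, F x →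
    ∀ (ε : ℝ), 0 < ε → ε ≤ ε₀ →
    ∀ (T : ℕ), 1 ≤ T → a * ΔF * ε ^ (-3 / 2 : ℝ) ≤ T →
      (∀ (Ω : Type*) [MeasurableSpace Ω] (μ : Measure Ω) [IsProbabilityMeasure μ]
        (R : Run P f F x₀ (soParams n ε) T μ) (tbar : Ω → ℕ),
        Measurable tbar →
        μ.map tbar = uniformOn (Finset.range T : Set ℕ) →
        IndepFun tbar (fun ω (t : Fin (T + 1)) => R.x t ω) μ →
        Integrable (fun ω => ‖gradient F (R.x (tbar ω + 1) ω)‖) μ ∧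
        ∫ ω, ‖gradient F (R.x (tbar ω + 1) ω)‖ ∂μ ≤ C * ε ∧
        Integrable (fun ω => lambdaMin (hessian F (R.x (tbar ω + 1) ω))) μ ∧
        -(C * √ε) ≤ ∫ ω, lambdaMin (hessian F (R.x (tbar ω + 1) ω)) ∂μ) ∧
      ((T : ℝ) ≤ b * ΔF * ε ^ (-3 / 2 : ℝ) → ε ≤ ΔF →
        ((soParams n ε).totalSamples T : ℝ)
          ≤ C * (ΔF * ε ^ (-3 : ℝ) + Real.log n * ΔF * ε ^ (-5 / 2 : ℝ))) := by
  have hQ₁ := stepSlope_nonneg hL₁ hG₁ hM₁ hK₁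
  set Q₁ := stepSlope L₁ G₁ M₁ K₁ with hQ₁def
  -- The four bounds ensure, in order, `√ε ≤ 1`, `√ε ≤ δ`, `L₁ √ε ≤ 1` and `Q₁ ε ≤ 1/2`; the added
  -- ones avoid division by zero.
  refine ⟨min (min 1 (δ ^ 2)) (min ((1 + L₁) ^ 2)⁻¹ (1 / (2 * (Q₁ + 1)))), by positivity, ?_⟩
  intro L₀ G₀ M₀ K₀ a b hL₀ hG₀ hM₀ hK₀ ha hb
  have hQ₀ := stepOffset_nonneg hL₀.le hL₁ hG₀ hG₁ hM₀.le hM₁ hK₀ hK₁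
  set Q₀ := stepOffset L₀ L₁ G₀ G₁ M₀ M₁ K₀ K₁ with hQ₀def
  -- The first two summands serve the stationarity bounds and the bracket the sample count.
  refine ⟨4 / a + 2 * Q₀ + (4 * b + 2 + 24 * b), by positivity, ?_⟩
  intro n hn Ξ _ P _ f F hobj hsm hgv hso hhv _ x₀ ΔF hΔF ε hε hεle T hT haT
  have hε1 : ε ≤ 1 := hεle.trans ((min_le_left _ _).trans (min_le_left _ _))
  have hεδ : ε ≤ δ ^ 2 := hεle.trans ((min_le_left _ _).trans (min_le_right _ _))
  have hεL : ε ≤ ((1 + L₁) ^ 2)⁻¹ := hεle.trans ((min_le_right _ _).trans (min_le_left _ _))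
  have hεQ : ε ≤ 1 / (2 * (Q₁ + 1)) := hεle.trans ((min_le_right _ _).trans (min_le_right _ _))
  have hΔ : 0 < √ε := Real.sqrt_pos.mpr hε
  have hsq : √ε ^ 2 = ε := Real.sq_sqrt hε.le
  have hΔ1 : √ε ≤ 1 := Real.sqrt_le_one.mpr hε1
  have hΔδ : √ε ≤ δ := (Real.sqrt_le_left hδ.le).mpr hεδ
  have hΔL : L₁ * √ε ≤ 1 := by
    have h1 : √ε ≤ (1 + L₁)⁻¹ := by
      rw [Real.sqrt_le_left (by positivity), inv_pow]; exact hεL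
    have h2 : (1 + L₁) * √ε ≤ 1 := by
      rwa [← one_div, le_div_iff₀ (by positivity), mul_comm] at h1
    nlinarith
  refine ⟨?_, fun hTb hεF => ?_⟩
  · intro Ω _ μ _ R tbar htm hlaw hind
    have hA : Assumptions P f F L₀ L₁ G₀ G₁ M₀ M₁ K₀ K₁ δ :=
      ⟨hL₀.le, hL₁, hG₀, hG₁, hM₀.le, hM₁, hK₀, hK₁, hδ, hobj, hsm, hgv, hso, hhv⟩
    have hB : (soParams n ε).Balanced n (√ε) L₁ δ := balanced_soParams hε hΔ1 hΔL hΔδ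
    have hQΔ : Q₁ * √ε ^ 2 ≤ 1 / 2 := by
      rw [hsq]
      rw [le_div_iff₀ (by positivity)] at hεQ
      nlinarith
    have hTΔ : a * (F x₀ - ⨅ x, F x) ≤ T * √ε ^ 3 := by
      rw [(rpow_eq_sqrt_pow hε).2.1, hΔF, ← div_eq_mul_inv, div_le_iff₀ (by positivity)] at haT
      exact haT
    obtain ⟨hgrad, hlam⟩ := R.sum_integral_le hn hA hB hQΔ ha hTΔ
    have hgc : Continuous fun x => ‖gradient F x‖ := hso.1.continuous_gradient.norm
    have hlc := hso.continuous_lambdaMin_hessian (by omega : 0 < n) hδ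
    obtain ⟨hI1, he1⟩ := integral_random_index htm hlaw hind hgc.measurable
      fun t ht => R.integrable_comp ht hgc
    obtain ⟨hI2, he2⟩ := integral_random_index htm hlaw hind hlc.measurable
      fun t ht => R.integrable_comp ht hlc
    have hTpos : (0 : ℝ) < T := by exact_mod_cast hT
    refine ⟨hI1, ?_, hI2, ?_⟩
    · rw [he1, inv_mul_le_iff₀ hTpos]
      refine hgrad.trans ?_
      rw [hsq]
      refine mul_le_mul_of_nonneg_left (mul_le_mul_of_nonneg_right ?_ hε.le) hTpos.le
      have : 0 ≤ 4 * b + 2 + 24 * b := by positivity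
      linarith
    · rw [he2, neg_le, ← mul_neg, inv_mul_le_iff₀ hTpos]
      refine hlam.trans ?_
      refine mul_le_mul_of_nonneg_left (mul_le_mul_of_nonneg_right ?_ hΔ.le) hTpos.le
      have : 0 ≤ 4 * b + 2 + 24 * b := by positivity
      linarith
  · refine (totalSamples_soParams_le hn hε hb hΔ1 hTb hεF).trans ?_
    have hF0 : 0 < ΔF := hε.trans_le hεF
    have hlog : 0 ≤ Real.log n := Real.log_natCast_nonneg n
    refine mul_le_mul_of_nonneg_right ?_ (by positivity)
    have : 0 ≤ 4 / a + 2 * Q₀ := by positivity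
    linarith
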